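/- Let $V$ be a complex vector space of finite dimension $n>0$ with a nonsingular symmetric bilinear form $(\;,\;)$. Let $C(V)=T(V)/\langle x\otimes x-(x,x)\rangle$ be its Clifford algebra, identified as a vector space with $\wedge V$ through $u\mapsto\gamma(u)1$, where $\gamma(x)=\varepsilon(x)+\iota(x)$ for $x\in V$ (exterior multiplication plus contraction by $(x,\cdot)$). Let $\mathrm{pr}_0:C(V)\to\wedge^0V=\mathbb C$ be the projection, $C^0(V)$ the even part, and $\alpha$ the antiautomorphism of $C(V)$ fixing $V$. Put $$\mathrm{Spin}(V)=\{g\in C^0(V): g\,\alpha(g)=1,\ gV\alpha(g)\subseteq V\},\qquad T(g)x=g\,x\,\alpha(g)\quad(x\in V),$$ and $\mathrm{Lie}\,\mathrm{Spin}(V)=\wedge^2V\subset C^0(V)$. Let $\tau:\wedge^2V\to\mathfrak{so}(V)$ be $\tau(u)x=-2\iota(x)u$, let $\Gamma(b)=(1-b)(1+b)^{-1}$ for $b\in\mathrm{End}(V)$ with $1+b$ invertible, and let $\mathrm{Spin}(V)^*$ be the Zariski open set of all $g\in\mathrm{Spin}(V)$ with $\det(1+T(g))\neq0$. Let $C^Z(V)$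 be the centralizer of $\wedge^0V+\wedge^nV$ in $C(V)$, let $\mu\in\wedge^nV$ satisfy $\mu^2=1$, and put $e_\pm=\frac12(1\pm\mu)$. Let $\sigma:C^Z(V)\to\mathrm{End}(S)$ be the spin module, i.e. the finite-dimensional module such that $e_+S$ and $e_-S$ are both irreducible. The spin representation is the restriction of $\sigma$ to $\mathrm{Spin}(V)$, with differential $\sigma|_{\wedge^2V}$. Its generalized Cayley mapping $\Phi:\mathrm{Spin}(V)\to\wedge^2V$ is defined by $$\mathrm{tr}(\sigma(\Phi(g))\sigma(y))=\mathrm{tr}(\sigma(g)\sigma(y))\qquad\text{for all }y\in\wedge^2V.$$ **Theorem.** 1. The form $(x,y)\mapsto\mathrm{tr}(\sigma(x)\sigma(y))$ on $\wedge^2V$ is nondegenerate, so that $\Phi$ is well defined. The regular function $\chi=2^{n/2}\,\mathrm{pr}_0$ on $\mathrm{Spin}(V)$ satisfies $\chi(g)^2=\det(1+T(g))$ for all $g$, i.e. $\chi(g)=\sqrt{\det(1+T(g))}$ for one choice of the square root. 2. For $g\in\mathrm{Spin}(V)^*$ one has $T(g)\in SO(V)$, $\Gamma(T(g))\in\mathfrak{so}(V)$,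 both $1\pm\Gamma(T(g))$ are invertible, $\Gamma(T(g))$ has a unique preimage under $\tau$, and $$\Phi(g)=-2\,\mathrm{pr}_0(g)\,\tau^{-1}\bigl(\Gamma(T(g))\bigr)\in\wedge^2V.$$ Thus on $\mathrm{Spin}(V)^*$ the map $\Phi$ is the classical Cayley transform $\Gamma$ up to the regular scalar factor $-2\,\mathrm{pr}_0$. 3. Let $n\ge2$. Then the affine ring $A(\mathrm{Spin}(V))$ is an integral domain, $\Phi^*:A(\wedge^2V)\to A(\mathrm{Spin}(V))$ is injective, and for the induced extension $\Phi^*:Q(\wedge^2V)\to Q(\mathrm{Spin}(V))$ of the fields of rational functions the degree is $$[Q(\mathrm{Spin}(V)):Q(\wedge^2V)]=\begin{cases}n&\text{if }n\text{ is even},\\ n-1&\text{if }n\text{ is odd}.\end{cases}$$ Moreover, identifying $Q(\wedge^2V)$ with its image, $$Q(\mathrm{Spin}(V))^{\mathrm{Spin}(V)}=Q(\wedge^2V)^{\mathrm{Spin}(V)}[\chi],\qquad Q(\mathrm{Spin}(V))=Q(\wedge^2V)[\chi],$$ where $\mathrm{Spin}(V)$ acts on itself by conjugation and on $\wedge^2V$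 by the adjoint action $X\mapsto hXh^{-1}$. -/

import Mathlib

open Module

noncomputable section

namespace CayleySpin

/-! ### Regular and rational functions -/

section Regular

variable {X Y E F : Type*} [AddCommGroup E] [Module ℂ E] [AddCommGroup F] [Module ℂ F]

/-- The affine ring `A(X)` of a subset `X` of a vector space `E`, with inclusion `j : X → E`:
the restrictions to `X` of the polynomial functions on `E`, i.e. the algebra of functions on `X`
generated by the restrictions of the linear forms on `E`. -/
def regular (j : X → E) : Subalgebra ℂ (X → ℂ) :=
  Algebra.adjoin ℂ {f | ∃ l : Dual ℂ E, f = fun x => l (j x)}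

/-- The field `Q(X)` of rational functions: the ring of fractions of the affine ring. -/
abbrev Rational (j : X → E) : Type _ := FractionRing (regular j)

/-- `Φ` is a morphism: it pulls regular functions back to regular functions. -/
def IsRegularMap (j : X → E) (k : Y → F) (Φ : X → Y) : Prop :=
  ∀ f ∈ regular k, f ∘ Φ ∈ regular j

theorem linear_mem_regular (j : X → E) (l : Dual ℂ E) : (fun x => l (j x)) ∈ regular j :=
  Algebra.subset_adjoin ⟨l, rfl⟩

theorem IsRegularMap.of_linear {j : X → E} {k : Y → F} {Φ : X → Y}
    (h : ∀ l : Dual ℂ F, (fun x => l (k (Φ x))) ∈ regular j) : IsRegularMap j k Φ := by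
  intro f hf
  induction hf using Algebra.adjoin_induction with
  | mem f hf => obtain ⟨l, rfl⟩ := hf; exact h l
  | algebraMap r => exact (regular j).algebraMap_mem r
  | add f g _ _ hf hg => exact (regular j).add_mem hf hg
  | mul f g _ _ hf hg => exact (regular j).mul_mem hf hg

/-- The cohomomorphism `Φ^* : A(Y) → A(X)`. -/
def pullback {j : X → E} {k : Y → F} {Φ : X → Y} (h : IsRegularMap j k Φ) :
    regular k →ₐ[ℂ] regular j where
  toFun f := ⟨f.1 ∘ Φ, h f.1 f.2⟩
  map_one' := rfl
  map_mul' _ _ := rfl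
  map_zero' := rfl
  map_add' _ _ := rfl
  commutes' _ := rfl

/-- The automorphism `f ↦ f ∘ e⁻¹` of `A(X)`, for a biregular bijection `e` of `X`. -/
def translate {j : X → E} (e : Equiv.Perm X) (h : IsRegularMap j j e)
    (h' : IsRegularMap j j e.symm) : regular j ≃ₐ[ℂ] regular j :=
  AlgEquiv.ofAlgHom (pullback h') (pullback h)
    (by ext f x; exact congrArg f.1 (e.apply_symm_apply x))
    (by ext f x; exact congrArg f.1 (e.symm_apply_apply x))

/-- For a group `G` (or family of parameters) acting on `X` by biregular bijections, the field of
invariants `Q(X)^G` of the induced action on `Q(X)`. -/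
def invariants {G : Type*} (j : X → E) (e : G → Equiv.Perm X)
    (h : ∀ a, IsRegularMap j j (e a)) (h' : ∀ a, IsRegularMap j j (e a).symm) :
    Subalgebra ℂ (Rational j) :=
  ⨅ a, AlgHom.equalizer
    (IsFractionRing.algEquivOfAlgEquiv (K := Rational j) (L := Rational j)
      (translate (e a) (h a) (h' a))).toAlgHom
    (AlgHom.id ℂ (Rational j))

end Regular

/-! ### The generalized Cayley mapping of a representation -/

section Cayley

variable {G 𝔤 S : Type*} [Group G] [AddCommGroup 𝔤] [Module ℂ 𝔤] [FiniteDimensional ℂ 𝔤]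
  [AddCommGroup S] [Module ℂ S]

/-- The form `B_π(X, Y) = tr (π' X ∘ π' Y)` on the Lie algebra. -/
def traceForm (π' : 𝔤 →ₗ[ℂ] End ℂ S) : LinearMap.BilinForm ℂ 𝔤 :=
  ((LinearMap.mul ℂ (End ℂ S)).compl₁₂ π' π').compr₂ (LinearMap.trace ℂ S)

open Classical in
/-- The generalized Cayley mapping `Φ_π : G → 𝔤` of a representation `π` with differential `π'`:
when `B_π` is nondegenerate, `Φ_π g` is the element of `𝔤` such that
`tr (π' (Φ_π g) ∘ π' X) = tr (π g ∘ π' X)` for all `X` in `𝔤`. It is used only in that case. -/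
def cayleyMap (π : Representation ℂ G S) (π' : 𝔤 →ₗ[ℂ] End ℂ S) (g : G) : 𝔤 :=
  if h : (traceForm π').Nondegenerate then
    ((traceForm π').toDual h).symm
      (LinearMap.trace ℂ S ∘ₗ LinearMap.mulLeft ℂ (π g) ∘ₗ π')
  else 0

theorem traceForm_apply {𝔤 S : Type*} [AddCommGroup 𝔤] [Module ℂ 𝔤] [AddCommGroup S] [Module ℂ S]
    (π' : 𝔤 →ₗ[ℂ] End ℂ S) (x y : 𝔤) :
    traceForm π' x y = LinearMap.trace ℂ S (π' x * π' y) := rfl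

theorem traceForm_cayleyMap (π : Representation ℂ G S) (π' : 𝔤 →ₗ[ℂ] End ℂ S)
    (h : (traceForm π').Nondegenerate) (g : G) (x : 𝔤) :
    LinearMap.trace ℂ S (π' (cayleyMap π π' g) * π' x) = LinearMap.trace ℂ S (π g * π' x) := by
  rw [← traceForm_apply, cayleyMap, dif_pos h, LinearMap.BilinForm.apply_toDual_symm_apply]
  rfl

end Cayley

/-! ### Clifford algebra, Spin group, spin module -/

variable {V : Type*} [AddCommGroup V] [Module ℂ V] (Q : QuadraticForm ℂ V)

/-- The symmetric bilinear form `( , )` with `(x, x) = Q x`. -/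
abbrev form : LinearMap.BilinForm ℂ V := QuadraticMap.associated Q

/-- The identification `ψ : C(V) → ∧V`, `ψ u = γ(u) 1`, where `γ(x) = ε(x) + ι(x)` for `x ∈ V`. -/
abbrev psi : CliffordAlgebra Q ≃ₗ[ℂ] ExteriorAlgebra ℂ V := CliffordAlgebra.equivExterior Q

theorem psi_one : psi Q 1 = 1 :=
  CliffordAlgebra.changeForm_one CliffordAlgebra.changeForm.associated_neg_proof

theorem psi_ι (x : V) : psi Q (CliffordAlgebra.ι Q x) = ExteriorAlgebra.ι ℂ x :=
  CliffordAlgebra.changeForm_ι CliffordAlgebra.changeForm.associated_neg_proof x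

theorem psi_ι_mul (x : V) (u : CliffordAlgebra Q) :
    psi Q (CliffordAlgebra.ι Q x * u) = ExteriorAlgebra.ι ℂ x * psi Q u
      + CliffordAlgebra.contractLeft (form Q x) (psi Q u) := by
  have h : CliffordAlgebra.contractLeft (QuadraticMap.associated (-Q) x) (psi Q u) =
      -CliffordAlgebra.contractLeft (form Q x) (psi Q u) := by
    rw [map_neg, LinearMap.neg_apply, map_neg, LinearMap.neg_apply]
  refine (CliffordAlgebra.changeForm_ι_mul
    (CliffordAlgebra.changeForm.associated_neg_proof (Q := Q)) x u).trans ?_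
  rw [← sub_neg_eq_add, ← h]
  rfl

/-- `pr₀ : C(V) → ∧⁰V = ℂ`. -/
def pr0 : CliffordAlgebra Q →ₗ[ℂ] ℂ :=
  (ExteriorAlgebra.algebraMapInv (R := ℂ) (M := V)).toLinearMap ∘ₗ (psi Q).toLinearMap

/-- `pr₁ : C(V) → ∧¹V = V`. -/
def pr1 : CliffordAlgebra Q →ₗ[ℂ] V := ExteriorAlgebra.ιInv ∘ₗ (psi Q).toLinearMap

theorem pr1_ι (x : V) : pr1 Q (CliffordAlgebra.ι Q x) = x := by
  rw [pr1, LinearMap.comp_apply, LinearEquiv.coe_coe, psi_ι]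
  exact ExteriorAlgebra.ι_leftInverse x

/-- The map `x ↦ g x α(g)` on `V`, for those `g` for which it takes values in `V`. -/
def twist (g : CliffordAlgebra Q) : V →ₗ[ℂ] V :=
  pr1 Q ∘ₗ LinearMap.mulRight ℂ (CliffordAlgebra.reverse g) ∘ₗ LinearMap.mulLeft ℂ g ∘ₗ
    CliffordAlgebra.ι Q

theorem ι_twist {g : CliffordAlgebra Q} {x : V}
    (h : ∃ y : V, g * CliffordAlgebra.ι Q x * CliffordAlgebra.reverse g = CliffordAlgebra.ι Q y) :
    CliffordAlgebra.ι Q (twist Q g x) =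
      g * CliffordAlgebra.ι Q x * CliffordAlgebra.reverse g := by
  obtain ⟨y, hy⟩ := h
  simp [twist, hy, pr1_ι]

/-- `Spin(V)`: the `g ∈ C⁰(V)` with `g α(g) = 1` and `g x α(g) ∈ V` for all `x ∈ V`, where `α` is
the antiautomorphism of `C(V)` fixing `V`; a group under Clifford multiplication. -/
def Spin [FiniteDimensional ℂ V] : Subgroup (CliffordAlgebra Q)ˣ where
  carrier := {g | (g : CliffordAlgebra Q) ∈ CliffordAlgebra.even Q ∧
    (g : CliffordAlgebra Q) * CliffordAlgebra.reverse (g : CliffordAlgebra Q) = 1 ∧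
    ∀ x : V, ∃ y : V, (g : CliffordAlgebra Q) * CliffordAlgebra.ι Q x *
      CliffordAlgebra.reverse (g : CliffordAlgebra Q) = CliffordAlgebra.ι Q y}
  one_mem' := by
    refine ⟨Subalgebra.one_mem _, by simp, fun x => ⟨x, by simp⟩⟩
  mul_mem' := by
    rintro a b ⟨ha, ha', ha''⟩ ⟨hb, hb', hb''⟩
    refine ⟨by simpa using Subalgebra.mul_mem _ ha hb, ?_, fun x => ?_⟩
    · rw [Units.val_mul, CliffordAlgebra.reverse.map_mul, mul_assoc,
        ← mul_assoc (b : CliffordAlgebra Q), hb', one_mul, ha']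
    · obtain ⟨y, hy⟩ := hb'' x
      obtain ⟨z, hz⟩ := ha'' y
      refine ⟨z, ?_⟩
      rw [← hz, ← hy, Units.val_mul, CliffordAlgebra.reverse.map_mul]
      simp only [mul_assoc]
  inv_mem' := by
    rintro g ⟨hg, hg', hg''⟩
    have hr : CliffordAlgebra.reverse (g : CliffordAlgebra Q) = ↑g⁻¹ :=
      (Units.inv_eq_of_mul_eq_one_right hg').symm
    have hr' : CliffordAlgebra.reverse (↑g⁻¹ : CliffordAlgebra Q) = g := by
      rw [← hr, CliffordAlgebra.reverse_reverse]
    refine ⟨?_, by rw [hr', Units.inv_mul], fun x => ?_⟩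
    · rw [← hr]
      exact (CliffordAlgebra.reverse_mem_evenOdd_iff Q).2 hg
    · have hinj : Function.Injective (twist Q (g : CliffordAlgebra Q)) := by
        intro a b hab
        have := congrArg (CliffordAlgebra.ι Q) hab
        rw [ι_twist Q (hg'' a), ι_twist Q (hg'' b), hr, Units.mul_left_inj,
          Units.mul_right_inj] at this
        rw [← pr1_ι Q a, this, pr1_ι]
      obtain ⟨y, rfl⟩ := LinearMap.injective_iff_surjective.1 hinj x
      refine ⟨y, ?_⟩
      rw [ι_twist Q (hg'' y), hr, hr']
      simp [mul_assoc]


/-- The vector representation `T : Spin(V) → GL(V)`, `T(g) x = g x α(g)`. -/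
def T [FiniteDimensional ℂ V] : Representation ℂ (Spin Q) V where
  toFun g := twist Q (g : (CliffordAlgebra Q)ˣ)
  map_one' := by
    ext x
    simp [twist, pr1_ι]
  map_mul' a b := by
    ext x
    have hb := ι_twist Q (b.2.2.2 x)
    simp only [Module.End.mul_apply]
    rw [← pr1_ι Q (twist Q (a : (CliffordAlgebra Q)ˣ) _), ι_twist Q (a.2.2.2 _), hb]
    simp [twist, mul_assoc]

theorem ι_T [FiniteDimensional ℂ V] (g : Spin Q) (x : V) :
    CliffordAlgebra.ι Q (T Q g x) = ((g : (CliffordAlgebra Q)ˣ) : CliffordAlgebra Q) *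
      CliffordAlgebra.ι Q x * CliffordAlgebra.reverse ((g : (CliffordAlgebra Q)ˣ) :
        CliffordAlgebra Q) :=
  ι_twist Q (g.2.2.2 x)

/-- `Z = ∧⁰V + ∧ⁿV ⊆ C(V)`, with `n = dim V`. -/
def Z : Submodule ℂ (CliffordAlgebra Q) :=
  (⋀[ℂ]^0 V ⊔ ⋀[ℂ]^(finrank ℂ V) V).comap (psi Q).toLinearMap

/-- `C^Z(V)`, the centralizer of `Z` in `C(V)`. -/
def CZ : Subalgebra ℂ (CliffordAlgebra Q) := Subalgebra.centralizer ℂ (Z Q : Set (CliffordAlgebra Q))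

section Aux

theorem involute_contract (d : Dual ℂ V) (w : ExteriorAlgebra ℂ V) :
    CliffordAlgebra.involute (CliffordAlgebra.contractLeft d w) =
      -CliffordAlgebra.contractLeft d (CliffordAlgebra.involute w) := by
  induction w using CliffordAlgebra.left_induction with
  | algebraMap r => simp
  | add x y hx hy => simp only [map_add, hx, hy, neg_add]
  | ι_mul w x hx =>
    simp only [CliffordAlgebra.contractLeft_ι_mul, map_sub, map_smul, map_mul,
      CliffordAlgebra.involute_ι, hx, neg_mul, map_neg]
    simp

theorem psi_mul_ι (u : CliffordAlgebra Q) (x : V) :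
    psi Q (u * CliffordAlgebra.ι Q x) =
      ExteriorAlgebra.ι ℂ x * CliffordAlgebra.involute (psi Q u)
        - CliffordAlgebra.contractLeft (form Q x) (CliffordAlgebra.involute (psi Q u)) := by
  induction u using CliffordAlgebra.left_induction with
  | algebraMap r =>
    rw [Algebra.algebraMap_eq_smul_one, smul_mul_assoc, one_mul, map_smul, map_smul, psi_one, psi_ι]
    simp
  | add a b ha hb =>
    simp only [add_mul, map_add, ha, hb, mul_add]
    abel
  | ι_mul u y hu =>
    rw [mul_assoc, psi_ι_mul, psi_ι_mul, hu]
    have hs : form Q x y = form Q y x := QuadraticMap.associated_isSymm ℂ Q x y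
    have ha : ExteriorAlgebra.ι ℂ x * ExteriorAlgebra.ι ℂ y =
        -(ExteriorAlgebra.ι ℂ y * ExteriorAlgebra.ι ℂ x) :=
      eq_neg_of_add_eq_zero_left (ExteriorAlgebra.ι_add_mul_swap x y)
    generalize psi Q u = w
    have e1 : CliffordAlgebra.involute (ExteriorAlgebra.ι ℂ y) = -ExteriorAlgebra.ι ℂ y :=
      CliffordAlgebra.involute_ι y
    have e2 : ∀ (d : Dual ℂ V) (z : V) (w : ExteriorAlgebra ℂ V),
        CliffordAlgebra.contractLeft d (ExteriorAlgebra.ι ℂ z * w) =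
          d z • w - ExteriorAlgebra.ι ℂ z * CliffordAlgebra.contractLeft d w :=
      fun d z w => CliffordAlgebra.contractLeft_ι_mul d z w
    rw [map_add, map_mul, e1, involute_contract]
    generalize CliffordAlgebra.involute w = w
    simp only [mul_add, mul_sub, map_add, map_sub, neg_mul, mul_neg, map_neg, e2, ← mul_assoc, ha,
      hs, CliffordAlgebra.contractLeft_comm (form Q x) (form Q y)]
    abel

theorem involute_of_mem_pow (k : ℕ) {w : ExteriorAlgebra ℂ V} (hw : w ∈ ⋀[ℂ]^k V) :
    CliffordAlgebra.involute w = (-1 : ℂ) ^ k • w := by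
  induction k generalizing w with
  | zero =>
    rw [ExteriorAlgebra.exteriorPower, pow_zero, Submodule.mem_one] at hw
    obtain ⟨r, rfl⟩ := hw
    simp
  | succ k ih =>
    rw [ExteriorAlgebra.exteriorPower, pow_succ'] at hw
    induction hw using Submodule.mul_induction_on' with
    | mem_mul_mem a ha b hb =>
      obtain ⟨x, rfl⟩ := ha
      have e1 : CliffordAlgebra.involute (ExteriorAlgebra.ι ℂ x) = -ExteriorAlgebra.ι ℂ x :=
        CliffordAlgebra.involute_ι x
      rw [map_mul, e1, ih hb, pow_succ]
      simp
    | add a _ b _ ha hb => rw [map_add, ha, hb, smul_add]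

theorem even_le_CZ [FiniteDimensional ℂ V] : CliffordAlgebra.even Q ≤ CZ Q := by
  have key : ∀ w : CliffordAlgebra Q, psi Q w ∈ ⋀[ℂ]^(finrank ℂ V) V → ∀ x : V,
      CliffordAlgebra.ι Q x * w =
        -((-1 : ℂ) ^ (finrank ℂ V) • (w * CliffordAlgebra.ι Q x)) := by
    intro w hw x
    have h0 : ExteriorAlgebra.ι ℂ x * psi Q w = 0 := by
      have hm : ExteriorAlgebra.ι ℂ x * psi Q w ∈ ⋀[ℂ]^(finrank ℂ V + 1) V := by
        rw [ExteriorAlgebra.exteriorPower, pow_succ']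
        exact Submodule.mul_mem_mul ⟨x, rfl⟩ hw
      have hb : ⋀[ℂ]^(finrank ℂ V + 1) V = ⊥ := by
        rw [← Submodule.finrank_eq_zero, exteriorPower.finrank_eq, Nat.choose_succ_self]
      rwa [hb, Submodule.mem_bot] at hm
    apply (psi Q).injective
    rw [psi_ι_mul, map_neg, map_smul, psi_mul_ι, involute_of_mem_pow _ hw, mul_smul_comm, h0,
      map_smul]
    simp [smul_smul, ← mul_pow]
  intro u hu
  rw [CZ, Subalgebra.mem_centralizer_iff]
  intro z hz
  obtain ⟨a, ha, b, hb, hab⟩ := Submodule.mem_sup.1 hz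
  rw [ExteriorAlgebra.exteriorPower, pow_zero, Submodule.mem_one] at ha
  obtain ⟨r, rfl⟩ := ha
  have hz' : z = algebraMap ℂ _ r + (psi Q).symm b := by
    apply (psi Q).injective
    rw [map_add, LinearEquiv.apply_symm_apply, Algebra.algebraMap_eq_smul_one, map_smul, psi_one,
      ← Algebra.algebraMap_eq_smul_one]
    exact hab.symm
  have hk := key ((psi Q).symm b) (by rwa [LinearEquiv.apply_symm_apply])
  generalize (psi Q).symm b = w at hz' hk
  rw [hz', add_mul, mul_add, Algebra.commutes]
  congr 1
  clear hz' hz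
  induction u, hu using CliffordAlgebra.even_induction with
  | algebraMap r => exact (Algebra.commutes r w).symm
  | add a b _ _ iha ihb => rw [mul_add, add_mul, iha, ihb]
  | ι_mul_ι_mul m₁ m₂ u _ ih =>
    have h2 : CliffordAlgebra.ι Q m₁ * CliffordAlgebra.ι Q m₂ * w =
        w * (CliffordAlgebra.ι Q m₁ * CliffordAlgebra.ι Q m₂) := by
      rw [mul_assoc, hk m₂, mul_neg, mul_smul_comm, ← mul_assoc, hk m₁, neg_mul, smul_mul_assoc]
      simp [smul_smul, ← mul_pow, mul_assoc]
    rw [mul_assoc _ u w, ← ih, ← mul_assoc _ w u, h2]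
    simp only [mul_assoc]

theorem psi_ι_mul_ι (x y : V) :
    psi Q (CliffordAlgebra.ι Q x * CliffordAlgebra.ι Q y) =
      ExteriorAlgebra.ι ℂ x * ExteriorAlgebra.ι ℂ y + algebraMap ℂ _ (form Q x y) := by
  rw [psi_ι_mul, psi_ι]
  congr 1
  exact CliffordAlgebra.contractLeft_ι (0 : QuadraticForm ℂ V) y (d := form Q x)

theorem psi_algebraMap (r : ℂ) : psi Q (algebraMap ℂ _ r) = algebraMap ℂ _ r := by
  rw [Algebra.algebraMap_eq_smul_one, map_smul, psi_one, Algebra.algebraMap_eq_smul_one]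

theorem two_le {P : Submodule ℂ (ExteriorAlgebra ℂ V)}
    (h : ∀ x y : V, ExteriorAlgebra.ι ℂ x * ExteriorAlgebra.ι ℂ y ∈ P) : ⋀[ℂ]^2 V ≤ P := by
  rw [ExteriorAlgebra.exteriorPower, pow_two, Submodule.mul_le]
  rintro _ ⟨x, rfl⟩ _ ⟨y, rfl⟩
  exact h x y

theorem psi_symm_wedge (x y : V) :
    (psi Q).symm (ExteriorAlgebra.ι ℂ x * ExteriorAlgebra.ι ℂ y) =
      CliffordAlgebra.ι Q x * CliffordAlgebra.ι Q y - algebraMap ℂ _ (form Q x y) := by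
  rw [LinearEquiv.symm_apply_eq, map_sub, psi_ι_mul_ι, psi_algebraMap, add_sub_cancel_right]

theorem psi_symm_mem_even {w : ExteriorAlgebra ℂ V} (hw : w ∈ ⋀[ℂ]^2 V) :
    (psi Q).symm w ∈ CliffordAlgebra.even Q := by
  refine two_le (P := (Subalgebra.toSubmodule (CliffordAlgebra.even Q)).comap
    (psi Q).symm.toLinearMap) (fun x y => ?_) hw
  rw [Submodule.mem_comap, LinearEquiv.coe_coe, psi_symm_wedge]
  exact Subalgebra.sub_mem _ (CliffordAlgebra.ι_mul_ι_mem_evenOdd_zero Q x y)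
    (Subalgebra.algebraMap_mem _ _)

end Aux

/-- `∧²V`, the Lie algebra of `Spin(V)`; its elements are viewed in `C(V)` through `ψ`. -/
abbrev Lie (V : Type*) [AddCommGroup V] [Module ℂ V] : Submodule ℂ (ExteriorAlgebra ℂ V) := ⋀[ℂ]^2 V

/-- The inclusion `∧²V ⊆ C^Z(V)`. -/
def lieToCZ [FiniteDimensional ℂ V] : Lie V →ₗ[ℂ] CZ Q :=
  LinearMap.codRestrict (Subalgebra.toSubmodule (CZ Q))
    ((psi Q).symm.toLinearMap ∘ₗ (Lie V).subtype)
    (fun w => even_le_CZ Q (psi_symm_mem_even Q w.2))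

/-- The inclusion `Spin(V) ⊆ C^Z(V)`. -/
def spinToCZ [FiniteDimensional ℂ V] : Spin Q →* CZ Q where
  toFun g := ⟨((g : (CliffordAlgebra Q)ˣ) : CliffordAlgebra Q), even_le_CZ Q g.2.1⟩
  map_one' := rfl
  map_mul' _ _ := rfl

section SpinModule

variable {S : Type*} [AddCommGroup S] [Module ℂ S]

/-- `W` is an irreducible subrepresentation of the representation `σ` of an algebra. -/
def IsIrreducibleSub {A : Type*} [Ring A] [Algebra ℂ A] (σ : A →ₐ[ℂ] End ℂ S)
    (W : Submodule ℂ S) : Prop :=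
  (∀ a, ∀ s ∈ W, σ a s ∈ W) ∧ W ≠ ⊥ ∧
    ∀ U : Submodule ℂ S, U ≤ W → (∀ a, ∀ s ∈ U, σ a s ∈ U) → U = ⊥ ∨ U = W

/-- `σ : C^Z(V) → End S` is the spin module. Here `μ ∈ ∧ⁿV` with `μ² = 1` is unique up to sign,
`e± = (1 ± μ)/2` are complementary central idempotents, so that `S = e₊S ⊕ e₋S`, and it is
required that both summands be irreducible. This determines `S` up to isomorphism. -/
def IsSpinModule (σ : CZ Q →ₐ[ℂ] End ℂ S) : Prop :=
  ∃ μ : CZ Q, psi Q μ ∈ ⋀[ℂ]^(finrank ℂ V) V ∧ μ * μ = 1 ∧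
    IsIrreducibleSub σ (LinearMap.range (σ ((1 / 2 : ℂ) • (1 + μ)))) ∧
    IsIrreducibleSub σ (LinearMap.range (σ ((1 / 2 : ℂ) • (1 - μ))))

variable {Q} [FiniteDimensional ℂ V]

/-- The representation `Spin` of `Spin(V)` on `S`: the restriction of `σ`. -/
def spinRep (σ : CZ Q →ₐ[ℂ] End ℂ S) : Representation ℂ (Spin Q) S :=
  (σ : CZ Q →* End ℂ S).comp (spinToCZ Q)

/-- Its differential: the restriction of `σ` to `∧²V`. -/
def spinRepDiff (σ : CZ Q →ₐ[ℂ] End ℂ S) : Lie V →ₗ[ℂ] End ℂ S :=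
  σ.toLinearMap ∘ₗ lieToCZ Q

/-- The generalized Cayley mapping `Φ : Spin(V) → ∧²V` of the representation `Spin`. -/
def Phi (σ : CZ Q →ₐ[ℂ] End ℂ S) : Spin Q → Lie V :=
  cayleyMap (spinRep σ) (spinRepDiff σ)

end SpinModule

/-! ### The classical Cayley transform -/

/-- `τ : ∧²V → so(V)`, `τ(u) x = -2 ι(x) u`. -/
def tau : Lie V →ₗ[ℂ] End ℂ V :=
  LinearMap.flip ((-2 : ℂ) • ((CliffordAlgebra.contractLeft ∘ₗ form Q).compr₂
    (ExteriorAlgebra.ιInv (R := ℂ) (M := V))).compl₂ (Lie V).subtype)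

theorem ι_tau (u : Lie V) (x : V) : ExteriorAlgebra.ι ℂ (tau Q u x) =
    (-2 : ℂ) • CliffordAlgebra.contractLeft (form Q x) (u : ExteriorAlgebra ℂ V) := by
  have h : ⋀[ℂ]^2 V ≤ LinearMap.eqLocus (ExteriorAlgebra.ι ℂ ∘ₗ ExteriorAlgebra.ιInv ∘ₗ
      CliffordAlgebra.contractLeft (form Q x)) (CliffordAlgebra.contractLeft (form Q x)) := by
    refine two_le (fun y z => ?_)
    have e : CliffordAlgebra.contractLeft (form Q x)
        (ExteriorAlgebra.ι ℂ y * ExteriorAlgebra.ι ℂ z) =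
        ExteriorAlgebra.ι ℂ (form Q x y • z - form Q x z • y) := by
      refine (CliffordAlgebra.contractLeft_ι_mul (form Q x) y _).trans ?_
      erw [CliffordAlgebra.contractLeft_ι]
      rw [map_sub, map_smul, map_smul, ← Algebra.commutes, Algebra.smul_def (form Q x z)]
    rw [LinearMap.mem_eqLocus, LinearMap.comp_apply, LinearMap.comp_apply, e,
      ExteriorAlgebra.ι_leftInverse]
  rw [← LinearMap.mem_eqLocus.1 (h u.2), LinearMap.comp_apply, ← map_smul]
  rfl

/-- `Γ(b) = (1 - b)(1 + b)⁻¹`, for `1 + b` invertible. -/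
def Gamma (b : End ℂ V) : End ℂ V := (1 - b) * Ring.inverse (1 + b)

/-- The Lie algebra `so(V)`: the skew-symmetric endomorphisms. -/
def IsSkew (s : End ℂ V) : Prop := ∀ x y : V, form Q (s x) y = -form Q x (s y)

/-- `SO(V)`. -/
def IsSO (a : End ℂ V) : Prop := (∀ x y : V, form Q (a x) (a y) = form Q x y) ∧ LinearMap.det a = 1

variable [FiniteDimensional ℂ V]

/-- The Zariski open subset `Spin(V)^*` of `Spin(V)`. -/
def SpinStar : Set (Spin Q) := {g | LinearMap.det (1 + T Q g) ≠ 0}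

/-! ### Function fields of `Spin(V)` and of its Lie algebra -/

/-- The inclusion `Spin(V) → C(V)`. -/
def spinIncl (g : Spin Q) : CliffordAlgebra Q := (g : (CliffordAlgebra Q)ˣ)

theorem form_T (g : Spin Q) (x y : V) : form Q (T Q g x) (T Q g y) = form Q x y := by
  have hQ : ∀ z, Q (T Q g z) = Q z := by
    intro z
    apply (algebraMap ℂ (ExteriorAlgebra ℂ V)).injective
    rw [← psi_algebraMap Q, ← psi_algebraMap Q, ← CliffordAlgebra.ι_sq_scalar, ι_T]
    have hr : CliffordAlgebra.reverse ((g : (CliffordAlgebra Q)ˣ) : CliffordAlgebra Q) =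
        ↑(g : (CliffordAlgebra Q)ˣ)⁻¹ := (Units.inv_eq_of_mul_eq_one_right g.2.2.1).symm
    rw [hr]
    congr 1
    simp only [mul_assoc, Units.inv_mul_cancel_left]
    rw [← mul_assoc (CliffordAlgebra.ι Q z), CliffordAlgebra.ι_sq_scalar, Algebra.commutes,
      Units.mul_inv_cancel_left]
  simp only [QuadraticMap.associated_apply, ← map_add, hQ]

/-- `Ad(h) X = h X h⁻¹` on `∧²V`, computed in `C(V)`. -/
def Ad (h : Spin Q) : Lie V →ₗ[ℂ] Lie V :=
  LinearMap.codRestrict (Lie V)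
    ((psi Q).toLinearMap ∘ₗ LinearMap.mulRight ℂ (spinIncl Q h⁻¹) ∘ₗ
      LinearMap.mulLeft ℂ (spinIncl Q h) ∘ₗ (psi Q).symm.toLinearMap ∘ₗ (Lie V).subtype)
    (by
      intro w
      refine two_le (P := (Lie V).comap ((psi Q).toLinearMap ∘ₗ
        LinearMap.mulRight ℂ (spinIncl Q h⁻¹) ∘ₗ
        LinearMap.mulLeft ℂ (spinIncl Q h) ∘ₗ (psi Q).symm.toLinearMap)) (fun x y => ?_) w.2
      have hr : CliffordAlgebra.reverse ((h : (CliffordAlgebra Q)ˣ) : CliffordAlgebra Q) =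
        ↑(h : (CliffordAlgebra Q)ˣ)⁻¹ := (Units.inv_eq_of_mul_eq_one_right h.2.2.1).symm
      have e : spinIncl Q h * (CliffordAlgebra.ι Q x * CliffordAlgebra.ι Q y -
          algebraMap ℂ _ (form Q x y)) * spinIncl Q h⁻¹ =
          (psi Q).symm (ExteriorAlgebra.ι ℂ (T Q h x) * ExteriorAlgebra.ι ℂ (T Q h y)) := by
        rw [psi_symm_wedge, form_T, ι_T, ι_T, hr, mul_sub, sub_mul]
        congr 1
        · simp [spinIncl, mul_assoc]
        · rw [← Algebra.commutes, mul_assoc]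
          simp [spinIncl]
      rw [Submodule.mem_comap]
      simp only [LinearMap.comp_apply, LinearEquiv.coe_coe, LinearMap.mulLeft_apply,
        LinearMap.mulRight_apply, psi_symm_wedge]
      rw [e, (psi Q).apply_symm_apply, Lie, ExteriorAlgebra.exteriorPower, pow_two]
      exact Submodule.mul_mem_mul (LinearMap.mem_range_self _ _) (LinearMap.mem_range_self _ _))

theorem psi_symm_Ad (h : Spin Q) (X : Lie V) :
    (psi Q).symm (Ad Q h X) = spinIncl Q h * (psi Q).symm X * spinIncl Q h⁻¹ :=
  (psi Q).symm_apply_apply _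

theorem Ad_inv_Ad (h : Spin Q) (X : Lie V) : Ad Q h⁻¹ (Ad Q h X) = X := by
  apply Subtype.ext
  apply (psi Q).symm.injective
  rw [psi_symm_Ad, psi_symm_Ad]
  simp [spinIncl, mul_assoc]

/-- The adjoint action of `Spin(V)` on its Lie algebra. -/
def adPerm (h : Spin Q) : Equiv.Perm (Lie V) where
  toFun := Ad Q h
  invFun := Ad Q h⁻¹
  left_inv := Ad_inv_Ad Q h
  right_inv X := by simpa using Ad_inv_Ad Q h⁻¹ X

/-- The action of `Spin(V)` on itself by conjugation. -/
def conjPerm (h : Spin Q) : Equiv.Perm (Spin Q) := (MulAut.conj h).toEquiv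

/-- The identity, as the inclusion of the vector space `Lie V` into itself. -/
def lieIncl (V : Type*) [AddCommGroup V] [Module ℂ V] : Lie V → Lie V := id

/-- `A(Spin(V))`. -/
abbrev ASpin : Subalgebra ℂ (Spin Q → ℂ) := regular (spinIncl Q)

/-- `A(Lie Spin(V))`, the polynomial functions on `∧²V`. -/
abbrev ALie (V : Type*) [AddCommGroup V] [Module ℂ V] : Subalgebra ℂ (Lie V → ℂ) :=
  regular (lieIncl V)

/-- `Q(Spin(V))`. -/
abbrev QSpin : Type _ := Rational (spinIncl Q)

/-- `Q(Lie Spin(V))`. -/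
abbrev QLie (V : Type*) [AddCommGroup V] [Module ℂ V] : Type _ := Rational (lieIncl V)

theorem adPerm_regular (h : Spin Q) : IsRegularMap (lieIncl V) (lieIncl V) (adPerm Q h) :=
  .of_linear fun l => linear_mem_regular (lieIncl V) (l ∘ₗ Ad Q h)

theorem adPerm_symm_regular (h : Spin Q) :
    IsRegularMap (lieIncl V) (lieIncl V) (adPerm Q h).symm :=
  .of_linear fun l => linear_mem_regular (lieIncl V) (l ∘ₗ Ad Q h⁻¹)

theorem conjPerm_regular (h : Spin Q) : IsRegularMap (spinIncl Q) (spinIncl Q) (conjPerm Q h) :=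
  .of_linear fun l => linear_mem_regular (spinIncl Q)
    (l ∘ₗ LinearMap.mulRight ℂ (spinIncl Q h⁻¹) ∘ₗ LinearMap.mulLeft ℂ (spinIncl Q h))

theorem conjPerm_symm_regular (h : Spin Q) :
    IsRegularMap (spinIncl Q) (spinIncl Q) (conjPerm Q h).symm :=
  .of_linear fun l => linear_mem_regular (spinIncl Q)
    (l ∘ₗ LinearMap.mulRight ℂ (spinIncl Q h) ∘ₗ LinearMap.mulLeft ℂ (spinIncl Q h⁻¹))

/-- `Q(Spin(V))^Spin(V)`. -/
def QSpinInv : Subalgebra ℂ (QSpin Q) :=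
  invariants (spinIncl Q) (conjPerm Q) (conjPerm_regular Q) (conjPerm_symm_regular Q)

/-- `Q(Lie Spin(V))^Spin(V)`. -/
def QLieInv : Subalgebra ℂ (QLie V) :=
  invariants (lieIncl V) (adPerm Q) (adPerm_regular Q) (adPerm_symm_regular Q)

/-- The regular function `χ = 2^{n/2} pr₀` on `Spin(V)`, with `2^{n/2} = (√2)ⁿ`. -/
def chi : ASpin Q :=
  ⟨fun g => ((√2 : ℝ) : ℂ) ^ finrank ℂ V * pr0 Q (spinIncl Q g),
    linear_mem_regular (spinIncl Q) (((√2 : ℝ) : ℂ) ^ finrank ℂ V • pr0 Q)⟩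

variable {Q}

theorem Phi_regular {S : Type*} [AddCommGroup S] [Module ℂ S] (σ : CZ Q →ₐ[ℂ] End ℂ S) :
    IsRegularMap (spinIncl Q) (lieIncl V) (Phi σ) := by
  refine .of_linear fun l => ?_
  by_cases h : (traceForm (spinRepDiff σ)).Nondegenerate
  · let L : CZ Q →ₗ[ℂ] ℂ := l ∘ₗ ((traceForm (spinRepDiff σ)).toDual h).symm.toLinearMap ∘ₗ
      (((LinearMap.mul ℂ (End ℂ S)).compl₁₂ σ.toLinearMap (spinRepDiff σ)).compr₂
        (LinearMap.trace ℂ S))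
    obtain ⟨L', hL'⟩ := LinearMap.exists_extend (p := Subalgebra.toSubmodule (CZ Q)) L
    have hf : (fun g => l (lieIncl V (Phi σ g))) = fun g => L' (spinIncl Q g) := by
      funext g
      have := LinearMap.congr_fun hL' (spinToCZ Q g)
      refine Eq.trans ?_ this.symm
      simp only [Phi, cayleyMap, dif_pos h]
      rfl
    rw [hf]
    exact linear_mem_regular _ L'
  · have hf : (fun g => l (lieIncl V (Phi σ g))) = fun _ => (0 : ℂ) := by
      funext g
      simp [Phi, cayleyMap, dif_neg h, lieIncl]
    rw [hf]
    exact (regular _).zero_mem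

/-- The cohomomorphism `Φ^* : A(Lie Spin(V)) → A(Spin(V))`. -/
def PhiStar {S : Type*} [AddCommGroup S] [Module ℂ S] (σ : CZ Q →ₐ[ℂ] End ℂ S) :
    ALie V →ₐ[ℂ] ASpin Q :=
  pullback (Phi_regular σ)

/-- The degree of the field extension given by a ring homomorphism. -/
def extensionDegree {K L : Type*} [CommRing K] [CommRing L] (φ : K →+* L) : ℕ :=
  letI := φ.toAlgebra
  finrank K L

end CayleySpin

end

open Module

set_option linter.unusedSectionVars false

noncomputable section

namespace CayleySpin

variable {V : Type*} [AddCommGroup V] [Module ℂ V] (Q : QuadraticForm ℂ V)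

/-! Everything is controlled by `pr0`, which is a trace on $C(V)$ (`pr0_mul_comm`). In an
orthonormal basis the monomials `mon` multiply by symmetric difference up to sign and are orthogonal
for `pr0`. On $C^0(V)$ the trace of the spin module is $\dim S$ times `pr0` (`trace_evenRep`).
Conjugation kills the trace of every even monomial except $1$ and, for even $n$, the top one. The
top one acts by opposite scalars on $e_+S$ and $e_-S$, and Schur orthogonality gives these halves
the same dimension. Hence the trace form is a multiple of $\mathrm{pr}_0(xy)$, and $\Phi(g)$ is the
degree-two component of $g$.

The degree-one part of $T(g)y\cdot g=g\cdot y$ is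
$\mathrm{pr}_0(g)(T(g)-1)=\frac12\tau(\Phi(g))(1+T(g))$, which is the Cayley formula wherever
$1+T(g)$ is invertible. The identity $2^n\mathrm{pr}_0(g)^2=\det(1+T(g))$ (`two_pow_mul_pr0_sq`)
comes from applying the operators $\varepsilon((1+T)y)+\iota((T-1)y)$, with $y$ running through a
basis, to $1$ and computing the top component in two ways.

Together these give, for $a=\mathrm{pr}_0(g)\ne0$ and $w=\Phi(g)$, the equation
$\det(a-\tau(w)/2)=a^{n-2}$ (`cayleyPoly`). Conversely every nonzero root $a$ over $w$ comes from
some $g$ (`exists_Phi_eq`), because products of reflections show $T$ to be onto $SO(V)$ and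
$-1\in\mathrm{Spin}(V)$ corrects the sign. This makes $\Phi^*$ injective. After removal of a factor
$X$ for odd $n$, the polynomial is irreducible, since it is so on a suitable affine line
(`exists_irreducible_factor`); its degree $2\lfloor n/2\rfloor$ is the degree of the extension.

That `pr0` and $\Phi^*$ generate the function field follows from a Pfaffian-like recursion for the
coordinates of $g$ (`pr0Fun_mul_coordFun`). For the invariants, `pr0` is a class function and $\Phi$
is equivariant, so an element is fixed exactly when its coefficients in powers of `pr0` are. Finally
$A(\mathrm{Spin}(V))$ is a domain because each $g$ is joined to $1$ by a product of irreducible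
families parametrized by nonisotropic vectors. -/

/-! ### Contractions and the projection `pr₀` -/

/-- The contraction `ι(x)` of `∧V` by `(x, ·)`. -/
def contr (x : V) : End ℂ (ExteriorAlgebra ℂ V) := CliffordAlgebra.contractLeft (form Q x)

/-- The projection `∧V → ∧⁰V = ℂ`, as a homomorphism of algebras. -/
abbrev scalarPart : ExteriorAlgebra ℂ V →ₐ[ℂ] ℂ := ExteriorAlgebra.algebraMapInv

theorem contr_ι_mul (x y : V) (u : ExteriorAlgebra ℂ V) :
    contr Q x (ExteriorAlgebra.ι ℂ y * u) =
      form Q x y • u - ExteriorAlgebra.ι ℂ y * contr Q x u :=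
  CliffordAlgebra.contractLeft_ι_mul (form Q x) y u

theorem contr_one (x : V) : contr Q x 1 = 0 :=
  CliffordAlgebra.contractLeft_one (d := form Q x) (0 : QuadraticForm ℂ V)

theorem contr_ι (x y : V) : contr Q x (ExteriorAlgebra.ι ℂ y) = algebraMap ℂ _ (form Q x y) :=
  CliffordAlgebra.contractLeft_ι (0 : QuadraticForm ℂ V) (d := form Q x) y

theorem contr_comm (x y : V) (u : ExteriorAlgebra ℂ V) :
    contr Q x (contr Q y u) = -contr Q y (contr Q x u) :=
  CliffordAlgebra.contractLeft_comm _ _ _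

theorem contr_add (x y : V) : contr Q (x + y) = contr Q x + contr Q y := by
  simp [contr]

theorem contr_smul (r : ℂ) (x : V) : contr Q (r • x) = r • contr Q x := by
  simp [contr]

theorem psi_ι_mul_contr (x : V) (u : CliffordAlgebra Q) :
    psi Q (CliffordAlgebra.ι Q x * u) = ExteriorAlgebra.ι ℂ x * psi Q u + contr Q x (psi Q u) :=
  psi_ι_mul Q x u

theorem scalarPart_ι_mul (x : V) (u : ExteriorAlgebra ℂ V) :
    scalarPart (ExteriorAlgebra.ι ℂ x * u) = 0 := by
  rw [map_mul]
  simp [ExteriorAlgebra.algebraMapInv]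

theorem scalarPart_involute (u : ExteriorAlgebra ℂ V) :
    scalarPart (CliffordAlgebra.involute u) = scalarPart u := by
  have h : (scalarPart (V := V)).comp CliffordAlgebra.involute = scalarPart := by
    apply CliffordAlgebra.hom_ext
    ext x
    have e1 : CliffordAlgebra.involute (ExteriorAlgebra.ι ℂ x) = -ExteriorAlgebra.ι ℂ x :=
      CliffordAlgebra.involute_ι x
    change scalarPart (CliffordAlgebra.involute (ExteriorAlgebra.ι ℂ x)) =
      scalarPart (ExteriorAlgebra.ι ℂ x)
    rw [e1]
    simp [ExteriorAlgebra.algebraMapInv]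
  exact DFunLike.congr_fun h u

theorem pr0_eq (u : CliffordAlgebra Q) : pr0 Q u = scalarPart (psi Q u) := rfl

theorem pr0_one : pr0 Q 1 = 1 := by rw [pr0_eq, psi_one, map_one]

theorem pr0_ι_mul (x : V) (u : CliffordAlgebra Q) :
    pr0 Q (CliffordAlgebra.ι Q x * u) = scalarPart (contr Q x (psi Q u)) := by
  rw [pr0_eq, psi_ι_mul_contr, map_add, scalarPart_ι_mul, zero_add]

theorem pr0_mul_ι (x : V) (u : CliffordAlgebra Q) :
    pr0 Q (u * CliffordAlgebra.ι Q x) = scalarPart (contr Q x (psi Q u)) := by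
  rw [pr0_eq, psi_mul_ι, map_sub, scalarPart_ι_mul, zero_sub, ← map_neg, ← involute_contract,
    scalarPart_involute]
  rfl

/-- Left and right multiplication by a vector $x$ have the same degree-zero part, the scalar part of
$\iota(x)$, because the exterior terms contribute nothing there. Moving one vector at a time around
the product gives the general case. -/
theorem pr0_mul_comm (u v : CliffordAlgebra Q) : pr0 Q (u * v) = pr0 Q (v * u) := by
  induction u using CliffordAlgebra.left_induction generalizing v with
  | algebraMap r => rw [Algebra.commutes]
  | add a b ha hb => simp only [add_mul, mul_add, map_add, ha, hb]
  | ι_mul u x hu =>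
    rw [mul_assoc, pr0_ι_mul, ← pr0_mul_ι, mul_assoc, hu, mul_assoc]

/-! ### Monomials in an orthonormal basis -/

section Monomials

variable {ι : Type*}

/-- A basis orthonormal for the bilinear form of `Q`. -/
def IsOrthonormal [DecidableEq ι] (b : Basis ι ℂ V) : Prop :=
  ∀ i j, form Q (b i) (b j) = if i = j then 1 else 0

theorem form_comm (x y : V) : form Q x y = form Q y x := QuadraticMap.associated_isSymm ℂ Q x y

theorem form_self (x : V) : form Q x x = Q x := QuadraticMap.associated_eq_self_apply ℂ Q x

theorem exists_isOrthonormal [FiniteDimensional ℂ V] (hQ : (form Q).Nondegenerate) :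
    ∃ b : Basis (Fin (finrank ℂ V)) ℂ V, IsOrthonormal Q b := by
  obtain ⟨v, hv⟩ := LinearMap.BilinForm.exists_orthogonal_basis (B := form Q)
    ⟨QuadraticMap.associated_isSymm ℂ Q⟩
  have hv' := hv.not_isOrtho_basis_self_of_separatingLeft hQ.1
  -- Square roots of $(v_i,v_i)$ exist over $\mathbb C$ and are nonzero by nondegeneracy; dividing
  -- by them normalizes the orthogonal basis.
  choose c hc using fun i => IsAlgClosed.exists_eq_mul_self (form Q (v i) (v i))
  have hc0 : ∀ i, c i ≠ 0 := fun i h => hv' i (by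
    change form Q (v i) (v i) = 0
    rw [hc, h, mul_zero])
  refine ⟨v.isUnitSMul (w := fun i => (c i)⁻¹) fun i => (inv_ne_zero (hc0 i)).isUnit, fun i j => ?_⟩
  rw [Basis.isUnitSMul_apply, Basis.isUnitSMul_apply, map_smul, map_smul, LinearMap.smul_apply]
  split_ifs with h
  · subst h
    rw [hc, smul_eq_mul, smul_eq_mul]
    field_simp [hc0 i]
  · have : form Q (v i) (v j) = 0 := hv h
    rw [this, smul_zero, smul_zero]

theorem ι_mul_self (x : V) : CliffordAlgebra.ι Q x * CliffordAlgebra.ι Q x =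
    algebraMap ℂ _ (form Q x x) := by
  rw [CliffordAlgebra.ι_sq_scalar, form_self]

theorem ι_mul_swap (x y : V) : CliffordAlgebra.ι Q x * CliffordAlgebra.ι Q y =
    -(CliffordAlgebra.ι Q y * CliffordAlgebra.ι Q x) + algebraMap ℂ _ (2 * form Q x y) := by
  have h := CliffordAlgebra.ι_mul_ι_add_swap (Q := Q) x y
  have e : QuadraticMap.polar Q x y = 2 * form Q x y := by
    rw [QuadraticMap.associated_apply, QuadraticMap.polar]
    simp
  rw [← e, ← h]
  abel

/-- Equality up to a sign. -/
def SignEq {A : Type*} [AddCommGroup A] [Module ℂ A] (u v : A) : Prop :=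
  ∃ ε : ℂ, ε * ε = 1 ∧ u = ε • v

namespace SignEq

variable {A : Type*} [Ring A] [Algebra ℂ A] {u v w u' v' : A}

theorem refl (u : A) : SignEq u u := ⟨1, by simp, by simp⟩

theorem of_neg (h : u = -v) : SignEq u v := ⟨-1, by simp, by simp [h]⟩

theorem symm (h : SignEq u v) : SignEq v u := by
  obtain ⟨ε, hε, rfl⟩ := h
  exact ⟨ε, hε, by rw [smul_smul, hε, one_smul]⟩

theorem trans (h : SignEq u v) (h' : SignEq v w) : SignEq u w := by
  obtain ⟨ε, hε, rfl⟩ := h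
  obtain ⟨δ, hδ, rfl⟩ := h'
  exact ⟨ε * δ, by linear_combination hε * (δ * δ) + hδ, smul_smul _ _ _⟩

theorem mul (h : SignEq u v) (h' : SignEq u' v') : SignEq (u * u') (v * v') := by
  obtain ⟨ε, hε, rfl⟩ := h
  obtain ⟨δ, hδ, rfl⟩ := h'
  exact ⟨ε * δ, by linear_combination hε * (δ * δ) + hδ, smul_mul_smul_comm _ _ _ _⟩

end SignEq

variable [DecidableEq ι] (b : Basis ι ℂ V)

/-- The image in `C(V)` of a vector of the basis `b`. -/
abbrev gen (i : ι) : CliffordAlgebra Q := CliffordAlgebra.ι Q (b i)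

/-- The Clifford product of a list of basis vectors. -/
def word (l : List ι) : CliffordAlgebra Q := (l.map (gen Q b)).prod

/-- The Clifford product of the basis vectors in `s`, in some order. -/
def mon (s : Finset ι) : CliffordAlgebra Q := word Q b s.toList

theorem word_nil : word Q b [] = 1 := rfl

theorem word_cons (i : ι) (l : List ι) : word Q b (i :: l) = gen Q b i * word Q b l := rfl

theorem mon_empty : mon Q b ∅ = 1 := by simp [mon, word]

variable {Q b} (hb : IsOrthonormal Q b)
include hb

theorem gen_mul_self (i : ι) : gen Q b i * gen Q b i = 1 := by
  rw [ι_mul_self, hb, if_pos rfl, map_one]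

theorem gen_mul_gen {i j : ι} (h : i ≠ j) : gen Q b i * gen Q b j = -(gen Q b j * gen Q b i) := by
  rw [ι_mul_swap, hb, if_neg h, mul_zero, map_zero, add_zero]

theorem word_perm {l l' : List ι} (h : l.Perm l') (hl : l.Nodup) :
    SignEq (word Q b l) (word Q b l') := by
  induction h with
  | nil => exact .refl _
  | cons i _ ih => exact (SignEq.refl _).mul (ih (List.nodup_cons.1 hl).2)
  | swap i j l =>
    refine .of_neg ?_
    have hij : j ≠ i := by rintro rfl; simp at hl
    rw [word_cons, word_cons, word_cons, word_cons, ← mul_assoc, gen_mul_gen hb hij, ← mul_assoc,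
      neg_mul]
  | trans h _ ih ih' => exact (ih hl).trans (ih' (h.nodup_iff.1 hl))

theorem word_signEq_mon {l : List ι} (hl : l.Nodup) : SignEq (word Q b l) (mon Q b l.toFinset) :=
  word_perm hb ((List.toFinset_toList hl).symm) hl

theorem gen_mul_mon_of_notMem {i : ι} {s : Finset ι} (h : i ∉ s) :
    SignEq (gen Q b i * mon Q b s) (mon Q b (insert i s)) := by
  have := word_signEq_mon hb (l := i :: s.toList) (by simp [h, s.nodup_toList])
  rwa [List.toFinset_cons, Finset.toList_toFinset] at this

theorem gen_mul_mon_of_mem {i : ι} {s : Finset ι} (h : i ∈ s) :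
    SignEq (gen Q b i * mon Q b s) (mon Q b (s.erase i)) := by
  have := ((SignEq.refl (gen Q b i)).mul (gen_mul_mon_of_notMem hb (s.notMem_erase i))).symm
  rwa [← mul_assoc, gen_mul_self hb, one_mul, Finset.insert_erase h] at this

theorem gen_mul_mon (i : ι) (s : Finset ι) :
    SignEq (gen Q b i * mon Q b s) (mon Q b (symmDiff {i} s)) := by
  by_cases h : i ∈ s
  · convert gen_mul_mon_of_mem hb h using 2
    ext j; simp only [Finset.mem_symmDiff, Finset.mem_singleton, Finset.mem_erase]; grind
  · convert gen_mul_mon_of_notMem hb h using 2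
    ext j; simp only [Finset.mem_symmDiff, Finset.mem_singleton, Finset.mem_insert]; grind

/-- Distinct letters anticommute and equal letters cancel because $e_i^2=1$. Up to sign the
monomials thus form an elementary abelian 2-group. -/
theorem mon_mul_mon (s t : Finset ι) :
    SignEq (mon Q b s * mon Q b t) (mon Q b (symmDiff s t)) := by
  induction s using Finset.induction_on with
  | empty => rw [mon_empty, one_mul, ← Finset.bot_eq_empty, bot_symmDiff]; exact .refl _
  | insert i s hi ih =>
    refine ((gen_mul_mon_of_notMem hb hi).symm.mul (.refl _)).trans ?_
    rw [mul_assoc]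
    refine ((SignEq.refl _).mul ih).trans ((gen_mul_mon hb _ _).trans ?_)
    rw [← symmDiff_assoc]
    have e : symmDiff {i} s = insert i s := by
      ext j; simp only [Finset.mem_symmDiff, Finset.mem_singleton, Finset.mem_insert]; grind
    rw [e]
    exact .refl _

theorem gen_mul_word (i : ι) {l : List ι} (hl : l.Nodup) :
    gen Q b i * word Q b l =
      ((-1) ^ l.length * if i ∈ l then -1 else 1 : ℂ) • (word Q b l * gen Q b i) := by
  induction l with
  | nil => simp [word_nil]
  | cons j l ih =>
    obtain ⟨hj, hl'⟩ := List.nodup_cons.1 hl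
    rw [word_cons]
    by_cases h : i = j
    · subst h
      have := ih hl'
      rw [if_neg hj, mul_one] at this
      rw [mul_assoc, this, List.length_cons, if_pos List.mem_cons_self, pow_succ, mul_smul_comm]
      simp
    · rw [← mul_assoc, gen_mul_gen hb h, neg_mul, mul_assoc, ih hl', mul_smul_comm, mul_assoc,
        ← neg_smul, List.length_cons, pow_succ]
      simp only [List.mem_cons, h, false_or]
      congr 1
      ring

theorem gen_mul_mon_comm (i : ι) (s : Finset ι) :
    gen Q b i * mon Q b s =
      ((-1) ^ s.card * if i ∈ s then -1 else 1 : ℂ) • (mon Q b s * gen Q b i) := by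
  have := gen_mul_word hb i s.nodup_toList
  rwa [Finset.length_toList, if_congr Finset.mem_toList rfl rfl] at this

/-- When $(x,y)=0$, the contraction $\iota(x)$ anticommutes with both $\varepsilon(y)$ and
$\iota(y)$, and it kills $1$. -/
theorem contr_psi_word (x : V) {l : List ι} (h : ∀ i ∈ l, form Q x (b i) = 0) :
    contr Q x (psi Q (word Q b l)) = 0 := by
  induction l with
  | nil => rw [word_nil, psi_one, contr_one]
  | cons j l ih =>
    have := ih fun i hi => h i (List.mem_cons_of_mem _ hi)
    rw [word_cons, psi_ι_mul_contr, map_add, contr_ι_mul, h j List.mem_cons_self, contr_comm, this]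
    simp

theorem contr_psi_word_of_notMem {i : ι} {l : List ι} (h : i ∉ l) :
    contr Q (b i) (psi Q (word Q b l)) = 0 :=
  contr_psi_word hb _ fun j hj => by rw [hb, if_neg]; rintro rfl; exact h hj

theorem contr_psi_mon_of_notMem {i : ι} {s : Finset ι} (h : i ∉ s) :
    contr Q (b i) (psi Q (mon Q b s)) = 0 :=
  contr_psi_word_of_notMem hb (by simpa using h)

theorem psi_word_cons {i : ι} {l : List ι} (h : i ∉ l) :
    psi Q (word Q b (i :: l)) = ExteriorAlgebra.ι ℂ (b i) * psi Q (word Q b l) := by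
  rw [word_cons, psi_ι_mul_contr, contr_psi_word_of_notMem hb h, add_zero]

theorem pr0_mon {s : Finset ι} (h : s ≠ ∅) : pr0 Q (mon Q b s) = 0 := by
  have hl : s.toList ≠ [] := by simpa using h
  obtain ⟨i, l, hil⟩ := List.exists_cons_of_ne_nil hl
  have hn := s.nodup_toList
  rw [hil] at hn
  rw [mon, hil, pr0_eq, psi_word_cons hb (List.nodup_cons.1 hn).1, scalarPart_ι_mul]

theorem pr0_mon_mul_mon {s t : Finset ι} (h : s ≠ t) : pr0 Q (mon Q b s * mon Q b t) = 0 := by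
  obtain ⟨ε, -, he⟩ := mon_mul_mon hb s t
  rw [he, map_smul, pr0_mon hb, smul_zero]
  rwa [← Finset.bot_eq_empty, Ne, symmDiff_eq_bot]

theorem exists_sq_mon (s : Finset ι) :
    ∃ ε : ℂ, ε * ε = 1 ∧ mon Q b s * mon Q b s = algebraMap ℂ _ ε := by
  obtain ⟨ε, hε, he⟩ := mon_mul_mon hb s s
  refine ⟨ε, hε, ?_⟩
  rw [he, symmDiff_self, Finset.bot_eq_empty, mon_empty, Algebra.algebraMap_eq_smul_one]

theorem span_mon : Submodule.span ℂ (Set.range (mon Q b)) = ⊤ := by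
  rw [eq_top_iff]
  rintro u -
  have hgen : ∀ i, ∀ v ∈ Submodule.span ℂ (Set.range (mon Q b)),
      gen Q b i * v ∈ Submodule.span ℂ (Set.range (mon Q b)) := by
    intro i v hv
    induction hv using Submodule.span_induction with
    | mem v hv =>
      obtain ⟨s, rfl⟩ := hv
      obtain ⟨ε, -, he⟩ := gen_mul_mon hb i s
      rw [he]
      exact Submodule.smul_mem _ _ (Submodule.subset_span ⟨_, rfl⟩)
    | zero => rw [mul_zero]; exact zero_mem _
    | add v w _ _ hv hw => rw [mul_add]; exact add_mem hv hw
    | smul r v _ hv => rw [mul_smul_comm]; exact Submodule.smul_mem _ _ hv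
  induction u using CliffordAlgebra.left_induction with
  | algebraMap r =>
    rw [Algebra.algebraMap_eq_smul_one, ← mon_empty Q b]
    exact Submodule.smul_mem _ _ (Submodule.subset_span ⟨_, rfl⟩)
  | add u v hu hv => exact add_mem hu hv
  | ι_mul u x hu =>
    rw [← b.linearCombination_repr x, Finsupp.linearCombination_apply, Finsupp.sum, map_sum,
      Finset.sum_mul]
    refine sum_mem fun i _ => ?_
    rw [map_smul, smul_mul_assoc]
    exact Submodule.smul_mem _ _ (hgen i u hu)

variable [Fintype ι]

/-- Expansion of an element of `C(V)` in the monomials. -/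
theorem eq_sum_mon (u : CliffordAlgebra Q) :
    u = ∑ s, (pr0 Q (mon Q b s * mon Q b s) * pr0 Q (mon Q b s * u)) • mon Q b s := by
  -- The first factor of the coefficient is the sign $e_s^2=\pm1$, which is its own inverse; by
  -- orthogonality the second factor extracts the coefficient up to that sign.
  have hu : u ∈ Submodule.span ℂ (Set.range (mon Q b)) := by rw [span_mon hb]; trivial
  induction hu using Submodule.span_induction with
  | mem v hv =>
    obtain ⟨t, rfl⟩ := hv
    rw [Finset.sum_eq_single t]
    · obtain ⟨ε, hε, he⟩ := exists_sq_mon hb t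
      rw [he, Algebra.algebraMap_eq_smul_one, map_smul, pr0_one, smul_eq_mul, mul_one, hε, one_smul]
    · intro s _ hst
      rw [pr0_mon_mul_mon hb hst, mul_zero, zero_smul]
    · simp
  | zero => simp
  | add v w _ _ hv hw =>
    simp only [mul_add, map_add, add_smul, Finset.sum_add_distrib]
    rw [← hv, ← hw]
  | smul r v _ hv =>
    simp only [mul_smul_comm, map_smul, smul_eq_mul, mul_left_comm _ r]
    simp only [mul_smul r]
    rw [← Finset.smul_sum, ← hv]

theorem sum_form_smul (x : V) : ∑ i, form Q (b i) x • b i = x := by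
  refine Eq.trans (Finset.sum_congr rfl fun i _ => ?_) (b.sum_repr x)
  congr 1
  conv_lhs => rw [← b.sum_repr x]
  have hi : ∀ j, form Q (b i) (b j) = if i = j then 1 else 0 := hb i
  simp only [map_sum, map_smul, hi]
  simp

end Monomials

/-! ### Parity -/

theorem psi_involute (u : CliffordAlgebra Q) :
    psi Q (CliffordAlgebra.involute u) = CliffordAlgebra.involute (psi Q u) := by
  induction u using CliffordAlgebra.left_induction with
  | algebraMap r => rw [AlgHom.commutes, psi_algebraMap, AlgHom.commutes]
  | add a b ha hb => simp only [map_add, ha, hb]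
  | ι_mul u x hu =>
    have e1 : CliffordAlgebra.involute (ExteriorAlgebra.ι ℂ x) = -ExteriorAlgebra.ι ℂ x :=
      CliffordAlgebra.involute_ι x
    have e2 : CliffordAlgebra.involute (contr Q x (psi Q u)) =
      -contr Q x (CliffordAlgebra.involute (psi Q u)) := involute_contract _ _
    rw [map_mul, CliffordAlgebra.involute_ι, neg_mul, map_neg, psi_ι_mul_contr, hu,
      psi_ι_mul_contr, map_add, map_mul, e1, e2]
    rw [neg_add, neg_mul]

theorem pr0_of_odd {u : CliffordAlgebra Q} (hu : u ∈ CliffordAlgebra.evenOdd Q 1) :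
    pr0 Q u = 0 := by
  have h : pr0 Q (CliffordAlgebra.involute u) = pr0 Q u := by
    rw [pr0_eq, psi_involute, scalarPart_involute, pr0_eq]
  rw [CliffordAlgebra.involute_eq_of_mem_odd hu, map_neg] at h
  linear_combination -h / 2

section Parity

variable {ι : Type*} [DecidableEq ι] {Q} {b : Basis ι ℂ V}

theorem word_parity (l : List ι) :
    (Even l.length → word Q b l ∈ CliffordAlgebra.evenOdd Q 0) ∧
      (Odd l.length → word Q b l ∈ CliffordAlgebra.evenOdd Q 1) := by
  induction l with
  | nil => exact ⟨fun _ => (CliffordAlgebra.even Q).one_mem, by simp⟩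
  | cons i l ih =>
    rw [word_cons, List.length_cons, Nat.even_add_one, Nat.odd_add_one, Nat.not_even_iff_odd,
      Nat.not_odd_iff_even]
    exact ⟨fun h => CliffordAlgebra.evenOdd_mul_le Q 1 1
        (Submodule.mul_mem_mul (CliffordAlgebra.ι_mem_evenOdd_one Q _) (ih.2 h)),
      fun h => CliffordAlgebra.evenOdd_mul_le Q 1 0
        (Submodule.mul_mem_mul (CliffordAlgebra.ι_mem_evenOdd_one Q _) (ih.1 h))⟩

theorem mon_mem_even {s : Finset ι} (h : Even s.card) : mon Q b s ∈ CliffordAlgebra.even Q :=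
  (word_parity s.toList).1 (by simpa using h)

theorem mon_mem_odd {s : Finset ι} (h : Odd s.card) : mon Q b s ∈ CliffordAlgebra.evenOdd Q 1 :=
  (word_parity s.toList).2 (by simpa using h)

theorem pr0_mon_mul_of_even {s : Finset ι} (h : Odd s.card) {u : CliffordAlgebra Q}
    (hu : u ∈ CliffordAlgebra.even Q) : pr0 Q (mon Q b s * u) = 0 :=
  pr0_of_odd Q (CliffordAlgebra.evenOdd_mul_le Q 1 0 (Submodule.mul_mem_mul (mon_mem_odd h) hu))

theorem pr0_mon_mul_of_odd {s : Finset ι} (h : Even s.card) {u : CliffordAlgebra Q}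
    (hu : u ∈ CliffordAlgebra.evenOdd Q 1) : pr0 Q (mon Q b s * u) = 0 :=
  pr0_of_odd Q (CliffordAlgebra.evenOdd_mul_le Q 0 1 (Submodule.mul_mem_mul (mon_mem_even h) hu))

variable (hb : IsOrthonormal Q b)
include hb

theorem pr0_conj_gen (i : ι) (u : CliffordAlgebra Q) :
    pr0 Q (gen Q b i * u * gen Q b i) = pr0 Q u := by
  rw [pr0_mul_comm, ← mul_assoc, gen_mul_self hb, one_mul]

variable [Fintype ι]

/-- The even elements of the center are the scalars. -/
theorem eq_algebraMap_of_commute {u : CliffordAlgebra Q} (hu : u ∈ CliffordAlgebra.even Q)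
    (h : ∀ x, CliffordAlgebra.ι Q x * u = u * CliffordAlgebra.ι Q x) :
    u = algebraMap ℂ _ (pr0 Q u) := by
  conv_lhs => rw [eq_sum_mon hb u]
  rw [Finset.sum_eq_single ∅]
  · rw [mon_empty, one_mul, one_mul, pr0_one, one_mul, Algebra.algebraMap_eq_smul_one]
  · intro s _ hs
    -- For $|s|$ even and $i\in s$, the vector $e_i$ anticommutes with $e_s$ and commutes with $u$.
    -- Conjugation by $e_i$ therefore negates $e_su$, while `pr0` is invariant under it.
    have : pr0 Q (mon Q b s * u) = 0 := by
      obtain h' | h' := Nat.even_or_odd s.card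
      · obtain ⟨i, hi⟩ := Finset.nonempty_iff_ne_empty.2 hs
        have := pr0_conj_gen hb i (mon Q b s * u)
        rw [← mul_assoc, gen_mul_mon_comm hb, if_pos hi, h'.neg_one_pow, smul_mul_assoc,
          smul_mul_assoc, mul_assoc (mon Q b s), h, mul_assoc, mul_assoc, gen_mul_self hb, mul_one,
          map_smul, smul_eq_mul] at this
        linear_combination -this / 2
      · exact pr0_mon_mul_of_even h' hu
    rw [this, mul_zero, zero_smul]
  · simp

/-- The odd counterpart: for $|s|$ odd and $i\in s$, now $e_i$ commutes with $e_s$ and anticommutes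
with $u$, so conjugation again negates $e_su$. Even $s$ contribute nothing by parity. -/
theorem eq_zero_of_anticommute {u : CliffordAlgebra Q} (hu : u ∈ CliffordAlgebra.evenOdd Q 1)
    (h : ∀ x, CliffordAlgebra.ι Q x * u = -(u * CliffordAlgebra.ι Q x)) : u = 0 := by
  rw [eq_sum_mon hb u]
  refine Finset.sum_eq_zero fun s _ => ?_
  have : pr0 Q (mon Q b s * u) = 0 := by
    obtain h' | h' := Nat.even_or_odd s.card
    · exact pr0_mon_mul_of_odd h' hu
    · have hs : s ≠ ∅ := by rintro rfl; simp at h'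
      obtain ⟨i, hi⟩ := Finset.nonempty_iff_ne_empty.2 hs
      have := pr0_conj_gen hb i (mon Q b s * u)
      rw [← mul_assoc, gen_mul_mon_comm hb, if_pos hi, h'.neg_one_pow, smul_mul_assoc,
        smul_mul_assoc, mul_assoc (mon Q b s), h] at this
      simp only [neg_mul, mul_neg, mul_assoc, gen_mul_self hb, mul_one, map_smul, map_neg,
        smul_eq_mul, neg_neg, one_mul] at this
      linear_combination -this / 2
  rw [this, mul_zero, zero_smul]

end Parity

/-! ### The isomorphism `τ : ∧²V → so(V)` -/

theorem ι_tau_contr (u : Lie V) (x : V) : ExteriorAlgebra.ι ℂ (tau Q u x) =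
    (-2 : ℂ) • contr Q x (u : ExteriorAlgebra ℂ V) := ι_tau Q u x

theorem contr_wedge (z x y : V) : contr Q z (ExteriorAlgebra.ι ℂ x * ExteriorAlgebra.ι ℂ y) =
    ExteriorAlgebra.ι ℂ (form Q z x • y - form Q z y • x) := by
  rw [contr_ι_mul, contr_ι, ← Algebra.commutes, ← Algebra.smul_def, map_sub, map_smul, map_smul]

theorem scalarPart_contr_contr (x y : V) (u : Lie V) :
    scalarPart (contr Q x (contr Q y (u : ExteriorAlgebra ℂ V))) = -1 / 2 * form Q x (tau Q u y) := by
  have h : contr Q y (u : ExteriorAlgebra ℂ V) = (-1 / 2 : ℂ) • ExteriorAlgebra.ι ℂ (tau Q u y) := by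
    rw [ι_tau_contr, smul_smul]
    norm_num
  rw [h, map_smul, contr_ι, map_smul, AlgHom.commutes]
  rfl

theorem tau_isSkew (u : Lie V) : IsSkew Q (tau Q u) := by
  intro x y
  have h1 := scalarPart_contr_contr Q x y u
  have h2 := scalarPart_contr_contr Q y x u
  rw [contr_comm, map_neg, h2] at h1
  rw [form_comm Q _ y]
  linear_combination 2 * h1

variable {Q}

section Tau

variable {ι : Type*} [Fintype ι] [DecidableEq ι] {b : Basis ι ℂ V} (hb : IsOrthonormal Q b)
include hb

/-- Euler's identity: $\sum_i\varepsilon(b_i)\iota(b_i)$ is the degree operator, used here in degree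
two. It shows that an element of $\wedge^2V$ killed by all contractions is zero. -/
theorem sum_ι_mul_contr (u : Lie V) :
    ∑ i, ExteriorAlgebra.ι ℂ (b i) * contr Q (b i) (u : ExteriorAlgebra ℂ V) =
      (2 : ℂ) • (u : ExteriorAlgebra ℂ V) := by
  have h : ⋀[ℂ]^2 V ≤ LinearMap.eqLocus (∑ i, LinearMap.mulLeft ℂ (ExteriorAlgebra.ι ℂ (b i)) ∘ₗ
      contr Q (b i)) ((2 : ℂ) • LinearMap.id) := by
    refine two_le fun x y => ?_
    have e1 : ∀ y : V, ∑ i, ExteriorAlgebra.ι ℂ (b i) * ExteriorAlgebra.ι ℂ (form Q (b i) x • y) =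
        ExteriorAlgebra.ι ℂ x * ExteriorAlgebra.ι ℂ y := by
      intro y
      conv_rhs => rw [← sum_form_smul hb x]
      rw [map_sum, Finset.sum_mul]
      simp only [map_smul, mul_smul_comm, smul_mul_assoc]
    have e2 : ∑ i, ExteriorAlgebra.ι ℂ (b i) * ExteriorAlgebra.ι ℂ (form Q (b i) y • x) =
        ExteriorAlgebra.ι ℂ y * ExteriorAlgebra.ι ℂ x := by
      conv_rhs => rw [← sum_form_smul hb y]
      rw [map_sum, Finset.sum_mul]
      simp only [map_smul, mul_smul_comm, smul_mul_assoc]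
    have e3 : ExteriorAlgebra.ι ℂ y * ExteriorAlgebra.ι ℂ x =
        -(ExteriorAlgebra.ι ℂ x * ExteriorAlgebra.ι ℂ y) :=
      eq_neg_of_add_eq_zero_left (ExteriorAlgebra.ι_add_mul_swap y x)
    rw [LinearMap.mem_eqLocus]
    simp only [LinearMap.sum_apply, LinearMap.comp_apply, LinearMap.mulLeft_apply, contr_wedge,
      map_sub, Finset.sum_sub_distrib, LinearMap.smul_apply, LinearMap.id_apply]
    rw [e1, e2, e3, sub_neg_eq_add, two_smul]
  simpa using LinearMap.mem_eqLocus.1 (h u.2)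

theorem tau_injective : Function.Injective (tau Q) := by
  rw [injective_iff_map_eq_zero]
  intro u hu
  have h0 : ∀ x, contr Q x (u : ExteriorAlgebra ℂ V) = 0 := by
    intro x
    have := ι_tau_contr Q u x
    rw [hu, LinearMap.zero_apply, map_zero] at this
    simpa using this.symm
  have := sum_ι_mul_contr hb u
  simp only [h0, mul_zero, Finset.sum_const_zero] at this
  simpa using this.symm

theorem exists_tau_eq {s : End ℂ V} (hs : IsSkew Q s) : ∃ u : Lie V, tau Q u = s := by
  have hm : ∀ x y : V, ExteriorAlgebra.ι ℂ x * ExteriorAlgebra.ι ℂ y ∈ Lie V := by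
    intro x y
    rw [Lie, ExteriorAlgebra.exteriorPower, pow_two]
    exact Submodule.mul_mem_mul (LinearMap.mem_range_self _ _) (LinearMap.mem_range_self _ _)
  -- By skewness, contracting $\sum_i b_i\wedge s(b_i)$ with $x$ gives $2s(x)$; the factor $-1/4$
  -- compensates this $2$ and the $-2$ in `tau`.
  refine ⟨⟨(-1 / 4 : ℂ) • ∑ i, ExteriorAlgebra.ι ℂ (b i) * ExteriorAlgebra.ι ℂ (s (b i)),
    Submodule.smul_mem _ _ (Submodule.sum_mem _ fun i _ => hm _ _)⟩, ?_⟩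
  ext x
  apply (ExteriorAlgebra.ι_leftInverse (R := ℂ) (M := V)).injective
  have e1 : ∑ i, form Q x (b i) • s (b i) = s x := by
    conv_rhs => rw [← sum_form_smul hb x]
    simp only [map_sum, map_smul, form_comm Q x]
  have e2 : ∑ i, form Q x (s (b i)) • b i = -s x := by
    conv_rhs => rw [← sum_form_smul hb (s x)]
    rw [← Finset.sum_neg_distrib]
    refine Finset.sum_congr rfl fun i _ => ?_
    rw [← neg_smul, form_comm Q (b i), hs, neg_neg]
  rw [ι_tau_contr]
  simp only [map_smul, map_sum, contr_wedge]
  rw [← map_sum, Finset.sum_sub_distrib, e1, e2, smul_smul, ← map_smul]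
  congr 1
  rw [sub_neg_eq_add, ← two_smul ℂ, smul_smul]
  norm_num

end Tau

end CayleySpin

end

noncomputable section

namespace CayleySpin

/-! ### Averaging over a finite family of operators -/

section Schur

variable {W : Type*} [AddCommGroup W] [Module ℂ W] [FiniteDimensional ℂ W] [Nontrivial W]

theorem exists_smul_of_commute {R : Set (End ℂ W)}
    (hR : ∀ U : Submodule ℂ W, (∀ f ∈ R, ∀ s ∈ U, f s ∈ U) → U = ⊥ ∨ U = ⊤)
    (A : End ℂ W) (hA : ∀ f ∈ R, f * A = A * f) : ∃ c : ℂ, A = c • (1 : End ℂ W) := by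
  obtain ⟨c, hc⟩ := Module.End.exists_eigenvalue A
  have h := hR (Module.End.eigenspace A c) (by
    intro f hf s hs
    rw [Module.End.mem_eigenspace_iff] at hs ⊢
    rw [← Module.End.mul_apply, ← hA f hf, Module.End.mul_apply, hs, map_smul])
  refine ⟨c, ?_⟩
  ext s
  have hs : s ∈ Module.End.eigenspace A c := by
    rw [h.resolve_left hc]
    trivial
  simpa using Module.End.mem_eigenspace_iff.1 hs

/-- Schur orthogonality. Taking traces identifies the scalar as $|J|\,\mathrm{tr}A/\dim W$. With $A$
a matrix unit this gives $\sum_j(f_j)_{kk}(g_j)_{ll}=\delta_{kl}|J|/\dim W$, and one sums over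
$k,l$. -/
theorem sum_trace_mul_trace {J : Type*} [Fintype J] (f g : J → End ℂ W) (hfg : ∀ j, g j * f j = 1)
    (h : ∀ A, ∃ c : ℂ, ∑ j, f j * A * g j = c • (1 : End ℂ W)) :
    ∑ j, LinearMap.trace ℂ W (f j) * LinearMap.trace ℂ W (g j) = Fintype.card J := by
  let b := Module.finBasis ℂ W
  let M := LinearMap.toMatrixAlgEquiv b
  have hd : (finrank ℂ W : ℂ) ≠ 0 := Nat.cast_ne_zero.2 Module.finrank_pos.ne'
  have key : ∀ A : End ℂ W, ∑ j, f j * A * g j =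
      ((Fintype.card J : ℂ) * LinearMap.trace ℂ W A / finrank ℂ W) • (1 : End ℂ W) := by
    intro A
    obtain ⟨c, hc⟩ := h A
    have h1 := congrArg (LinearMap.trace ℂ W) hc
    have h2 : ∀ j, LinearMap.trace ℂ W (f j * A * g j) = LinearMap.trace ℂ W A := by
      intro j
      rw [LinearMap.trace_mul_comm, ← mul_assoc, hfg, one_mul]
    rw [map_sum, Finset.sum_congr rfl fun j _ => h2 j, map_smul, LinearMap.trace_one] at h1
    simp only [Finset.sum_const, Finset.card_univ, nsmul_eq_mul, smul_eq_mul] at h1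
    rw [hc, h1, mul_div_cancel_right₀ _ hd]
  have htr : ∀ A : End ℂ W, LinearMap.trace ℂ W A = ∑ k, M A k k := by
    intro A
    rw [LinearMap.trace_eq_matrix_trace ℂ b]
    rfl
  have hkl : ∀ k l, ∑ j, M (f j) k k * M (g j) l l =
      if k = l then (Fintype.card J : ℂ) / finrank ℂ W else 0 := by
    intro k l
    have h1 := congrArg (fun A => M A k l) (key (M.symm (Matrix.single k l 1)))
    have h3 : LinearMap.trace ℂ W (M.symm (Matrix.single k l 1)) = if k = l then 1 else 0 := by
      rw [htr]
      simp [Matrix.single_apply, ite_and, eq_comm]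
    simp only [map_sum, map_mul, AlgEquiv.apply_symm_apply, map_smul, map_one, h3,
      Matrix.smul_apply, Matrix.one_apply, Matrix.sum_apply] at h1
    have h2 : ∀ j, (M (f j) * Matrix.single k l 1 * M (g j) : Matrix _ _ ℂ) k l = M (f j) k k * M (g j) l l := by
      intro j
      simp [Matrix.mul_apply, Matrix.single_apply, ite_and, Finset.sum_ite_eq]
    simp only [h2] at h1
    rw [h1]
    split_ifs <;> simp
  calc ∑ j, LinearMap.trace ℂ W (f j) * LinearMap.trace ℂ W (g j)
      = ∑ k, ∑ l, ∑ j, M (f j) k k * M (g j) l l := by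
        simp only [htr, Finset.sum_mul_sum]
        rw [Finset.sum_comm]
        refine Finset.sum_congr rfl fun k _ => Finset.sum_comm
    _ = Fintype.card J := by
        simp only [hkl, Finset.sum_ite_eq, Finset.mem_univ, if_true, Finset.sum_const,
          Finset.card_univ, Fintype.card_fin, nsmul_eq_mul]
        field_simp

end Schur

variable {V : Type*} [AddCommGroup V] [Module ℂ V] {Q : QuadraticForm ℂ V}

/-! ### Traces of even monomials -/

section EvenMonomials

variable {ι : Type*} [DecidableEq ι] (Q) (b : Basis ι ℂ V)

/-- The even monomials, as elements of `C⁰(V)`. -/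
def evenMon (s : {s : Finset ι // Even s.card}) : CliffordAlgebra.even Q :=
  ⟨mon Q b s, mon_mem_even s.2⟩

/-- The sign `e_s²`. -/
def monSq (s : Finset ι) : ℂ := pr0 Q (mon Q b s * mon Q b s)

variable {Q b} (hb : IsOrthonormal Q b)
include hb

theorem monSq_mul_self (s : Finset ι) : monSq Q b s * monSq Q b s = 1 := by
  obtain ⟨ε, hε, he⟩ := exists_sq_mon hb s
  rwa [monSq, he, Algebra.algebraMap_eq_smul_one, map_smul, pr0_one, smul_eq_mul, mul_one]

theorem mon_mul_self (s : Finset ι) : mon Q b s * mon Q b s = algebraMap ℂ _ (monSq Q b s) := by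
  obtain ⟨ε, hε, he⟩ := exists_sq_mon hb s
  rw [monSq, he]
  simp only [Algebra.algebraMap_eq_smul_one, map_smul, pr0_one, smul_eq_mul, mul_one]

theorem evenMon_mul_inv (s : {s : Finset ι // Even s.card}) :
    evenMon Q b s * (monSq Q b s • evenMon Q b s) = 1 := by
  apply Subtype.ext
  change mon Q b s * (monSq Q b s • mon Q b s) = 1
  rw [mul_smul_comm, mon_mul_self hb, Algebra.algebraMap_eq_smul_one, smul_smul, monSq_mul_self hb,
    one_smul]

theorem evenMon_inv_mul (s : {s : Finset ι // Even s.card}) :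
    (monSq Q b s • evenMon Q b s) * evenMon Q b s = 1 := by
  rw [smul_mul_assoc, ← mul_smul_comm, evenMon_mul_inv hb]

omit hb in
theorem even_card_symmDiff {s t : Finset ι} (hs : Even s.card) (ht : Even t.card) :
    Even (symmDiff s t).card := by
  have h1 := Finset.card_sdiff_add_card_inter s t
  have h2 := Finset.card_sdiff_add_card_inter t s
  have h3 : (symmDiff s t).card = (s \ t).card + (t \ s).card :=
    Finset.card_union_of_disjoint disjoint_sdiff_sdiff
  rw [Finset.inter_comm] at h2
  grind

/-- Symmetric difference with a fixed even set, as a permutation of the even sets. -/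
def symmDiffPerm (t : {s : Finset ι // Even s.card}) :
    Equiv.Perm {s : Finset ι // Even s.card} where
  toFun s := ⟨symmDiff t.1 s.1, even_card_symmDiff t.2 s.2⟩
  invFun s := ⟨symmDiff t.1 s.1, even_card_symmDiff t.2 s.2⟩
  left_inv _ := Subtype.ext (symmDiff_symmDiff_cancel_left _ _)
  right_inv _ := Subtype.ext (symmDiff_symmDiff_cancel_left _ _)

theorem evenMon_mul_evenMon (t s : {s : Finset ι // Even s.card}) :
    ∃ ε : ℂ, ε * ε = 1 ∧ evenMon Q b t * evenMon Q b s = ε • evenMon Q b (symmDiffPerm t s) := by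
  obtain ⟨ε, hε, he⟩ := mon_mul_mon hb t.1 s.1
  exact ⟨ε, hε, Subtype.ext he⟩

variable [Fintype ι]

theorem even_eq_sum (u : CliffordAlgebra.even Q) :
    u = ∑ s : {s : Finset ι // Even s.card},
      (monSq Q b s * pr0 Q (mon Q b s * u)) • evenMon Q b s := by
  apply Subtype.ext
  rw [AddSubmonoidClass.coe_finsetSum]
  conv_lhs => rw [eq_sum_mon hb (u : CliffordAlgebra Q),
    ← Fintype.sum_subtype_add_sum_subtype fun s : Finset ι => Even s.card]
  have h : ∀ s : {s : Finset ι // ¬Even s.card}, (pr0 Q (mon Q b s * mon Q b s) *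
      pr0 Q (mon Q b s * (u : CliffordAlgebra Q))) • mon Q b s.1 = 0 := by
    intro s
    rw [pr0_mon_mul_of_even (Nat.not_even_iff_odd.1 s.2) u.2, mul_zero, zero_smul]
  rw [Finset.sum_congr rfl fun s _ => h s, Finset.sum_const_zero, add_zero]
  rfl

variable {W : Type*} [AddCommGroup W] [Module ℂ W]

/-- For $i\in s$ and $j\notin s$ the invertible element $e_ie_j$ anticommutes with $e_s$, so $e_s$
is conjugate to $-e_s$. -/
theorem trace_evenMon (ρ : CliffordAlgebra.even Q →ₐ[ℂ] End ℂ W)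
    (s : {s : Finset ι // Even s.card}) (h0 : s.1 ≠ ∅) (h1 : s.1 ≠ Finset.univ) :
    LinearMap.trace ℂ W (ρ (evenMon Q b s)) = 0 := by
  obtain ⟨i, hi⟩ := Finset.nonempty_iff_ne_empty.2 h0
  obtain ⟨j, hj⟩ : ∃ j, j ∉ s.1 := by
    by_contra! h
    exact h1 (Finset.eq_univ_iff_forall.2 h)
  let x : CliffordAlgebra.even Q :=
    ⟨gen Q b i * gen Q b j, CliffordAlgebra.ι_mul_ι_mem_evenOdd_zero Q _ _⟩
  let y : CliffordAlgebra.even Q :=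
    ⟨gen Q b j * gen Q b i, CliffordAlgebra.ι_mul_ι_mem_evenOdd_zero Q _ _⟩
  have hyx : y * x = 1 := by
    apply Subtype.ext
    change gen Q b j * gen Q b i * (gen Q b i * gen Q b j) = 1
    rw [mul_assoc, ← mul_assoc (gen Q b i), gen_mul_self hb, one_mul, gen_mul_self hb]
  have hxy : x * y = 1 := by
    apply Subtype.ext
    change gen Q b i * gen Q b j * (gen Q b j * gen Q b i) = 1
    rw [mul_assoc, ← mul_assoc (gen Q b j), gen_mul_self hb, one_mul, gen_mul_self hb]
  have hx : x * evenMon Q b s = -(evenMon Q b s * x) := by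
    apply Subtype.ext
    change gen Q b i * gen Q b j * mon Q b s = -(mon Q b s * (gen Q b i * gen Q b j))
    rw [mul_assoc, gen_mul_mon_comm hb, if_neg hj, s.2.neg_one_pow, one_mul, one_smul, ← mul_assoc,
      gen_mul_mon_comm hb, if_pos hi, s.2.neg_one_pow, one_mul, neg_smul, one_smul, neg_mul,
      mul_assoc]
  have h : LinearMap.trace ℂ W (ρ (x * evenMon Q b s * y)) =
      LinearMap.trace ℂ W (ρ (evenMon Q b s)) := by
    rw [map_mul, LinearMap.trace_mul_comm, ← map_mul, ← mul_assoc, hyx, one_mul]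
  rw [hx, neg_mul, mul_assoc, hxy, mul_one, map_neg, map_neg] at h
  linear_combination -h / 2

/-- The even monomials are closed under multiplication up to sign, so multiplying by one of them
only permutes the summands; the signs occur twice and cancel. -/
theorem average_commute (ρ : CliffordAlgebra.even Q →ₐ[ℂ] End ℂ W) (A : End ℂ W)
    (u : CliffordAlgebra.even Q) :
    ρ u * ∑ s, ρ (evenMon Q b s) * A * ρ (monSq Q b s • evenMon Q b s) =
      (∑ s, ρ (evenMon Q b s) * A * ρ (monSq Q b s • evenMon Q b s)) * ρ u := by
  have key : ∀ t, ρ (evenMon Q b t) * ∑ s, ρ (evenMon Q b s) * A * ρ (monSq Q b s • evenMon Q b s) =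
      (∑ s, ρ (evenMon Q b s) * A * ρ (monSq Q b s • evenMon Q b s)) * ρ (evenMon Q b t) := by
    intro t
    conv_rhs => rw [← Equiv.sum_comp (symmDiffPerm t)]
    rw [Finset.mul_sum, Finset.sum_mul]
    refine Finset.sum_congr rfl fun s _ => ?_
    obtain ⟨ε, hε, he⟩ := evenMon_mul_evenMon hb t s
    have h1 : evenMon Q b (symmDiffPerm t s) = ε • (evenMon Q b t * evenMon Q b s) := by
      rw [he, smul_smul, hε, one_smul]
    have h2 : monSq Q b (symmDiffPerm t s).1 • evenMon Q b (symmDiffPerm t s) * evenMon Q b t =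
        ε • (monSq Q b s • evenMon Q b s) := by
      -- Both sides are inverse to $\varepsilon e_s$, so the signs `monSq` need not be compared.
      refine (left_inv_eq_right_inv (a := ε • evenMon Q b s) ?_ ?_)
      · rw [mul_assoc, mul_smul_comm, he, smul_smul, hε, one_smul, evenMon_inv_mul hb]
      · rw [smul_mul_smul_comm, hε, one_smul, evenMon_mul_inv hb]
    rw [mul_assoc _ (ρ _) (ρ (evenMon Q b t)), ← map_mul ρ (_ • _), h2, h1]
    rw [map_smul ρ ε, map_smul ρ ε, smul_mul_assoc, smul_mul_assoc, mul_smul_comm, smul_smul, hε,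
      one_smul, map_mul]
    simp only [mul_assoc]
  rw [even_eq_sum hb u, map_sum, Finset.sum_mul, Finset.mul_sum]
  refine Finset.sum_congr rfl fun t _ => ?_
  rw [map_smul, smul_mul_assoc, mul_smul_comm, key]

end EvenMonomials

end CayleySpin

end

noncomputable section

namespace CayleySpin

variable {V : Type*} [AddCommGroup V] [Module ℂ V] {Q : QuadraticForm ℂ V}

/-! ### The trace of the spin module -/

/-- The restriction of a representation of an algebra to a stable subspace. -/
def restrictHom {A S : Type*} [Ring A] [Algebra ℂ A] [AddCommGroup S] [Module ℂ S]
    (ρ : A →ₐ[ℂ] End ℂ S) (W : Submodule ℂ S) (h : ∀ a, ∀ s ∈ W, ρ a s ∈ W) :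
    A →ₐ[ℂ] End ℂ W where
  toFun a := (ρ a).restrict (h a)
  map_one' := by ext; simp
  map_mul' a b := by ext; simp
  map_zero' := by ext; simp
  map_add' a b := by ext; simp
  commutes' r := by ext; simp

section

variable {ι : Type*} [DecidableEq ι] {b : Basis ι ℂ V} (hb : IsOrthonormal Q b)
include hb

theorem psi_word_mem {l : List ι} (hl : l.Nodup) : psi Q (word Q b l) ∈ ⋀[ℂ]^l.length V := by
  induction l with
  | nil =>
    rw [word_nil, psi_one, List.length_nil, ExteriorAlgebra.exteriorPower, pow_zero]
    exact Submodule.one_le.1 le_rfl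
  | cons i l ih =>
    obtain ⟨hi, hl⟩ := List.nodup_cons.1 hl
    rw [psi_word_cons hb hi, List.length_cons, ExteriorAlgebra.exteriorPower, pow_succ']
    exact Submodule.mul_mem_mul ⟨b i, rfl⟩ (ih hl)

variable [Fintype ι]

theorem psi_mon_univ_mem : psi Q (mon Q b Finset.univ) ∈ ⋀[ℂ]^(finrank ℂ V) V := by
  have := psi_word_mem hb (Finset.univ : Finset ι).nodup_toList
  rwa [Finset.length_toList, Finset.card_univ, ← Module.finrank_eq_card_basis b] at this

variable [FiniteDimensional ℂ V]

/-- For $n$ even the top monomial anticommutes with every vector, hence with every odd monomial, so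
commuting with it kills the odd coefficients. Thus irreducibility over $C^Z(V)$ is irreducibility
over $C^0(V)$. -/
theorem mem_even_of_mem_CZ (hn : Even (finrank ℂ V)) {u : CliffordAlgebra Q} (hu : u ∈ CZ Q) :
    u ∈ CliffordAlgebra.even Q := by
  set m := mon Q b Finset.univ with hm
  have hmZ : m ∈ Z Q := Submodule.mem_sup_right (psi_mon_univ_mem hb)
  have hum : m * u = u * m := (Subalgebra.mem_centralizer_iff ℂ).1 hu m hmZ
  have hcard : Even (Finset.univ : Finset ι).card := by
    rwa [Finset.card_univ, ← Module.finrank_eq_card_basis b]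
  have hgen : ∀ i, gen Q b i * m = -(m * gen Q b i) := by
    intro i
    rw [hm, gen_mul_mon_comm hb, if_pos (Finset.mem_univ i), hcard.neg_one_pow]
    simp
  have hword : ∀ l : List ι, word Q b l * m = (-1 : ℂ) ^ l.length • (m * word Q b l) := by
    intro l
    induction l with
    | nil => simp [word_nil]
    | cons i l ih =>
      rw [word_cons, mul_assoc, ih, mul_smul_comm, ← mul_assoc, hgen, List.length_cons, pow_succ]
      simp [mul_assoc]
  have hsq := mon_mul_self hb (Finset.univ : Finset ι)
  have hsq' := monSq_mul_self hb (Finset.univ : Finset ι)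
  rw [eq_sum_mon hb u]
  refine Subalgebra.sum_mem _ fun s _ => ?_
  obtain hs | hs := Nat.even_or_odd s.card
  · exact Subalgebra.smul_mem _ (mon_mem_even hs) _
  · have h1 : mon Q b s * m = -(m * mon Q b s) := by
      rw [mon, hword, Finset.length_toList, hs.neg_one_pow, neg_one_smul]
    have h2 : pr0 Q (m * (mon Q b s * u) * m) = monSq Q b Finset.univ * pr0 Q (mon Q b s * u) := by
      rw [pr0_mul_comm, ← mul_assoc, hm, hsq, ← Algebra.smul_def, map_smul, smul_eq_mul]
    have h3 : pr0 Q (m * (mon Q b s * u) * m) = -pr0 Q (m * (mon Q b s * u) * m) := by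
      conv_lhs => rw [mul_assoc, mul_assoc, ← hum, ← mul_assoc (mon Q b s), h1, neg_mul, mul_neg,
        map_neg, mul_assoc m, pr0_mul_comm]
    have h4 : pr0 Q (mon Q b s * u) = 0 := by
      have h5 : monSq Q b Finset.univ * pr0 Q (mon Q b s * u) = 0 := by
        rw [← h2]
        linear_combination h3 / 2
      exact (mul_eq_zero.1 h5).resolve_left fun h => by simp [h] at hsq'
    rw [h4, mul_zero, zero_smul]
    exact Subalgebra.zero_mem _

/-- In the orthogonality relation over the even monomials only $1$ and the top monomial survive, and
each contributes $(\dim W)^2$. The right-hand side does not depend on $W$, which forces the two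
halves of the spin module to have equal dimension. -/
theorem two_mul_finrank_sq {W : Type*} [AddCommGroup W] [Module ℂ W] [FiniteDimensional ℂ W]
    [Nontrivial W] [Nonempty ι] (hcard : Even (Finset.univ : Finset ι).card)
    (ρ : CliffordAlgebra.even Q →ₐ[ℂ] End ℂ W)
    (hρ : ∀ U : Submodule ℂ W, (∀ f ∈ Set.range ρ, ∀ s ∈ U, f s ∈ U) → U = ⊥ ∨ U = ⊤)
    {c : ℂ} (hc : c * c = monSq Q b Finset.univ)
    (hρc : ρ (evenMon Q b ⟨Finset.univ, hcard⟩) = c • (1 : End ℂ W)) :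
    2 * finrank ℂ W ^ 2 = Fintype.card {s : Finset ι // Even s.card} := by
  have h := sum_trace_mul_trace (W := W) (fun s => ρ (evenMon Q b s))
    (fun s => ρ (monSq Q b s.1 • evenMon Q b s))
    (fun s => by rw [← map_mul, evenMon_inv_mul hb, map_one])
    (fun A => exists_smul_of_commute hρ _ (by
      rintro _ ⟨u, rfl⟩
      exact average_commute hb ρ A u))
  let s0 : {s : Finset ι // Even s.card} := ⟨∅, by simp⟩
  let s1 : {s : Finset ι // Even s.card} := ⟨Finset.univ, hcard⟩
  have h01 : s0 ≠ s1 := fun h => Finset.univ_nonempty.ne_empty (congrArg Subtype.val h).symm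
  have e0 : evenMon Q b s0 = 1 := Subtype.ext (mon_empty Q b)
  have e0' : monSq Q b s0.1 = 1 := by
    change pr0 Q (mon Q b ∅ * mon Q b ∅) = 1
    rw [mon_empty, mul_one, pr0_one]
  rw [← Finset.sum_subset (Finset.subset_univ {s0, s1}), Finset.sum_pair h01] at h
  · rw [e0, e0', one_smul, map_one, map_smul ρ, hρc, LinearMap.trace_one, map_smul, map_smul,
      map_smul, LinearMap.trace_one, ← hc] at h
    have hsq' := monSq_mul_self hb (Finset.univ : Finset ι)
    rw [← hc] at hsq'
    simp only [smul_eq_mul] at h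
    have : (2 * finrank ℂ W ^ 2 : ℂ) = Fintype.card {s : Finset ι // Even s.card} := by
      linear_combination h - (finrank ℂ W : ℂ) ^ 2 * hsq'
    exact_mod_cast this
  · intro s _ hs
    simp only [Finset.mem_insert, Finset.mem_singleton, not_or] at hs
    rw [trace_evenMon hb ρ s (fun h => hs.1 (Subtype.ext h)) (fun h => hs.2 (Subtype.ext h)),
      zero_mul]

variable {S : Type*} [AddCommGroup S] [Module ℂ S] [FiniteDimensional ℂ S]

/-- The restriction of the spin module to `C⁰(V)`. -/
def evenRep (σ : CZ Q →ₐ[ℂ] End ℂ S) :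
    CliffordAlgebra.even Q →ₐ[ℂ] End ℂ S :=
  σ.comp (Subalgebra.inclusion (even_le_CZ Q))

/-- The top monomial is a multiple of $\mu$, whose trace is $\dim e_+S-\dim e_-S=0$ by
`two_mul_finrank_sq`. -/
theorem trace_evenMon_univ [Nonempty ι] (hcard : Even (Finset.univ : Finset ι).card)
    (σ : CZ Q →ₐ[ℂ] End ℂ S) (hσ : IsSpinModule Q σ) :
    LinearMap.trace ℂ S (evenRep σ (evenMon Q b ⟨Finset.univ, hcard⟩)) = 0 := by
  obtain ⟨μ, hμ, hμ2, hp, hm⟩ := hσ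
  have hn : Even (finrank ℂ V) := by rwa [Module.finrank_eq_card_basis b, ← Finset.card_univ]
  obtain ⟨c, hc⟩ : ∃ c : ℂ, mon Q b Finset.univ = c • (μ : CliffordAlgebra Q) := by
    have h1 : finrank ℂ (⋀[ℂ]^(finrank ℂ V) V) = 1 := by
      rw [exteriorPower.finrank_eq, Nat.choose_self]
    have hμ0 : (⟨psi Q μ, hμ⟩ : ⋀[ℂ]^(finrank ℂ V) V) ≠ 0 := by
      intro h
      have h2 : psi Q (μ : CliffordAlgebra Q) = 0 := congrArg Subtype.val h
      have h3 : (μ : CliffordAlgebra Q) = 0 := (psi Q).map_eq_zero_iff.1 h2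
      have h4 := congrArg Subtype.val hμ2
      rw [Subalgebra.coe_mul, h3, mul_zero] at h4
      have h5 := congrArg (pr0 Q) h4
      rw [map_zero, Subalgebra.coe_one, pr0_one] at h5
      exact zero_ne_one h5
    obtain ⟨c, hc⟩ := (finrank_eq_one_iff_of_nonzero' _ hμ0).1 h1 ⟨_, psi_mon_univ_mem hb⟩
    refine ⟨c, (psi Q).injective ?_⟩
    rw [map_smul]
    exact (congrArg Subtype.val hc).symm
  have hcsq : c * c = monSq Q b Finset.univ := by
    have h4 : (μ : CliffordAlgebra Q) * μ = 1 := congrArg Subtype.val hμ2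
    rw [monSq, hc, smul_mul_smul_comm, h4, map_smul, pr0_one, smul_eq_mul, mul_one]
  have hmon : evenRep σ (evenMon Q b ⟨Finset.univ, hcard⟩) = c • σ μ := by
    rw [← map_smul]
    refine congrArg σ (Subtype.ext hc)
  -- Here $\varepsilon=\pm1$ is the scalar by which $\mu$ acts on the half $W$; the dimension
  -- formula is the same for both signs.
  have hd : ∀ (ε : ℂ), ε * ε = 1 → ∀ W : Submodule ℂ S, IsIrreducibleSub σ W →
      (∀ s ∈ W, σ μ s = ε • s) →
      2 * finrank ℂ W ^ 2 = Fintype.card {s : Finset ι // Even s.card} := by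
    intro ε hε W hW hWμ
    obtain ⟨h1, h2, h3⟩ := hW
    have : Nontrivial W := Submodule.nontrivial_iff_ne_bot.2 h2
    refine two_mul_finrank_sq hb hcard (c := c * ε)
      ((restrictHom σ W h1).comp (Subalgebra.inclusion (even_le_CZ Q))) (fun U hU => ?_) ?_ ?_
    · have h4 := h3 (U.map W.subtype) (Submodule.map_subtype_le _ _) (by
        rintro a _ ⟨s, hs, rfl⟩
        exact ⟨_, hU _ ⟨⟨a, mem_even_of_mem_CZ hb hn a.2⟩, rfl⟩ s hs, rfl⟩)
      refine h4.imp (fun h => ?_) fun h => ?_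
      · exact Submodule.map_injective_of_injective W.injective_subtype 
          (h.trans (Submodule.map_bot _).symm)
      · exact Submodule.map_injective_of_injective W.injective_subtype
          (h.trans W.map_subtype_top.symm)
    · rw [← hcsq]
      linear_combination c * c * hε
    · ext s
      have h5 := LinearMap.congr_fun hmon (s : S)
      rw [LinearMap.smul_apply, hWμ s s.2, smul_smul] at h5
      exact h5
  set ep := σ ((1 / 2 : ℂ) • (1 + μ)) with hep
  set em := σ ((1 / 2 : ℂ) • (1 - μ)) with hem
  have hσμ : σ μ * σ μ = 1 := by rw [← map_mul, hμ2, map_one]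
  have hep' : ep = (1 / 2 : ℂ) • (1 + σ μ) := by rw [hep, map_smul, map_add, map_one]
  have hem' : em = (1 / 2 : ℂ) • (1 - σ μ) := by rw [hem, map_smul, map_sub, map_one]
  have hpp : σ μ * ep = ep := by rw [hep', mul_smul_comm, mul_add, hσμ, mul_one, add_comm]
  have hmm : σ μ * em = -em := by
    rw [hem', mul_smul_comm, mul_sub, hσμ, mul_one, ← smul_neg, neg_sub]
  have tr : ∀ e : End ℂ S, e * e = e → LinearMap.trace ℂ S e = finrank ℂ (LinearMap.range e) := by
    intro e he
    refine LinearMap.IsProj.trace (p := LinearMap.range e) ⟨fun x => ⟨x, rfl⟩, ?_⟩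
    rintro _ ⟨x, rfl⟩
    rw [← Module.End.mul_apply, he]
  have hd1 := hd 1 (by simp) _ hp (by
    rintro _ ⟨s, rfl⟩
    rw [← Module.End.mul_apply, hpp, one_smul])
  have hd2 := hd (-1) (by simp) _ hm (by
    rintro _ ⟨s, rfl⟩
    rw [← Module.End.mul_apply, hmm, neg_one_smul, LinearMap.neg_apply])
  have hdd : finrank ℂ (LinearMap.range ep) = finrank ℂ (LinearMap.range em) := by
    have : finrank ℂ (LinearMap.range ep) ^ 2 = finrank ℂ (LinearMap.range em) ^ 2 := by omega
    exact Nat.pow_left_injective (by norm_num : 2 ≠ 0) this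
  have hμe : σ μ = ep - em := by
    rw [hep', hem', ← smul_sub, add_sub_sub_cancel, ← two_smul ℂ, smul_smul]
    norm_num
  rw [hmon, map_smul, hμe, map_sub, tr ep, tr em, hdd, sub_self, smul_zero]
  · have h : em * em = (1 / 2 : ℂ) • (em - σ μ * em) := by
      conv_lhs => enter [1]; rw [hem']
      rw [smul_mul_assoc, sub_mul, one_mul]
    rw [h, hmm, sub_neg_eq_add, ← two_smul ℂ, smul_smul]
    norm_num
  · have h : ep * ep = (1 / 2 : ℂ) • (ep + σ μ * ep) := by
      conv_lhs => enter [1]; rw [hep']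
      rw [smul_mul_assoc, add_mul, one_mul]
    rw [h, hpp, ← two_smul ℂ, smul_smul]
    norm_num

/-- Every even monomial other than $1$ has trace zero. For odd $n$ the top monomial is not even and
does not occur. -/
theorem trace_evenRep [Nonempty ι] (σ : CZ Q →ₐ[ℂ] End ℂ S) (hσ : IsSpinModule Q σ)
    (u : CliffordAlgebra.even Q) :
    LinearMap.trace ℂ S (evenRep σ u) = finrank ℂ S * pr0 Q u := by
  have hs0 : (⟨∅, by simp⟩ : {s : Finset ι // Even s.card}).1 = ∅ := rfl
  have e0 : evenMon Q b ⟨∅, by simp⟩ = 1 := Subtype.ext (mon_empty Q b)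
  conv_lhs => rw [even_eq_sum hb u, map_sum, map_sum]
  rw [Finset.sum_eq_single ⟨∅, by simp⟩]
  · rw [e0, map_smul, map_smul, map_one, LinearMap.trace_one, monSq]
    simp only [mon_empty, one_mul, pr0_one, smul_eq_mul]
    ring
  · intro s _ hs
    have h : LinearMap.trace ℂ S (evenRep σ (evenMon Q b s)) = 0 := by
      by_cases h1 : s.1 = Finset.univ
      · obtain ⟨s, hs'⟩ := s
        subst h1
        exact trace_evenMon_univ hb hs' σ hσ
      · exact trace_evenMon hb _ s (fun h => hs (Subtype.ext h)) h1
    rw [map_smul, map_smul, h, smul_zero]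
  · simp

end

/-! ### The generalized Cayley mapping of the spin representation -/

section Cayley

variable [FiniteDimensional ℂ V] {S : Type*} [AddCommGroup S] [Module ℂ S] [FiniteDimensional ℂ S]
  {σ : CZ Q →ₐ[ℂ] End ℂ S}

theorem finrank_spinModule_ne_zero (hσ : IsSpinModule Q σ) : (finrank ℂ S : ℂ) ≠ 0 := by
  obtain ⟨μ, -, -, hp, -⟩ := hσ
  have : Nontrivial S := by
    by_contra h
    rw [not_nontrivial_iff_subsingleton] at h
    exact hp.2.1 (Subsingleton.elim _ _)
  exact Nat.cast_ne_zero.2 Module.finrank_pos.ne'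

/-- Pairing with a bivector is a double contraction: since $x\wedge y=xy-(x,y)$, the terms in
$\mathrm{pr}_0(u)$ cancel. Only the degree-two component of $u$ matters, and `tau` can express it.
-/
theorem pr0_wedge_mul (x y : V) (u : CliffordAlgebra Q) :
    pr0 Q ((psi Q).symm (ExteriorAlgebra.ι ℂ x * ExteriorAlgebra.ι ℂ y) * u) =
      scalarPart (contr Q x (contr Q y (psi Q u))) := by
  rw [psi_symm_wedge, sub_mul, mul_assoc, map_sub, pr0_ι_mul, psi_ι_mul_contr, map_add, contr_ι_mul,
    ← Algebra.smul_def, map_smul, map_add, map_sub, map_smul, scalarPart_ι_mul, pr0_eq]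
  ring

theorem spinIncl_mem_even (g : Spin Q) : spinIncl Q g ∈ CliffordAlgebra.even Q := g.2.1

theorem spinIncl_mul (g h : Spin Q) : spinIncl Q (g * h) = spinIncl Q g * spinIncl Q h := rfl

theorem spinIncl_one : spinIncl Q 1 = 1 := rfl

theorem spinIncl_inv_mul (g : Spin Q) : spinIncl Q g⁻¹ * spinIncl Q g = 1 := by
  rw [← spinIncl_mul, inv_mul_cancel, spinIncl_one]

theorem spinIncl_mul_inv (g : Spin Q) : spinIncl Q g * spinIncl Q g⁻¹ = 1 := by
  rw [← spinIncl_mul, mul_inv_cancel, spinIncl_one]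

theorem spinIncl_injective : Function.Injective (spinIncl Q) :=
  Units.val_injective.comp Subtype.val_injective

theorem reverse_spinIncl (g : Spin Q) :
    CliffordAlgebra.reverse (spinIncl Q g) = spinIncl Q g⁻¹ :=
  (Units.inv_eq_of_mul_eq_one_right g.2.2.1).symm

theorem ι_T_eq (g : Spin Q) (x : V) : CliffordAlgebra.ι Q (T Q g x) =
    spinIncl Q g * CliffordAlgebra.ι Q x * spinIncl Q g⁻¹ := by
  rw [← reverse_spinIncl]
  exact ι_T Q g x

theorem ι_T_mul (g : Spin Q) (x : V) : CliffordAlgebra.ι Q (T Q g x) * spinIncl Q g =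
    spinIncl Q g * CliffordAlgebra.ι Q x := by
  rw [ι_T_eq, mul_assoc, spinIncl_inv_mul, mul_one]

theorem wedge_mem_Lie (x y : V) : ExteriorAlgebra.ι ℂ x * ExteriorAlgebra.ι ℂ y ∈ Lie V := by
  rw [Lie, ExteriorAlgebra.exteriorPower, pow_two]
  exact Submodule.mul_mem_mul (LinearMap.mem_range_self _ _) (LinearMap.mem_range_self _ _)

variable (hQ : (form Q).Nondegenerate) (hn : 0 < finrank ℂ V) (hσ : IsSpinModule Q σ)
include hQ hn hσ

theorem trace_σ {u : CliffordAlgebra Q} (hu : u ∈ CliffordAlgebra.even Q) :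
    LinearMap.trace ℂ S (σ ⟨u, even_le_CZ Q hu⟩) = finrank ℂ S * pr0 Q u := by
  obtain ⟨b, hb⟩ := exists_isOrthonormal Q hQ
  have : Nonempty (Fin (finrank ℂ V)) := ⟨⟨0, hn⟩⟩
  exact trace_evenRep hb σ hσ ⟨u, hu⟩

theorem traceForm_spin (x y : Lie V) : traceForm (spinRepDiff σ) x y =
    finrank ℂ S * pr0 Q ((psi Q).symm x * (psi Q).symm y) := by
  rw [traceForm_apply]
  rw [← trace_σ hQ hn hσ (Subalgebra.mul_mem _ (psi_symm_mem_even Q x.2) (psi_symm_mem_even Q y.2))]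
  change LinearMap.trace ℂ S (σ _ * σ _) = _
  rw [← map_mul]
  rfl

/-- Pairing $w$ with $x\wedge y$ gives a nonzero multiple of $(x,\tau(w)y)$, so the kernel of the
form is the kernel of the injective map `tau`. -/
theorem traceForm_spin_nondegenerate : (traceForm (spinRepDiff σ)).Nondegenerate := by
  have hl : ∀ w : Lie V, (∀ y, traceForm (spinRepDiff σ) y w = 0) → w = 0 := by
    intro w hw
    obtain ⟨b, hb⟩ := exists_isOrthonormal Q hQ
    refine (injective_iff_map_eq_zero _).1 (tau_injective hb) w ?_
    ext y
    rw [LinearMap.zero_apply]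
    refine hQ.2 _ fun x => ?_
    have h := hw ⟨_, wedge_mem_Lie x y⟩
    rw [traceForm_spin hQ hn hσ, pr0_wedge_mul, LinearEquiv.apply_symm_apply,
      scalarPart_contr_contr] at h
    have h' := (mul_eq_zero.1 h).resolve_left (finrank_spinModule_ne_zero hσ)
    linear_combination -2 * h'
  refine ⟨fun w hw => hl w fun y => ?_, hl⟩
  rw [traceForm_spin hQ hn hσ, pr0_mul_comm, ← traceForm_spin hQ hn hσ, hw]

theorem pr0_Phi (g : Spin Q) (y : Lie V) :
    pr0 Q ((psi Q).symm y * (psi Q).symm (Phi σ g)) = pr0 Q ((psi Q).symm y * spinIncl Q g) := by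
  have h := traceForm_cayleyMap (spinRep σ) (spinRepDiff σ)
    (traceForm_spin_nondegenerate hQ hn hσ) g y
  rw [← traceForm_apply] at h
  change traceForm (spinRepDiff σ) (Phi σ g) y = _ at h
  rw [traceForm_spin hQ hn hσ] at h
  have h2 : LinearMap.trace ℂ S (spinRep σ g * spinRepDiff σ y) =
      finrank ℂ S * pr0 Q (spinIncl Q g * (psi Q).symm y) := by
    rw [← trace_σ hQ hn hσ (Subalgebra.mul_mem _ (spinIncl_mem_even g) (psi_symm_mem_even Q y.2))]
    change LinearMap.trace ℂ S (σ _ * σ _) = _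
    rw [← map_mul]
    rfl
  rw [h2] at h
  rw [pr0_mul_comm, mul_left_cancel₀ (finrank_spinModule_ne_zero hσ) h, pr0_mul_comm]

/-- The elements $g$ and $\Phi(g)$ pair equally with all bivectors, so $\Phi(g)$ is the degree-two
component of $g$. -/
theorem scalarPart_contr_contr_spin (g : Spin Q) (x y : V) :
    scalarPart (contr Q x (contr Q y (psi Q (spinIncl Q g)))) =
      -1 / 2 * form Q x (tau Q (Phi σ g) y) := by
  rw [← scalarPart_contr_contr, ← pr0_wedge_mul,
    ← (psi Q).apply_symm_apply ((Phi σ g : Lie V) : ExteriorAlgebra ℂ V), ← pr0_wedge_mul]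
  exact (pr0_Phi hQ hn hσ g ⟨_, wedge_mem_Lie x y⟩).symm

/-- `pr₀(g) (T(g) - 1) = ½ τ(Φ(g)) (1 + T(g))`. -/
theorem pr0_smul_T_sub_one (g : Spin Q) :
    pr0 Q (spinIncl Q g) • (T Q g - 1) = (1 / 2 : ℂ) • (tau Q (Phi σ g) * (1 + T Q g)) := by
  ext y
  refine sub_eq_zero.1 (hQ.2 _ fun z => ?_)
  have hg := ι_T_mul g y
  have hi : CliffordAlgebra.involute (psi Q (spinIncl Q g)) = psi Q (spinIncl Q g) := by
    rw [← psi_involute, CliffordAlgebra.involute_eq_of_mem_even (spinIncl_mem_even g)]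
  -- The degree-one component of $T(g)y\cdot g=g\cdot y$, paired with $z$. On the left one
  -- multiplies by $\varepsilon+\iota$ of $T(g)y$; on the right, as $g$ is even, by
  -- $\varepsilon(y)-\iota(y)$.
  have h := congrArg (fun u => scalarPart (contr Q z (psi Q u))) hg
  have hc : psi Q (spinIncl Q g * CliffordAlgebra.ι Q y) =
      ExteriorAlgebra.ι ℂ y * psi Q (spinIncl Q g) - contr Q y (psi Q (spinIncl Q g)) := by
    rw [psi_mul_ι, hi]
    rfl
  simp only [hc, psi_ι_mul_contr, map_add, map_sub, contr_ι_mul, scalarPart_ι_mul, map_smul,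
    scalarPart_contr_contr_spin hQ hn hσ, ← pr0_eq, smul_eq_mul] at h
  simp only [LinearMap.smul_apply, LinearMap.sub_apply, Module.End.one_apply, map_sub, map_smul,
    Module.End.mul_apply, LinearMap.add_apply, map_add, smul_eq_mul]
  linear_combination h

end Cayley

end CayleySpin

end

noncomputable section

namespace CayleySpin

variable {V : Type*} [AddCommGroup V] [Module ℂ V] {Q : QuadraticForm ℂ V}

/-! ### The determinant of `1 + T(g)` -/

/-! ### Degree filtration of the exterior algebra. -/

section Filtration

variable {ι : Type*} [DecidableEq ι] (Q) (b : Basis ι ℂ V)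

/-- The subspace `∧⁰V + ⋯ + ∧ᵏV` of `∧V`. -/
def low (k : ℕ) : Submodule ℂ (ExteriorAlgebra ℂ V) :=
  Submodule.span ℂ {u | ∃ s : Finset ι, s.card ≤ k ∧ u = psi Q (mon Q b s)}

variable {Q b} (hb : IsOrthonormal Q b)

theorem psi_mon_mem_low {k : ℕ} {s : Finset ι} (h : s.card ≤ k) :
    psi Q (mon Q b s) ∈ low Q b k :=
  Submodule.subset_span ⟨s, h, rfl⟩

theorem low_mono {k l : ℕ} (h : k ≤ l) : low Q b k ≤ low Q b l :=
  Submodule.span_mono fun _ ⟨s, hs, hu⟩ => ⟨s, hs.trans h, hu⟩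

theorem one_mem_low (k : ℕ) : (1 : ExteriorAlgebra ℂ V) ∈ low Q b k := by
  have := psi_mon_mem_low (Q := Q) (b := b) (s := ∅) (k := k) (by simp)
  rwa [mon_empty, psi_one] at this

theorem map_mem_low [Fintype ι] {k l : ℕ} (f : V →ₗ[ℂ] End ℂ (ExteriorAlgebra ℂ V))
    (hf : ∀ i, ∀ s : Finset ι, s.card ≤ k → f (b i) (psi Q (mon Q b s)) ∈ low Q b l) (x : V)
    {u : ExteriorAlgebra ℂ V} (hu : u ∈ low Q b k) : f x u ∈ low Q b l := by
  induction hu using Submodule.span_induction with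
  | mem u hu =>
    obtain ⟨s, hs, rfl⟩ := hu
    rw [← b.sum_repr x, map_sum, LinearMap.sum_apply]
    refine sum_mem fun i _ => ?_
    rw [map_smul, LinearMap.smul_apply]
    exact Submodule.smul_mem _ _ (hf i s hs)
  | zero => rw [map_zero]; exact zero_mem _
  | add u v _ _ hu hv => rw [map_add]; exact add_mem hu hv
  | smul r u _ hu => rw [map_smul]; exact Submodule.smul_mem _ _ hu

include hb

theorem ι_mul_psi_mon_mem_low (i : ι) {s : Finset ι} {k : ℕ} (hs : s.card ≤ k) :
    ExteriorAlgebra.ι ℂ (b i) * psi Q (mon Q b s) ∈ low Q b (k + 1) := by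
  by_cases h : i ∈ s
  · obtain ⟨ε, -, he⟩ := (gen_mul_mon_of_notMem hb (s.notMem_erase i)).symm
    rw [Finset.insert_erase h] at he
    rw [he, map_smul, psi_ι_mul_contr, contr_psi_mon_of_notMem hb (s.notMem_erase i), add_zero,
      mul_smul_comm, ← mul_assoc, ExteriorAlgebra.ι_sq_zero, zero_mul, smul_zero]
    exact zero_mem _
  · obtain ⟨ε, -, he⟩ := gen_mul_mon_of_notMem hb h
    have h1 := psi_ι_mul_contr Q (b i) (mon Q b s)
    rw [contr_psi_mon_of_notMem hb h, add_zero, he, map_smul] at h1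
    rw [← h1]
    refine Submodule.smul_mem _ _ (psi_mon_mem_low ?_)
    rw [Finset.card_insert_of_notMem h]
    omega

theorem contr_psi_mon_mem_low (i : ι) {s : Finset ι} {k : ℕ} (hs : s.card ≤ k) :
    contr Q (b i) (psi Q (mon Q b s)) ∈ low Q b k := by
  by_cases h : i ∈ s
  · obtain ⟨ε, -, he⟩ := (gen_mul_mon_of_notMem hb (s.notMem_erase i)).symm
    have h0 := contr_psi_mon_of_notMem hb (s.notMem_erase i)
    rw [Finset.insert_erase h] at he
    rw [he, map_smul, psi_ι_mul_contr, h0, add_zero, map_smul, contr_ι_mul, h0, mul_zero, sub_zero]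
    exact Submodule.smul_mem _ _ (Submodule.smul_mem _ _
      (psi_mon_mem_low ((Finset.card_erase_le).trans hs)))
  · rw [contr_psi_mon_of_notMem hb h]
    exact zero_mem _

variable [Fintype ι]

theorem ι_mul_mem_low (x : V) {k : ℕ} {u : ExteriorAlgebra ℂ V} (hu : u ∈ low Q b k) :
    ExteriorAlgebra.ι ℂ x * u ∈ low Q b (k + 1) :=
  map_mem_low (LinearMap.mul ℂ (ExteriorAlgebra ℂ V) ∘ₗ ExteriorAlgebra.ι ℂ)
    (fun i _ hs => ι_mul_psi_mon_mem_low hb i hs) x hu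

theorem contr_mem_low (x : V) {k : ℕ} {u : ExteriorAlgebra ℂ V} (hu : u ∈ low Q b k) :
    contr Q x u ∈ low Q b k :=
  map_mem_low (CliffordAlgebra.contractLeft ∘ₗ form Q)
    (fun i _ hs => contr_psi_mon_mem_low hb i hs) x hu

theorem prod_ι_mem_low (l : List V) :
    (l.map (ExteriorAlgebra.ι ℂ)).prod ∈ low Q b l.length := by
  induction l with
  | nil => exact one_mem_low _
  | cons x l ih =>
    rw [List.map_cons, List.prod_cons, List.length_cons]
    exact ι_mul_mem_low hb x ih

/-- Modulo lower degree, a product of operators `ε(x) + ι(y)` applied to `1` is `∏ x`. -/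
theorem foldr_sub_prod_mem_low (f g : V → V) (l : List V) (k : ℕ) (hk : l.length ≤ k + 1) :
    l.foldr (fun y u => ExteriorAlgebra.ι ℂ (f y) * u + contr Q (g y) u) 1 -
      ((l.map f).map (ExteriorAlgebra.ι ℂ)).prod ∈ low Q b k := by
  induction l generalizing k with
  | nil => simp
  | cons y l ih =>
    rw [List.foldr_cons, List.map_cons, List.map_cons, List.prod_cons]
    set F := l.foldr (fun y u => ExteriorAlgebra.ι ℂ (f y) * u + contr Q (g y) u) 1 with hF
    set P := ((l.map f).map (ExteriorAlgebra.ι ℂ)).prod with hP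
    -- The product $P$ has at most $k$ factors, so its contraction already lies in `low k`. Only the
    -- error $F-P$, of degree one less by induction, meets an exterior multiplication.
    have e : ExteriorAlgebra.ι ℂ (f y) * F + contr Q (g y) F - ExteriorAlgebra.ι ℂ (f y) * P =
        ExteriorAlgebra.ι ℂ (f y) * (F - P) + contr Q (g y) (F - P) + contr Q (g y) P := by
      rw [mul_sub, map_sub]
      abel
    rw [List.length_cons] at hk
    have hP' : P ∈ low Q b k :=
      low_mono (by simpa using hk) (prod_ι_mem_low hb (l.map f))
    rw [e]
    refine add_mem ?_ (contr_mem_low hb _ hP')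
    cases k with
    | zero =>
      obtain rfl : l = [] := List.eq_nil_of_length_eq_zero (by omega)
      simp [hF, hP]
    | succ k =>
      have := ih k (by omega)
      exact add_mem (ι_mul_mem_low hb _ this) (contr_mem_low hb _ (low_mono (Nat.le_succ k) this))

/-- Pairing with the top monomial reads off the top coefficient, by orthogonality of the monomials.
-/
theorem pr0_mon_univ_mul_of_mem_low {k : ℕ} (hk : k < Fintype.card ι) {u : ExteriorAlgebra ℂ V}
    (hu : u ∈ low Q b k) : pr0 Q (mon Q b Finset.univ * (psi Q).symm u) = 0 := by
  induction hu using Submodule.span_induction with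
  | mem u hu =>
    obtain ⟨s, hs, rfl⟩ := hu
    rw [LinearEquiv.symm_apply_apply]
    refine pr0_mon_mul_mon hb fun h => ?_
    rw [← h, Finset.card_univ] at hs
    omega
  | zero => simp
  | add u v _ _ hu hv => rw [map_add, mul_add, map_add, hu, hv, add_zero]
  | smul r u _ hu => rw [map_smul, mul_smul_comm, map_smul, hu, smul_zero]

end Filtration

theorem mul_eq_scalarPart_smul [FiniteDimensional ℂ V] {w : ExteriorAlgebra ℂ V}
    (hw : w ∈ ⋀[ℂ]^(finrank ℂ V) V) (u : ExteriorAlgebra ℂ V) : w * u = scalarPart u • w := by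
  induction u using CliffordAlgebra.left_induction with
  | algebraMap r =>
    rw [← Algebra.commutes, ← Algebra.smul_def, AlgHom.commutes]
    rfl
  | add u v hu hv => rw [mul_add, hu, hv, map_add, add_smul]
  | ι_mul u x hu =>
    have h0 : w * ExteriorAlgebra.ι ℂ x = 0 := by
      have hm : w * ExteriorAlgebra.ι ℂ x ∈ ⋀[ℂ]^(finrank ℂ V + 1) V := by
        rw [ExteriorAlgebra.exteriorPower, pow_succ]
        exact Submodule.mul_mem_mul hw ⟨x, rfl⟩
      have hb : ⋀[ℂ]^(finrank ℂ V + 1) V = ⊥ := by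
        rw [← Submodule.finrank_eq_zero, exteriorPower.finrank_eq, Nat.choose_succ_self]
      rwa [hb, Submodule.mem_bot] at hm
    have h1 : scalarPart (ExteriorAlgebra.ι ℂ x * u) = 0 := scalarPart_ι_mul x u
    refine Eq.trans ?_ (zero_smul ℂ w).symm |>.trans (by rw [← h1])
    refine (mul_assoc w (ExteriorAlgebra.ι ℂ x) u).symm.trans ?_
    rw [h0, zero_mul]

/-- Reversal changes each monomial at most by a sign and fixes $1$, the only monomial seen by `pr0`.
-/
theorem pr0_reverse (hQ : (form Q).Nondegenerate) [FiniteDimensional ℂ V] (u : CliffordAlgebra Q) :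
    pr0 Q (CliffordAlgebra.reverse u) = pr0 Q u := by
  obtain ⟨b, hb⟩ := exists_isOrthonormal Q hQ
  rw [eq_sum_mon hb u, map_sum, map_sum, map_sum]
  refine Finset.sum_congr rfl fun s _ => ?_
  rw [map_smul, map_smul, map_smul]
  congr 1
  have hrev : ∀ l : List (Fin (finrank ℂ V)),
      CliffordAlgebra.reverse (word Q b l) = word Q b l.reverse := by
    intro l
    have h := CliffordAlgebra.reverse_prod_map_ι (Q := Q) (l.map b)
    rw [List.map_map, ← List.map_reverse] at h
    exact h
  by_cases hs : s = ∅
  · rw [hs, mon_empty, CliffordAlgebra.reverse.map_one]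
  · rw [pr0_mon hb hs, mon, hrev]
    obtain ⟨ε, -, he⟩ := word_signEq_mon hb (List.nodup_reverse.2 s.nodup_toList)
    rw [he, List.toFinset_reverse, Finset.toList_toFinset, map_smul, pr0_mon hb hs, smul_zero]

/-! ### The identity between $\mathrm{pr}_0(g)^2$ and $\det(1+T(g))$. -/

section Det

variable [FiniteDimensional ℂ V]

/-- Write $\hat v$ for the main involution. The operator $\varepsilon((1+T)y)+\iota((T-1)y)$ is
$v\mapsto T(y)v+\hat v y$. On $v=gw$ it gives $g(yw+\hat w y)$, because $T(y)g=gy$ and $g$ is even,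
and $yw+\hat wy=2\,y\wedge w$. So multiplication by $g$ turns it into twice an exterior
multiplication. -/
theorem foldr_mul_spin (g : Spin Q) (l : List V) (u : CliffordAlgebra Q) :
    l.foldr (fun y v => ExteriorAlgebra.ι ℂ ((1 + T Q g) y) * v + contr Q ((T Q g - 1) y) v)
        (psi Q (spinIncl Q g * u)) =
      psi Q (spinIncl Q g * (psi Q).symm
        ((2 : ℂ) ^ l.length • ((l.map (ExteriorAlgebra.ι ℂ)).prod * psi Q u))) := by
  induction l with
  | nil => rw [List.foldr_nil, List.map_nil, List.prod_nil, List.length_nil, pow_zero, one_smul, one_mul,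
      LinearEquiv.symm_apply_apply]
  | cons y l ih =>
    rw [List.foldr_cons, ih]
    set v := (psi Q).symm ((2 : ℂ) ^ l.length • ((l.map (ExteriorAlgebra.ι ℂ)).prod * psi Q u))
      with hv
    have hP : ∀ v : CliffordAlgebra Q,
        ExteriorAlgebra.ι ℂ ((1 + T Q g) y) * psi Q v + contr Q ((T Q g - 1) y) (psi Q v) =
          psi Q (CliffordAlgebra.ι Q (T Q g y) * v +
            CliffordAlgebra.involute v * CliffordAlgebra.ι Q y) := by
      intro v
      have h2 : psi Q (CliffordAlgebra.involute v * CliffordAlgebra.ι Q y) =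
          ExteriorAlgebra.ι ℂ y * psi Q v - contr Q y (psi Q v) := by
        rw [psi_mul_ι, psi_involute, CliffordAlgebra.involute_involute]
        rfl
      rw [map_add, psi_ι_mul_contr, h2, LinearMap.add_apply, LinearMap.sub_apply,
        Module.End.one_apply, sub_eq_add_neg, contr_add, map_add, add_mul, ← neg_one_smul ℂ y,
        contr_smul]
      simp only [LinearMap.add_apply, LinearMap.smul_apply, neg_smul, one_smul]
      abel
    have hE : ∀ v : CliffordAlgebra Q, CliffordAlgebra.ι Q y * v + CliffordAlgebra.involute v * CliffordAlgebra.ι Q y =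
        (psi Q).symm ((2 : ℂ) • (ExteriorAlgebra.ι ℂ y * psi Q v)) := by
      intro v
      apply (psi Q).injective
      have h2 : psi Q (CliffordAlgebra.involute v * CliffordAlgebra.ι Q y) =
          ExteriorAlgebra.ι ℂ y * psi Q v - contr Q y (psi Q v) := by
        rw [psi_mul_ι, psi_involute, CliffordAlgebra.involute_involute]
        rfl
      rw [map_add, psi_ι_mul_contr, h2, LinearEquiv.apply_symm_apply, two_smul ℂ]
      abel
    rw [hP, ← mul_assoc, ι_T_mul, map_mul,
      CliffordAlgebra.involute_eq_of_mem_even (spinIncl_mem_even g), mul_assoc, mul_assoc, ← mul_add,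
      hE, hv, LinearEquiv.apply_symm_apply, mul_smul_comm, smul_smul, List.map_cons, List.prod_cons,
      List.length_cons, pow_succ', mul_assoc]

/-- The operators of `foldr_mul_spin` for all basis vectors are applied to $1=gg^{-1}$, and top
coefficients are compared. One side is $2^n\mathrm{pr}_0(g)\,\mathrm{pr}_0(g^{-1})$, where
$\mathrm{pr}_0(g^{-1})=\mathrm{pr}_0(g)$ since $g^{-1}$ is the reverse of $g$; the other is
$\det(1+T(g))$, as contractions only affect lower degrees. -/
theorem two_pow_mul_pr0_sq (hQ : (form Q).Nondegenerate) (hn : 0 < finrank ℂ V) (g : Spin Q) :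
    (2 : ℂ) ^ finrank ℂ V * pr0 Q (spinIncl Q g) ^ 2 = LinearMap.det (1 + T Q g) := by
  obtain ⟨b, hb⟩ := exists_isOrthonormal Q hQ
  set m := mon Q b Finset.univ with hm
  let l : List V := List.ofFn b
  have hl : l.length = finrank ℂ V := List.length_ofFn
  let θ : ExteriorAlgebra ℂ V →ₗ[ℂ] ℂ :=
    pr0 Q ∘ₗ LinearMap.mulLeft ℂ m ∘ₗ (psi Q).symm.toLinearMap
  have hθ : ∀ u, θ u = pr0 Q (m * (psi Q).symm u) := fun _ => rfl
  let ω := (l.map (ExteriorAlgebra.ι ℂ)).prod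
  have hωw : (psi Q).symm ω = word Q b (List.finRange (finrank ℂ V)) := by
    rw [LinearEquiv.symm_apply_eq]
    have : ∀ l' : List (Fin (finrank ℂ V)), l'.Nodup →
        ((l'.map b).map (ExteriorAlgebra.ι ℂ)).prod = psi Q (word Q b l') := by
      intro l' hl'
      induction l' with
      | nil => rw [word_nil, psi_one]; rfl
      | cons i l' ih =>
        obtain ⟨h1, h2⟩ := List.nodup_cons.1 hl'
        rw [psi_word_cons hb h1, ← ih h2]
        rfl
    rw [← this _ (List.nodup_finRange (finrank ℂ V)), ← List.ofFn_eq_map]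
  have hωm : ω ∈ ⋀[ℂ]^(finrank ℂ V) V := by
    have := psi_word_mem hb (List.nodup_finRange (finrank ℂ V))
    rwa [← hωw, LinearEquiv.apply_symm_apply, List.length_finRange] at this
  obtain ⟨ε, hε, hεm⟩ := word_signEq_mon hb (List.nodup_finRange (finrank ℂ V))
  rw [List.toFinset_finRange, ← hm] at hεm
  have hsq := monSq_mul_self hb (Finset.univ : Finset (Fin (finrank ℂ V)))
  have hmm : m * m = algebraMap ℂ _ (monSq Q b Finset.univ) := mon_mul_self hb _
  have hθω : θ ω = ε * monSq Q b Finset.univ := by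
    rw [hθ, hωw, hεm, mul_smul_comm, map_smul, monSq, smul_eq_mul]
  have h1 := foldr_mul_spin g l (spinIncl Q g⁻¹)
  rw [spinIncl_mul_inv, psi_one, mul_eq_scalarPart_smul hωm, hl] at h1
  have h2 := pr0_mon_univ_mul_of_mem_low hb (k := finrank ℂ V - 1) (by simp; omega)
    (foldr_sub_prod_mem_low hb (fun y => (1 + T Q g) y) (fun y => (T Q g - 1) y) l (finrank ℂ V - 1)
      (by omega))
  change θ _ = 0 at h2
  rw [map_sub, sub_eq_zero] at h2
  have h3 : θ ((l.map fun y => (1 + T Q g) y).map (ExteriorAlgebra.ι ℂ)).prod =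
      LinearMap.det (1 + T Q g) * θ ω := by
    -- An alternating $n$-form changes under an endomorphism by its determinant.
    let f : V [⋀^Fin (finrank ℂ V)]→ₗ[ℂ] ℂ := θ.compAlternatingMap (ExteriorAlgebra.ιMulti ℂ (finrank ℂ V))
    have hf : ∀ v : Fin (finrank ℂ V) → V, f v = θ ((List.ofFn v).map (ExteriorAlgebra.ι ℂ)).prod := by
      intro v
      rw [List.map_ofFn]
      change θ (ExteriorAlgebra.ιMulti ℂ (finrank ℂ V) v) = _
      rw [ExteriorAlgebra.ιMulti_apply]
      rfl
    have h4 := AlternatingMap.eq_smul_basis_det b f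
    have h5 := DFunLike.congr_fun h4 (⇑(1 + T Q g : End ℂ V) ∘ b)
    rw [AlternatingMap.smul_apply, Basis.det_comp, Basis.det_self, mul_one, hf, hf, smul_eq_mul,
      mul_comm] at h5
    rw [← h5, List.map_ofFn]
  rw [h3] at h2
  rw [h1, hθ, LinearEquiv.symm_apply_apply, map_smul, map_smul, mul_smul_comm, mul_smul_comm,
    mul_smul_comm, mul_smul_comm, hωw, hεm, mul_smul_comm, mul_smul_comm, map_smul, map_smul,
    map_smul, pr0_mul_comm, mul_assoc, hmm, ← Algebra.commutes, ← Algebra.smul_def, map_smul, hθω,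
    ← pr0_eq, ← reverse_spinIncl, pr0_reverse hQ] at h2
  simp only [smul_eq_mul] at h2
  have h0 : ε * monSq Q b Finset.univ * (ε * monSq Q b Finset.univ) = 1 := by
    linear_combination hε * (monSq Q b Finset.univ) ^ 2 + hsq
  have h0' : ε * monSq Q b Finset.univ ≠ 0 := fun h => by simp [h] at h0
  apply mul_right_cancel₀ h0'
  linear_combination h2

end Det

end CayleySpin

end

noncomputable section

namespace CayleySpin

variable {V : Type*} [AddCommGroup V] [Module ℂ V] {Q : QuadraticForm ℂ V}

/-! ### The classical Cayley transform -/

theorem IsSkew.smul {s : End ℂ V} (hs : IsSkew Q s) (c : ℂ) : IsSkew Q (c • s) := by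
  intro x y
  simp only [LinearMap.smul_apply, map_smul, hs x y, smul_neg]

/-! ### Skew endomorphisms as skew-symmetric matrices. -/

section Matrix

variable {ι : Type*} [Fintype ι] [DecidableEq ι] {b : Basis ι ℂ V} (hb : IsOrthonormal Q b)
include hb

theorem repr_eq_form (x : V) (i : ι) : b.repr x i = form Q (b i) x := by
  conv_rhs => rw [← b.sum_repr x]
  have hi : ∀ j, form Q (b i) (b j) = if i = j then 1 else 0 := hb i
  simp only [map_sum, map_smul, hi]
  simp

theorem toMatrix_apply_form (s : End ℂ V) (i j : ι) :
    LinearMap.toMatrix b b s i j = form Q (b i) (s (b j)) := by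
  rw [LinearMap.toMatrix_apply, repr_eq_form hb]

theorem transpose_toMatrix_of_isSkew {s : End ℂ V} (hs : IsSkew Q s) :
    (LinearMap.toMatrix b b s).transpose = -LinearMap.toMatrix b b s := by
  ext i j
  rw [Matrix.transpose_apply, Matrix.neg_apply, toMatrix_apply_form hb, toMatrix_apply_form hb,
    form_comm, hs]

theorem isSkew_of_transpose {s : End ℂ V}
    (hs : (LinearMap.toMatrix b b s).transpose = -LinearMap.toMatrix b b s) : IsSkew Q s := by
  have h : ∀ i j, form Q (s (b i)) (b j) = -form Q (b i) (s (b j)) := by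
    intro i j
    have := congrFun (congrFun hs i) j
    rwa [Matrix.transpose_apply, Matrix.neg_apply, toMatrix_apply_form hb,
      toMatrix_apply_form hb, form_comm] at this
  intro x y
  rw [← b.sum_repr x, ← b.sum_repr y]
  simp only [map_sum, map_smul, LinearMap.sum_apply, LinearMap.smul_apply, h, smul_neg,
    Finset.sum_neg_distrib]

theorem det_add_eq_det_sub {s : End ℂ V} (hs : IsSkew Q s) (c : ℂ) :
    LinearMap.det (c • (1 : End ℂ V) - s) = LinearMap.det (c • (1 : End ℂ V) + s) := by
  rw [← LinearMap.det_toMatrix b, ← LinearMap.det_toMatrix b (c • (1 : End ℂ V) + s),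
    ← Matrix.det_transpose, map_sub, map_add, map_smul, Matrix.transpose_sub,
    transpose_toMatrix_of_isSkew hb hs, sub_neg_eq_add, Matrix.transpose_smul,
    LinearMap.toMatrix_one, Matrix.transpose_one]

end Matrix

variable [FiniteDimensional ℂ V]

theorem isUnit_of_det_ne_zero {f : End ℂ V} (h : LinearMap.det f ≠ 0) : IsUnit f :=
  (LinearMap.isUnit_iff_isUnit_det f).2 h.isUnit

section Spin

variable {S : Type*} [AddCommGroup S] [Module ℂ S] [FiniteDimensional ℂ S]
  {σ : CZ Q →ₐ[ℂ] End ℂ S} (hQ : (form Q).Nondegenerate) (hn : 0 < finrank ℂ V)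

/-- The inverse-free form of the Cayley transform; the factors $2$ come from $(1+t)\pm(1-t)$. -/
theorem T_one_add_Gamma {t : End ℂ V} (h : IsUnit (1 + t)) :
    t * (1 + Gamma t) = 1 - Gamma t ∧ IsUnit (1 + Gamma t) ∧
      1 - Gamma t = (2 : ℂ) • (t * Ring.inverse (1 + t)) ∧
      1 + Gamma t = (2 : ℂ) • Ring.inverse (1 + t) := by
  have hi : (1 + t) * Ring.inverse (1 + t) = 1 := Ring.mul_inverse_cancel _ h
  have e1 : 1 + Gamma t = (2 : ℂ) • Ring.inverse (1 + t) := by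
    have e : (1 + t) * Ring.inverse (1 + t) + (1 - t) * Ring.inverse (1 + t) =
        (2 : ℂ) • Ring.inverse (1 + t) := by
      rw [← add_mul, add_add_sub_cancel, ← two_smul ℂ, smul_mul_assoc, one_mul]
    rwa [hi] at e
  have e2 : 1 - Gamma t = (2 : ℂ) • (t * Ring.inverse (1 + t)) := by
    have e : (1 + t) * Ring.inverse (1 + t) - (1 - t) * Ring.inverse (1 + t) =
        (2 : ℂ) • (t * Ring.inverse (1 + t)) := by
      rw [← sub_mul, add_sub_sub_cancel, ← two_smul ℂ, smul_mul_assoc]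
    rwa [hi] at e
  refine ⟨by rw [e1, e2, mul_smul_comm], ?_, e2, e1⟩
  rw [e1, Algebra.smul_def]
  exact ((isUnit_iff_ne_zero.2 two_ne_zero).map (algebraMap ℂ (End ℂ V))).mul
    (isUnit_ringInverse.2 h)

theorem spinStar_iff (hQ : (form Q).Nondegenerate) (hn : 0 < finrank ℂ V) (g : Spin Q) :
    g ∈ SpinStar Q ↔ pr0 Q (spinIncl Q g) ≠ 0 := by
  change LinearMap.det (1 + T Q g) ≠ 0 ↔ _
  rw [← two_pow_mul_pr0_sq hQ hn]
  simp

include hQ hn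

/-- Take determinants in $T(1+\Gamma)=1-\Gamma$; transposition gives $\det(1-\Gamma)=\det(1+\Gamma)$
for skew $\Gamma$, and this is nonzero. -/
theorem det_T (g : Spin Q) (hg : IsSkew Q (Gamma (T Q g))) (h : IsUnit (1 + T Q g)) :
    LinearMap.det (T Q g) = 1 := by
  obtain ⟨b, hb⟩ := exists_isOrthonormal Q hQ
  obtain ⟨h1, h2, -, -⟩ := T_one_add_Gamma h
  have h3 := congrArg LinearMap.det h1
  have h4 := det_add_eq_det_sub hb hg 1
  rw [one_smul] at h4
  rw [map_mul, h4] at h3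
  exact mul_right_cancel₀ ((LinearMap.isUnit_iff_isUnit_det _).1 h2).ne_zero
    (h3.trans (one_mul _).symm)

variable (hσ : IsSpinModule Q σ)
include hσ

theorem tau_Phi {g : Spin Q} (hg : g ∈ SpinStar Q) :
    tau Q (Phi σ g) = (-2 * pr0 Q (spinIncl Q g)) • Gamma (T Q g) := by
  have hu := isUnit_of_det_ne_zero hg
  have hi : (1 + T Q g) * Ring.inverse (1 + T Q g) = 1 := Ring.mul_inverse_cancel _ hu
  have h := pr0_smul_T_sub_one hQ hn hσ g
  have h2 := congrArg (fun f => (2 : ℂ) • (f * Ring.inverse (1 + T Q g))) h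
  simp only [smul_mul_assoc, smul_smul, mul_assoc, hi, mul_one] at h2
  norm_num at h2
  rw [← h2, Gamma, ← neg_sub, neg_mul, smul_neg, ← neg_smul]
  congr 1
  ring

theorem Gamma_T_eq {g : Spin Q} (hg : g ∈ SpinStar Q) :
    Gamma (T Q g) = tau Q ((-2 * pr0 Q (spinIncl Q g))⁻¹ • Phi σ g) := by
  rw [map_smul, tau_Phi hQ hn hσ hg, smul_smul, inv_mul_cancel₀, one_smul]
  exact mul_ne_zero (by norm_num) ((spinStar_iff hQ hn g).1 hg)

theorem cayley_spinStar {g : Spin Q} (hg : g ∈ SpinStar Q) :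
    IsSO Q (T Q g) ∧
      IsSkew Q (Gamma (T Q g)) ∧ IsUnit (1 + Gamma (T Q g)) ∧ IsUnit (1 - Gamma (T Q g)) ∧
      ∃ w : Lie V, (∀ u : Lie V, tau Q u = Gamma (T Q g) ↔ u = w) ∧
        Phi σ g = (-2 * pr0 Q (spinIncl Q g)) • w := by
  obtain ⟨b, hb⟩ := exists_isOrthonormal Q hQ
  have hu := isUnit_of_det_ne_zero hg
  have hΓ := Gamma_T_eq hQ hn hσ hg
  have hs : IsSkew Q (Gamma (T Q g)) := by rw [hΓ]; exact tau_isSkew Q _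
  have hdet := det_T hQ hn g hs hu
  obtain ⟨h1, h2, -⟩ := T_one_add_Gamma hu
  refine ⟨⟨form_T Q g, hdet⟩, hs, h2, ?_,
    (-2 * pr0 Q (spinIncl Q g))⁻¹ • Phi σ g, fun u => ?_, ?_⟩
  · rw [← h1]
    exact (isUnit_of_det_ne_zero (by rw [hdet]; exact one_ne_zero)).mul h2
  · rw [hΓ]
    exact (tau_injective hb).eq_iff
  · rw [smul_smul, mul_inv_cancel₀, one_smul]
    exact mul_ne_zero (by norm_num) ((spinStar_iff hQ hn g).1 hg)

end Spin

end CayleySpin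

end

noncomputable section

namespace CayleySpin

/-! ### Regular functions on a vector space -/

section VectorSpace

variable {E ι : Type*} [AddCommGroup E] [Module ℂ E] (b : Basis ι ℂ E)

/-- The polynomial function on `E` given by a polynomial in the coordinates. -/
def polyFun : MvPolynomial ι ℂ →ₐ[ℂ] (E → ℂ) := MvPolynomial.aeval fun i x => b.coord i x

theorem polyFun_apply (p : MvPolynomial ι ℂ) (x : E) :
    polyFun b p x = MvPolynomial.eval (fun i => b.coord i x) p := by
  have : (Pi.evalAlgHom ℂ (fun _ : E => ℂ) x).comp (polyFun b) =
      MvPolynomial.aeval fun i => b.coord i x := by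
    ext i
    simp [polyFun]
  exact (DFunLike.congr_fun this p).trans (by rw [MvPolynomial.aeval_eq_eval])

variable [Fintype ι]

theorem polyFun_injective : Function.Injective (polyFun b) := by
  intro p q h
  refine MvPolynomial.funext fun c => ?_
  have h1 := congrFun h (b.equivFun.symm c)
  rw [polyFun_apply, polyFun_apply] at h1
  have h2 : (fun i => b.coord i (b.equivFun.symm c)) = c := by
    funext i
    rw [Basis.coord_apply, ← Basis.equivFun_apply, LinearEquiv.apply_symm_apply]
  rwa [h2] at h1

theorem range_polyFun : (polyFun b).range = regular (id : E → E) := by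
  rw [polyFun, ← Algebra.adjoin_range_eq_range_aeval]
  refine le_antisymm (Algebra.adjoin_le ?_) (Algebra.adjoin_le ?_)
  · rintro _ ⟨i, rfl⟩
    exact linear_mem_regular (id : E → E) (b.coord i)
  · rintro _ ⟨l, rfl⟩
    have : (fun x : E => l (id x)) = ∑ i, l (b i) • fun x => b.coord i x := by
      funext x
      rw [id]
      conv_lhs => rw [← b.sum_repr x]
      simp only [map_sum, map_smul, Finset.sum_apply, Pi.smul_apply, smul_eq_mul, Basis.coord_apply,
        mul_comm]
    rw [this]
    exact Subalgebra.sum_mem _ fun i _ =>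
      Subalgebra.smul_mem _ (Algebra.subset_adjoin (Set.mem_range_self i)) _

/-- The regular functions on a vector space form a polynomial algebra. -/
def regularEquiv {j : E → E} (hj : j = id) : MvPolynomial ι ℂ ≃ₐ[ℂ] regular j :=
  (AlgEquiv.ofInjective (polyFun b) (polyFun_injective b)).trans
    (Subalgebra.equivOfEq _ _ (by rw [hj, range_polyFun]))

theorem regularEquiv_apply {j : E → E} (hj : j = id) (p : MvPolynomial ι ℂ) (x : E) :
    (regularEquiv b hj p : E → ℂ) x = MvPolynomial.eval (fun i => b.coord i x) p :=
  polyFun_apply b p x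

end VectorSpace

section FiniteDimensional

variable {E : Type*} [AddCommGroup E] [Module ℂ E] [FiniteDimensional ℂ E] {j : E → E}

theorem isDomain_regular (hj : j = id) : IsDomain (regular j) :=
  (regularEquiv (Module.finBasis ℂ E) hj).symm.toMulEquiv.isDomain _

theorem isIntegrallyClosed_regular (hj : j = id) : IsIntegrallyClosed (regular j) :=
  IsIntegrallyClosed.of_equiv (regularEquiv (Module.finBasis ℂ E) hj).toRingEquiv

/-- Restriction to an affine line is the specialization that reduces irreducibility over
$A(\wedge^2V)$ to a question in two variables. -/
theorem exists_restrictLine (hj : j = id) (x y : E) :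
    ∃ φ : regular j →ₐ[ℂ] Polynomial ℂ, ∀ f t, (φ f).eval t = (f : E → ℂ) (x + t • y) := by
  let b := Module.finBasis ℂ E
  let e := regularEquiv b hj
  let ψ : MvPolynomial (Fin (finrank ℂ E)) ℂ →ₐ[ℂ] Polynomial ℂ := MvPolynomial.aeval fun i =>
    Polynomial.C (b.coord i x) + Polynomial.C (b.coord i y) * Polynomial.X
  refine ⟨ψ.comp e.symm.toAlgHom, fun f t => ?_⟩
  have h1 : (Polynomial.aeval t).comp ψ =
      MvPolynomial.aeval (R := ℂ) (fun i => b.coord i (x + t • y)) := by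
    ext i
    simp only [ψ, AlgHom.comp_apply, MvPolynomial.aeval_X, map_add, map_smul, smul_eq_mul,
      Polynomial.coe_aeval_eq_eval, Polynomial.eval_mul, Polynomial.eval_C,
      Polynomial.eval_X]
    ring
  have h2 : f = e (e.symm f) := (e.apply_symm_apply f).symm
  have h3 := regularEquiv_apply b hj (e.symm f) (x + t • y)
  change (e (e.symm f) : E → ℂ) (x + t • y) = _ at h3
  rw [← h2] at h3
  rw [h3, ← MvPolynomial.aeval_eq_eval, ← h1]
  rfl

theorem bilin_mem_regular (hj : j = id) (B : E →ₗ[ℂ] E →ₗ[ℂ] ℂ) : (fun x => B x x) ∈ regular j := by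
  subst hj
  have : (fun x => B x x) = ∑ i, (fun x : E => (Module.finBasis ℂ E).coord i (id x)) *
      fun x : E => B (Module.finBasis ℂ E i) (id x) := by
    funext x
    simp only [Finset.sum_apply, Pi.mul_apply, id]
    conv_lhs => enter [1]; rw [← (Module.finBasis ℂ E).sum_repr x]
    simp only [map_sum, map_smul, LinearMap.sum_apply, LinearMap.smul_apply, smul_eq_mul]
    rfl
  rw [this]
  exact Subalgebra.sum_mem _ fun i _ => Subalgebra.mul_mem _
    (linear_mem_regular (id : E → E) ((Module.finBasis ℂ E).coord i))
    (linear_mem_regular (id : E → E) (B (Module.finBasis ℂ E i)))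

end FiniteDimensional

/-! ### Reflections -/

variable {V : Type*} [AddCommGroup V] [Module ℂ V] (Q : QuadraticForm ℂ V)

/-- The reflection `x ↦ x - 2 (v, x) v` in a unit vector `v`. -/
def refl (v : V) : End ℂ V := LinearMap.transvection ((-2 : ℂ) • form Q v) v

theorem refl_apply (v x : V) : refl Q v x = x - (2 * form Q v x) • v := by
  rw [refl, LinearMap.transvection.apply, LinearMap.smul_apply, smul_eq_mul, neg_mul, neg_smul,
    sub_eq_add_neg]

/-- The Clifford product of a list of vectors. -/
def vprod (l : List V) : CliffordAlgebra Q := (l.map (CliffordAlgebra.ι Q)).prod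

theorem vprod_cons (v : V) (l : List V) :
    vprod Q (v :: l) = CliffordAlgebra.ι Q v * vprod Q l := rfl

theorem vprod_append (l l' : List V) : vprod Q (l ++ l') = vprod Q l * vprod Q l' := by
  rw [vprod, List.map_append, List.prod_append]; rfl

theorem reverse_vprod (l : List V) :
    CliffordAlgebra.reverse (vprod Q l) = vprod Q l.reverse := by
  rw [vprod, vprod, CliffordAlgebra.reverse_prod_map_ι, List.map_reverse]

theorem vprod_parity (l : List V) :
    (Even l.length → vprod Q l ∈ CliffordAlgebra.evenOdd Q 0) ∧
      (Odd l.length → vprod Q l ∈ CliffordAlgebra.evenOdd Q 1) := by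
  induction l with
  | nil => exact ⟨fun _ => (CliffordAlgebra.even Q).one_mem, by simp⟩
  | cons v l ih =>
    rw [vprod_cons, List.length_cons, Nat.even_add_one, Nat.odd_add_one, Nat.not_even_iff_odd,
      Nat.not_odd_iff_even]
    exact ⟨fun h => CliffordAlgebra.evenOdd_mul_le Q 1 1
        (Submodule.mul_mem_mul (CliffordAlgebra.ι_mem_evenOdd_one Q _) (ih.2 h)),
      fun h => CliffordAlgebra.evenOdd_mul_le Q 1 0
        (Submodule.mul_mem_mul (CliffordAlgebra.ι_mem_evenOdd_one Q _) (ih.1 h))⟩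

variable {Q}

theorem refl_mul_self {v : V} (hv : form Q v v = 1) : refl Q v * refl Q v = 1 := by
  ext x
  rw [Module.End.mul_apply, refl_apply, refl_apply, map_sub, map_smul, hv, Module.End.one_apply,
    sub_sub, ← add_smul, smul_eq_mul]
  ring_nf
  simp

theorem det_refl [FiniteDimensional ℂ V] {v : V} (hv : form Q v v = 1) :
    LinearMap.det (refl Q v) = -1 := by
  rw [refl, LinearMap.transvection.det, LinearMap.smul_apply, hv]
  norm_num

theorem ι_mul_ι_mul_ι {v : V} (hv : form Q v v = 1) (x : V) :
    CliffordAlgebra.ι Q v * CliffordAlgebra.ι Q x * CliffordAlgebra.ι Q v =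
      -CliffordAlgebra.ι Q (refl Q v x) := by
  rw [mul_assoc, ι_mul_swap Q x v, mul_add, mul_neg, ← mul_assoc, ι_mul_self, hv, map_one, one_mul,
    refl_apply, map_sub, map_smul, ← Algebra.commutes, ← Algebra.smul_def, form_comm Q x]
  abel

/-- A list of unit vectors. -/
def IsUnitList (Q : QuadraticForm ℂ V) (l : List V) : Prop := ∀ v ∈ l, form Q v v = 1

theorem IsUnitList.of_cons {v : V} {l : List V} (h : IsUnitList Q (v :: l)) :
    form Q v v = 1 ∧ IsUnitList Q l :=
  ⟨h v List.mem_cons_self, fun w hw => h w (List.mem_cons_of_mem _ hw)⟩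

theorem IsUnitList.cons {v : V} {l : List V} (hv : form Q v v = 1) (h : IsUnitList Q l) :
    IsUnitList Q (v :: l) := by
  intro w hw
  obtain rfl | hw := List.mem_cons.1 hw
  exacts [hv, h w hw]

theorem vprod_mul_reverse {l : List V} (h : IsUnitList Q l) :
    vprod Q l * vprod Q l.reverse = 1 := by
  induction l with
  | nil => exact mul_one _
  | cons v l ih =>
    obtain ⟨hv, hl⟩ := h.of_cons
    rw [List.reverse_cons, vprod_append, vprod_cons, mul_assoc, ← mul_assoc (vprod Q l), ih hl,
      one_mul, vprod_cons, ← mul_assoc, ι_mul_self, hv, map_one, one_mul]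
    rfl

theorem IsUnitList.reverse {l : List V} (h : IsUnitList Q l) : IsUnitList Q l.reverse :=
  fun v hv => h v (List.mem_reverse.1 hv)

theorem vprod_conj {l : List V} (h : IsUnitList Q l) (x : V) :
    vprod Q l * CliffordAlgebra.ι Q x * vprod Q l.reverse =
      (-1 : ℂ) ^ l.length • CliffordAlgebra.ι Q ((l.map (refl Q)).prod x) := by
  induction l with
  | nil => simp [vprod]
  | cons v l ih =>
    obtain ⟨hv, hl⟩ := h.of_cons
    have e : vprod Q (v :: l) * CliffordAlgebra.ι Q x * vprod Q (v :: l).reverse =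
        CliffordAlgebra.ι Q v * (vprod Q l * CliffordAlgebra.ι Q x * vprod Q l.reverse) *
          CliffordAlgebra.ι Q v := by
      rw [List.reverse_cons, vprod_append, vprod_cons]
      simp only [vprod, List.map_cons, List.map_nil, List.prod_cons, List.prod_nil, mul_one,
        mul_assoc]
    rw [e, ih hl, mul_smul_comm, smul_mul_assoc, ι_mul_ι_mul_ι hv, List.map_cons, List.prod_cons,
      List.length_cons, pow_succ, mul_smul, neg_one_smul, Module.End.mul_apply]

theorem refl_prod_reverse {l : List V} (h : IsUnitList Q l) :
    (l.reverse.map (refl Q)).prod * (l.map (refl Q)).prod = 1 := by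
  induction l with
  | nil => simp
  | cons v l ih =>
    obtain ⟨hv, hl⟩ := h.of_cons
    rw [List.reverse_cons, List.map_append, List.prod_append, List.map_singleton, List.prod_singleton,
      List.map_cons, List.prod_cons, mul_assoc, ← mul_assoc (refl Q v),
      refl_mul_self hv, one_mul, ih hl]

theorem det_refl_prod [FiniteDimensional ℂ V] {l : List V} (h : IsUnitList Q l) :
    LinearMap.det (l.map (refl Q)).prod = (-1) ^ l.length := by
  induction l with
  | nil => simp
  | cons v l ih =>
    obtain ⟨hv, hl⟩ := h.of_cons
    rw [List.map_cons, List.prod_cons, map_mul, det_refl hv, ih hl, List.length_cons, pow_succ']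

theorem form_refl {v : V} (hv : form Q v v = 1) (x y : V) :
    form Q (refl Q v x) (refl Q v y) = form Q x y := by
  simp only [refl_apply, map_sub, map_smul, LinearMap.sub_apply, LinearMap.smul_apply, smul_eq_mul,
    hv, form_comm Q x v]
  ring

theorem form_refl_prod {l : List V} (h : IsUnitList Q l) (x y : V) :
    form Q ((l.map (refl Q)).prod x) ((l.map (refl Q)).prod y) = form Q x y := by
  induction l with
  | nil => rfl
  | cons v l ih =>
    obtain ⟨hv, hl⟩ := h.of_cons
    rw [List.map_cons, List.prod_cons, Module.End.mul_apply, Module.End.mul_apply, form_refl hv,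
      ih hl]

/-- A unit vector `y` is moved to a unit vector `x` by reflections in the plane of `x` and `y`. -/
theorem exists_refl_prod_eq {x y : V} (hx : form Q x x = 1) (hy : form Q y y = 1) :
    ∃ l : List V, IsUnitList Q l ∧ (∀ v ∈ l, ∃ c d : ℂ, v = c • x + d • y) ∧
      (l.map (refl Q)).prod y = x := by
  by_cases h : form Q x y = 1
  -- When $(x,y)=1$ the vector $x-y$ is isotropic. Instead one reflects in the normalized $x+y$,
  -- where $(x+y,x+y)=4$, which sends $y$ to $-x$, and then in $x$.
  · obtain ⟨c, hc⟩ := IsAlgClosed.exists_eq_mul_self (4 : ℂ)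
    have hc0 : c ≠ 0 := fun h => by norm_num [h] at hc
    have hv : form Q (c⁻¹ • x + c⁻¹ • y) (c⁻¹ • x + c⁻¹ • y) = 1 := by
      simp only [map_add, map_smul, LinearMap.add_apply, LinearMap.smul_apply, smul_eq_mul, hx, hy,
        h, form_comm Q y x]
      field_simp
      linear_combination hc
    refine ⟨[x, c⁻¹ • x + c⁻¹ • y], .cons hx (.cons hv (by simp [IsUnitList])), ?_, ?_⟩
    · intro v hv
      obtain rfl | hv := List.mem_cons.1 hv
      · exact ⟨1, 0, by simp⟩
      · rw [List.mem_singleton.1 hv]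
        exact ⟨_, _, rfl⟩
    · have h1 : form Q (c⁻¹ • x + c⁻¹ • y) y = 2 * c⁻¹ := by
        simp only [map_add, map_smul, LinearMap.add_apply, LinearMap.smul_apply, smul_eq_mul, hy, h]
        ring
      have h2 : 2 * (2 * c⁻¹) * c⁻¹ = 1 := by
        field_simp
        linear_combination hc
      rw [List.map_cons, List.map_cons, List.map_nil, List.prod_cons, List.prod_singleton,
        Module.End.mul_apply, refl_apply Q (c⁻¹ • x + c⁻¹ • y), h1, smul_add, smul_smul, smul_smul,
        h2, one_smul, one_smul, sub_add_cancel_right, refl_apply, map_neg, hx]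
      module
  -- Here $c^2=(x-y,x-y)\ne0$, and the reflection in $x-y$ exchanges $x$ and $y$.
  · obtain ⟨c, hc⟩ := IsAlgClosed.exists_eq_mul_self (2 - 2 * form Q x y)
    have hc0 : c ≠ 0 := fun h' => h (by rw [h'] at hc; linear_combination -hc / 2)
    have hv : form Q (c⁻¹ • x + (-c⁻¹) • y) (c⁻¹ • x + (-c⁻¹) • y) = 1 := by
      simp only [map_add, map_smul, LinearMap.add_apply, LinearMap.smul_apply, smul_eq_mul, hx, hy,
        form_comm Q y x]
      field_simp
      linear_combination hc
    refine ⟨[c⁻¹ • x + (-c⁻¹) • y], .cons hv (by simp [IsUnitList]), ?_, ?_⟩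
    · intro v hv
      rw [List.mem_singleton.1 hv]
      exact ⟨_, _, rfl⟩
    · have h1 : form Q (c⁻¹ • x + (-c⁻¹) • y) y = c⁻¹ * (form Q x y - 1) := by
        simp only [map_add, map_smul, LinearMap.add_apply, LinearMap.smul_apply, smul_eq_mul, hy]
        ring
      have h2 : 2 * (c⁻¹ * (form Q x y - 1)) * c⁻¹ = -1 := by
        field_simp
        linear_combination -hc
      rw [List.map_cons, List.map_nil, List.prod_singleton, refl_apply, h1, smul_add, smul_smul,
        smul_smul, mul_neg, h2]
      module

/-- Every isometry is a product of reflections. -/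
theorem exists_eq_refl_prod [FiniteDimensional ℂ V] (hQ : (form Q).Nondegenerate) {f : End ℂ V}
    (hf : ∀ x y, form Q (f x) (f y) = form Q x y) :
    ∃ l : List V, IsUnitList Q l ∧ f = (l.map (refl Q)).prod := by
  obtain ⟨b, hb⟩ := exists_isOrthonormal Q hQ
  have hb1 : ∀ i, form Q (b i) (b i) = 1 := fun i => by rw [hb, if_pos rfl]
  -- Basis vectors are fixed one at a time. The new reflections are in vectors of the plane of $b_i$
  -- and its image, which is orthogonal to the $b_j$ already fixed, so these stay fixed.
  have key : ∀ s : Finset (Fin (finrank ℂ V)), ∃ l : List V, IsUnitList Q l ∧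
      ∀ i ∈ s, ((l.map (refl Q)).prod * f) (b i) = b i := by
    intro s
    induction s using Finset.induction_on with
    | empty => exact ⟨[], by simp [IsUnitList], by simp⟩
    | insert i s hi ih =>
      obtain ⟨l, hl, hls⟩ := ih
      set p := (l.map (refl Q)).prod * f with hp
      have hp' : ∀ x y, form Q (p x) (p y) = form Q x y := by
        intro x y
        rw [hp, Module.End.mul_apply, Module.End.mul_apply, form_refl_prod hl, hf]
      obtain ⟨l', hl', hspan, hl'x⟩ := exists_refl_prod_eq (x := b i) (y := p (b i)) (hb1 i)
        (by rw [hp', hb1])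
      have hfix : ∀ j ∈ s, (l'.map (refl Q)).prod (b j) = b j := by
        intro j hj
        have hij : i ≠ j := by rintro rfl; exact hi hj
        have h1 : form Q (b i) (b j) = 0 := by rw [hb, if_neg hij]
        have h2 : form Q (p (b i)) (b j) = 0 := by
          conv_lhs => rw [← hls j hj]
          rw [hp', h1]
        have h3 : ∀ v ∈ l', refl Q v (b j) = b j := by
          intro v hv
          obtain ⟨c, d, rfl⟩ := hspan v hv
          simp [refl_apply, h1, h2]
        clear hl' hspan hl'x
        induction l' with
        | nil => rfl
        | cons v l' ih =>
          rw [List.map_cons, List.prod_cons, Module.End.mul_apply,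
            ih fun w hw => h3 w (List.mem_cons_of_mem _ hw), h3 v List.mem_cons_self]
      refine ⟨l' ++ l, ?_, ?_⟩
      · intro v hv
        exact (List.mem_append.1 hv).elim (hl' v) (hl v)
      · intro j hj
        rw [List.map_append, List.prod_append, mul_assoc, ← hp, Module.End.mul_apply]
        obtain rfl | hj := Finset.mem_insert.1 hj
        · exact hl'x
        · rw [hls j hj, hfix j hj]
  obtain ⟨l, hl, h⟩ := key Finset.univ
  have h1 : (l.map (refl Q)).prod * f = 1 := b.ext fun i => h i (Finset.mem_univ i)
  refine ⟨l.reverse, hl.reverse, ?_⟩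
  calc f = ((l.reverse.map (refl Q)).prod * (l.map (refl Q)).prod) * f := by
        rw [refl_prod_reverse hl, one_mul]
    _ = (l.reverse.map (refl Q)).prod := by rw [mul_assoc, h1, mul_one]

end CayleySpin

end

noncomputable section

namespace CayleySpin

variable {V : Type*} [AddCommGroup V] [Module ℂ V] {Q : QuadraticForm ℂ V} [FiniteDimensional ℂ V]

/-! ### `Spin(V)` and products of unit vectors -/

theorem exists_spin_eq_vprod {l : List V} (h : IsUnitList Q l) (he : Even l.length) :
    ∃ g : Spin Q, spinIncl Q g = vprod Q l ∧ T Q g = (l.map (refl Q)).prod := by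
  have hr : vprod Q l.reverse * vprod Q l = 1 := by
    simpa using vprod_mul_reverse h.reverse
  let u : (CliffordAlgebra Q)ˣ := ⟨vprod Q l, vprod Q l.reverse, vprod_mul_reverse h, hr⟩
  have hc : ∀ x, vprod Q l * CliffordAlgebra.ι Q x * CliffordAlgebra.reverse (vprod Q l) =
      CliffordAlgebra.ι Q ((l.map (refl Q)).prod x) := by
    intro x
    rw [reverse_vprod, vprod_conj h, he.neg_one_pow, one_smul]
  let g : Spin Q := ⟨u, (vprod_parity Q l).1 he,
    (congrArg _ (reverse_vprod Q l)).trans (vprod_mul_reverse h), fun x => ⟨_, hc x⟩⟩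
  refine ⟨g, rfl, LinearMap.ext fun x => ?_⟩
  rw [← pr1_ι Q (T Q g x), ι_T, ← pr1_ι Q ((l.map (refl Q)).prod x), ← hc]

theorem even_length_of_det {l : List V} (h : IsUnitList Q l)
    (hd : LinearMap.det (l.map (refl Q)).prod = 1) : Even l.length := by
  rw [det_refl_prod h] at hd
  by_contra ho
  rw [(Nat.not_even_iff_odd.1 ho).neg_one_pow] at hd
  norm_num at hd

/-- `T` maps `Spin(V)` onto `SO(V)`. -/
theorem exists_T_eq (hQ : (form Q).Nondegenerate) {f : End ℂ V} (hf : IsSO Q f) :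
    ∃ g : Spin Q, T Q g = f := by
  obtain ⟨l, hl, rfl⟩ := exists_eq_refl_prod hQ hf.1
  obtain ⟨g, -, hg⟩ := exists_spin_eq_vprod hl (even_length_of_det hl hf.2)
  exact ⟨g, hg⟩

/-- `Spin(V)` consists of the products of an even number of unit vectors. -/
theorem exists_spinIncl_eq_vprod (hQ : (form Q).Nondegenerate) (hn : 0 < finrank ℂ V) (g : Spin Q) :
    ∃ l : List V, IsUnitList Q l ∧ Even l.length ∧ spinIncl Q g = vprod Q l := by
  obtain ⟨b, hb⟩ := exists_isOrthonormal Q hQ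
  obtain ⟨l, hl, hgl⟩ := exists_eq_refl_prod hQ (form_T Q g)
  have hr : vprod Q l.reverse * vprod Q l = 1 := by
    simpa using vprod_mul_reverse hl.reverse
  -- Both factors induce the same isometry of $V$, up to the sign $(-1)^{|l|}$, so the quotient
  -- commutes with all vectors up to that sign.
  have h1 : ∀ x, CliffordAlgebra.ι Q x * (vprod Q l.reverse * spinIncl Q g) =
      (-1 : ℂ) ^ l.length • (vprod Q l.reverse * spinIncl Q g * CliffordAlgebra.ι Q x) := by
    intro x
    have h2 := vprod_conj hl x
    rw [← hgl] at h2
    have h3 : vprod Q l * CliffordAlgebra.ι Q x =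
        (-1 : ℂ) ^ l.length • (CliffordAlgebra.ι Q (T Q g x) * vprod Q l) := by
      rw [← smul_mul_assoc, ← h2, mul_assoc, hr, mul_one]
    have h4 : CliffordAlgebra.ι Q x * vprod Q l.reverse =
        (-1 : ℂ) ^ l.length • (vprod Q l.reverse * CliffordAlgebra.ι Q (T Q g x)) := by
      calc _ = vprod Q l.reverse * (vprod Q l * CliffordAlgebra.ι Q x) * vprod Q l.reverse := by
            rw [← mul_assoc, hr, one_mul]
        _ = _ := by
            rw [h3, mul_smul_comm, smul_mul_assoc, mul_assoc, mul_assoc, vprod_mul_reverse hl,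
              mul_one]
    rw [← mul_assoc, h4, smul_mul_assoc, mul_assoc, mul_assoc, ι_T_mul]
  have hne : vprod Q l.reverse * spinIncl Q g ≠ 0 := by
    intro h0
    have : vprod Q l * (vprod Q l.reverse * spinIncl Q g) * spinIncl Q g⁻¹ = 1 := by
      rw [← mul_assoc, vprod_mul_reverse hl, one_mul, spinIncl_mul_inv]
    rw [h0, mul_zero, zero_mul] at this
    have h2 := congrArg (pr0 Q) this
    rw [pr0_one, map_zero] at h2
    exact zero_ne_one h2
  rcases Nat.even_or_odd l.length with he | ho
  · have hmem : vprod Q l.reverse * spinIncl Q g ∈ CliffordAlgebra.even Q :=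
      Subalgebra.mul_mem _ ((vprod_parity Q l.reverse).1 (by rwa [List.length_reverse]))
        (spinIncl_mem_even g)
    obtain ⟨g', hg', -⟩ := exists_spin_eq_vprod hl.reverse (by rwa [List.length_reverse])
    have hs := eq_algebraMap_of_commute hb hmem
      (fun x => by rw [h1 x, he.neg_one_pow, one_smul])
    generalize hc : pr0 Q (vprod Q l.reverse * spinIncl Q g) = c at hs
    have hg : spinIncl Q g = c • vprod Q l := by
      rw [← one_mul (spinIncl Q g), ← vprod_mul_reverse hl, mul_assoc, hs, ← Algebra.commutes,
        Algebra.smul_def]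
    -- The scalar $c$ lies in $\mathrm{Spin}(V)$, so $c^2=1$. The value $-1$ is then absorbed as the
    -- product $v(-v)$ of two unit vectors.
    have hcc : c * c = 1 := by
      have h2 := spinIncl_mul_inv (g' * g)
      rw [← reverse_spinIncl, spinIncl_mul, hg', hs, CliffordAlgebra.reverse.commutes,
        ← map_mul] at h2
      have h3 := congrArg (pr0 Q) h2
      rwa [Algebra.algebraMap_eq_smul_one, map_smul, pr0_one, smul_eq_mul, mul_one] at h3
    rcases mul_self_eq_one_iff.1 hcc with rfl | rfl
    · exact ⟨l, hl, he, by rw [hg, one_smul]⟩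
    · have hv : ∀ i, form Q (b i) (b i) = 1 := fun i => by rw [hb, if_pos rfl]
      refine ⟨b ⟨0, hn⟩ :: -b ⟨0, hn⟩ :: l, .cons (hv _) (.cons (by simp [hv]) hl), ?_, ?_⟩
      · simpa [Nat.even_add] using he
      · rw [hg, vprod_cons, vprod_cons, ← mul_assoc, map_neg, mul_neg, ι_mul_self, hv, map_one]
        simp
  -- For $|l|$ odd the quotient would be an odd element anticommuting with $V$, hence zero, but it
  -- is invertible.
  · exfalso
    apply hne
    refine eq_zero_of_anticommute hb (CliffordAlgebra.evenOdd_mul_le Q 1 0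
      (Submodule.mul_mem_mul ((vprod_parity Q l.reverse).2 (by rwa [List.length_reverse]))
        (spinIncl_mem_even g))) fun x => ?_
    rw [h1 x, ho.neg_one_pow, neg_one_smul]

/-! ### Irreducibility of `Spin(V)` -/

/-- The closure of `D` is an irreducible subset of `Spin(V)`. -/
def IsIrred (D : Set (Spin Q)) : Prop :=
  ∀ f₁ ∈ ASpin Q, ∀ f₂ ∈ ASpin Q, (∀ g ∈ D, f₁ g * f₂ g = 0) →
    (∀ g ∈ D, f₁ g = 0) ∨ ∀ g ∈ D, f₂ g = 0

theorem mul_left_regular (h : Spin Q) : IsRegularMap (spinIncl Q) (spinIncl Q) (fun g => h * g) :=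
  .of_linear fun l => linear_mem_regular (spinIncl Q) (l ∘ₗ LinearMap.mulLeft ℂ (spinIncl Q h))

theorem mul_right_regular (h : Spin Q) : IsRegularMap (spinIncl Q) (spinIncl Q) (fun g => g * h) :=
  .of_linear fun l => linear_mem_regular (spinIncl Q) (l ∘ₗ LinearMap.mulRight ℂ (spinIncl Q h))

-- For fixed $k\in D'$, irreducibility of $D$ allows the two factors to be evaluated at different
-- points $g_1,g_2$, giving $f_1(g_1k)f_2(g_2k)=0$. Irreducibility of $D'$, applied to the left
-- translates, then decides.
open Pointwise in
theorem IsIrred.mul {D D' : Set (Spin Q)} (hD : IsIrred D) (hD' : IsIrred D') :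
    IsIrred (D * D') := by
  intro f₁ hf₁ f₂ hf₂ h
  by_contra! hc
  obtain ⟨⟨_, ⟨g₁, hg₁, h₁, hh₁, rfl⟩, hne₁⟩, ⟨_, ⟨g₂, hg₂, h₂, hh₂, rfl⟩, hne₂⟩⟩ := hc
  have key : ∀ k ∈ D', f₁ (g₁ * k) * f₂ (g₂ * k) = 0 := by
    intro k hk
    rcases hD _ (mul_right_regular k f₁ hf₁) _ (mul_right_regular k f₂ hf₂)
      (fun g hg => h _ (Set.mul_mem_mul hg hk)) with h' | h'
    · exact mul_eq_zero_of_left (h' g₁ hg₁) _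
    · exact mul_eq_zero_of_right _ (h' g₂ hg₂)
  rcases hD' _ (mul_left_regular g₁ f₁ hf₁) _ (mul_left_regular g₂ f₂ hf₂) key with h' | h'
  · exact hne₁ (h' h₁ hh₁)
  · exact hne₂ (h' h₂ hh₂)

/-- The products of the unit vector `v` with its images under reflections. -/
def reflOrbit (v : V) : Set (Spin Q) :=
  {g | ∃ d : V, form Q d d ≠ 0 ∧ form Q d d • spinIncl Q g =
    form Q d d • 1 - (2 * form Q d v) • (CliffordAlgebra.ι Q v * CliffordAlgebra.ι Q d)}

/-- The element is $vw$ with $w$ the reflection of $v$ in $d$; clearing the denominator $(d,d)$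
gives the stated equation. -/
theorem exists_mem_reflOrbit {v : V} (hv : form Q v v = 1) {d : V} (hd : form Q d d ≠ 0) :
    ∃ g : Spin Q, form Q d d • spinIncl Q g =
      form Q d d • 1 - (2 * form Q d v) • (CliffordAlgebra.ι Q v * CliffordAlgebra.ι Q d) := by
  set w := v - (2 * form Q d v / form Q d d) • d with hw
  have hw1 : form Q w w = 1 := by
    simp only [hw, map_sub, map_smul, LinearMap.sub_apply, LinearMap.smul_apply, smul_eq_mul, hv,
      form_comm Q v d]
    field_simp
    ring
  obtain ⟨g, hg, -⟩ := exists_spin_eq_vprod (Q := Q) (l := [v, w])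
    (.cons hv (.cons hw1 (by simp [IsUnitList]))) (by simp)
  refine ⟨g, ?_⟩
  rw [hg, vprod, List.map_cons, List.map_cons, List.map_nil, List.prod_cons, List.prod_singleton,
    hw, map_sub, map_smul, mul_sub, ι_mul_self, hv, map_one, smul_sub, mul_smul_comm, smul_smul,
    mul_div_cancel₀ _ hd]

/-- The coordinates of $g$ are polynomials in $d$ divided by $(d,d)$, so a power of $(d,d)$ clears
the denominators of any regular function. -/
theorem exists_polynomial_reflOrbit (v : V) {f : Spin Q → ℂ} (hf : f ∈ ASpin Q) :
    ∃ N : ℕ, ∃ F ∈ regular (id : V → V), ∀ (g : Spin Q) (d : V), form Q d d ≠ 0 →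
      form Q d d • spinIncl Q g = form Q d d • 1 -
        (2 * form Q d v) • (CliffordAlgebra.ι Q v * CliffordAlgebra.ι Q d) →
      f g * form Q d d ^ N = F d := by
  have hq : (fun d => form Q d d) ∈ regular (id : V → V) := bilin_mem_regular rfl (form Q)
  induction hf using Algebra.adjoin_induction with
  | mem f hf =>
    obtain ⟨l, rfl⟩ := hf
    refine ⟨1, (fun d => form Q d d * l 1 - form Q (id d) v * (2 * l (CliffordAlgebra.ι Q v *
      CliffordAlgebra.ι Q (id d)))), ?_, fun g d hd h => ?_⟩
    · refine Subalgebra.sub_mem _ (Subalgebra.mul_mem _ hq (Subalgebra.algebraMap_mem _ (l 1)))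
        (Subalgebra.mul_mem _ (linear_mem_regular _ ((form Q).flip v)) ?_)
      exact linear_mem_regular (id : V → V) ((2 : ℂ) • (l ∘ₗ LinearMap.mulLeft ℂ
        (CliffordAlgebra.ι Q v) ∘ₗ CliffordAlgebra.ι Q))
    · have := congrArg l h
      simp only [map_sub, map_smul, smul_eq_mul] at this
      simp only [pow_one, id]
      linear_combination this
  | algebraMap r => exact ⟨0, _, Subalgebra.algebraMap_mem _ r, fun g d _ _ => by simp⟩
  | add f₁ f₂ _ _ h₁ h₂ =>
    obtain ⟨N₁, F₁, hF₁, h₁⟩ := h₁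
    obtain ⟨N₂, F₂, hF₂, h₂⟩ := h₂
    refine ⟨N₁ + N₂, F₁ * (fun d => form Q d d) ^ N₂ + F₂ * (fun d => form Q d d) ^ N₁,
      Subalgebra.add_mem _ (Subalgebra.mul_mem _ hF₁ (Subalgebra.pow_mem _ hq _))
        (Subalgebra.mul_mem _ hF₂ (Subalgebra.pow_mem _ hq _)), fun g d hd h => ?_⟩
    simp only [Pi.add_apply, Pi.mul_apply, Pi.pow_apply, ← h₁ g d hd h, ← h₂ g d hd h]
    ring
  | mul f₁ f₂ _ _ h₁ h₂ =>
    obtain ⟨N₁, F₁, hF₁, h₁⟩ := h₁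
    obtain ⟨N₂, F₂, hF₂, h₂⟩ := h₂
    refine ⟨N₁ + N₂, F₁ * F₂, Subalgebra.mul_mem _ hF₁ hF₂, fun g d hd h => ?_⟩
    simp only [Pi.mul_apply, ← h₁ g d hd h, ← h₂ g d hd h]
    ring

/-- The set is parametrized by the nonisotropic vectors $d$. A vanishing product becomes a vanishing
product of polynomials on $V$ after multiplication by $(d,d)$, and polynomials form a domain. -/
theorem isIrred_reflOrbit {v : V} (hv : form Q v v = 1) : IsIrred (reflOrbit v : Set (Spin Q)) := by
  intro f₁ hf₁ f₂ hf₂ h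
  obtain ⟨N₁, F₁, hF₁, h₁⟩ := exists_polynomial_reflOrbit v hf₁
  obtain ⟨N₂, F₂, hF₂, h₂⟩ := exists_polynomial_reflOrbit v hf₂
  have := isDomain_regular (E := V) (j := id) rfl
  have hq : (fun d => form Q d d) ∈ regular (id : V → V) := bilin_mem_regular rfl (form Q)
  let q : regular (id : V → V) := ⟨_, hq⟩
  have hq0 : q ≠ 0 := by
    intro h0
    have := congrFun (congrArg Subtype.val h0) v
    exact one_ne_zero (hv.symm.trans this)
  have h0 : (⟨F₁, hF₁⟩ * ⟨F₂, hF₂⟩ * q : regular (id : V → V)) = 0 := by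
    apply Subtype.ext
    funext d
    change F₁ d * F₂ d * form Q d d = 0
    by_cases hd : form Q d d = 0
    · rw [hd, mul_zero]
    obtain ⟨g, hg⟩ := exists_mem_reflOrbit hv hd
    rw [← h₁ g d hd hg, ← h₂ g d hd hg]
    linear_combination form Q d d ^ N₁ * form Q d d ^ N₂ * form Q d d * h g ⟨d, hd, hg⟩
  rcases mul_eq_zero.1 ((mul_eq_zero.1 h0).resolve_right hq0) with h' | h'
  · left
    rintro g ⟨d, hd, hg⟩
    have e := h₁ g d hd hg
    rw [show F₁ d = 0 from congrFun (congrArg Subtype.val h') d] at e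
    exact (mul_eq_zero.1 e).resolve_right (pow_ne_zero _ hd)
  · right
    rintro g ⟨d, hd, hg⟩
    have e := h₂ g d hd hg
    rw [show F₂ d = 0 from congrFun (congrArg Subtype.val h') d] at e
    exact (mul_eq_zero.1 e).resolve_right (pow_ne_zero _ hd)

/-- `g` lies in the irreducible component of `1`. -/
def IsConnectedToOne (g : Spin Q) : Prop := ∃ D : Set (Spin Q), IsIrred D ∧ 1 ∈ D ∧ g ∈ D

open Pointwise in
theorem IsConnectedToOne.mul {g h : Spin Q} (hg : IsConnectedToOne g) (hh : IsConnectedToOne h) :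
    IsConnectedToOne (g * h) := by
  obtain ⟨D, hD, h1, hgD⟩ := hg
  obtain ⟨D', hD', h1', hhD⟩ := hh
  exact ⟨D * D', hD.mul hD', ⟨1, h1, 1, h1', mul_one 1⟩, ⟨g, hgD, h, hhD, rfl⟩⟩

/-- Otherwise every projection $b_i-(b_i,v)v$ is isotropic, so $(b_i,v)^2=1$ for all $i$ and
$1=(v,v)=n$. Such a $d$ is the parameter at which `reflOrbit v` passes through $1$. -/
theorem exists_orthogonal (hQ : (form Q).Nondegenerate) (hn : 2 ≤ finrank ℂ V) {v : V}
    (hv : form Q v v = 1) : ∃ d : V, form Q d v = 0 ∧ form Q d d ≠ 0 := by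
  obtain ⟨b, hb⟩ := exists_isOrthonormal Q hQ
  by_contra! hc
  have hb1 : ∀ i, form Q (b i) (b i) = 1 := fun i => by rw [hb, if_pos rfl]
  have h1 : ∀ i, form Q (b i) v * form Q (b i) v = 1 := by
    intro i
    have := hc (b i - form Q (b i) v • v) (by simp [hv])
    simp only [map_sub, map_smul, LinearMap.sub_apply, LinearMap.smul_apply, smul_eq_mul, hv,
      form_comm Q v (b i), hb1] at this
    linear_combination -this
  have h2 : ∑ i, form Q (b i) v * form Q (b i) v = 1 := by
    conv_rhs => rw [← hv]; enter [1]; rw [← sum_form_smul hb v]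
    simp
  simp only [h1, Finset.sum_const, Finset.card_univ, Fintype.card_fin, nsmul_eq_mul, mul_one] at h2
  have : finrank ℂ V = 1 := by exact_mod_cast h2
  omega

theorem isConnectedToOne_mem_reflOrbit (hQ : (form Q).Nondegenerate) (hn : 2 ≤ finrank ℂ V) {v : V}
    (hv : form Q v v = 1) {g : Spin Q} (hg : g ∈ reflOrbit v) : IsConnectedToOne g := by
  obtain ⟨d, hd, hd'⟩ := exists_orthogonal hQ hn hv
  exact ⟨reflOrbit v, isIrred_reflOrbit hv, ⟨d, hd', by rw [hd, spinIncl_one]; simp⟩, hg⟩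

/-- If $(v,w)\ne1$, the parameter $d=v-w$ gives $vw$ in `reflOrbit v`. If $(v,w)=1$, one writes
$vw=(-1)\cdot v(-w)$; the parameter $d=v$ gives $-1$, and $(v,-w)=-1\ne1$. -/
theorem isConnectedToOne_of_two (hQ : (form Q).Nondegenerate) (hn : 2 ≤ finrank ℂ V) {v w : V}
    (hv : form Q v v = 1) (hw : form Q w w = 1) {g : Spin Q}
    (hg : spinIncl Q g = CliffordAlgebra.ι Q v * CliffordAlgebra.ι Q w) : IsConnectedToOne g := by
  have key : ∀ (w : V) (g : Spin Q), form Q w w = 1 → form Q v w ≠ 1 →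
      spinIncl Q g = CliffordAlgebra.ι Q v * CliffordAlgebra.ι Q w → IsConnectedToOne g := by
    intro w g hw hvw hg
    refine isConnectedToOne_mem_reflOrbit hQ hn hv ⟨v - w, ?_, ?_⟩
    · simp only [map_sub, LinearMap.sub_apply, hv, hw, form_comm Q w v]
      intro h
      exact hvw (by linear_combination -h / 2)
    · have e1 : form Q (v - w) (v - w) = 2 * form Q (v - w) v := by
        simp only [map_sub, LinearMap.sub_apply, hv, hw, form_comm Q w v]
        ring
      rw [hg, e1, ← smul_sub, map_sub (CliffordAlgebra.ι Q), mul_sub, ι_mul_self, hv, map_one,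
        sub_sub_cancel]
  by_cases h : form Q v w = 1
  · obtain ⟨g', hg', -⟩ := exists_spin_eq_vprod (Q := Q) (l := [v, -v])
      (.cons hv (.cons (by simp [hv]) (by simp [IsUnitList]))) (by simp)
    have hg1 : spinIncl Q g' = -1 := by
      rw [hg', vprod, List.map_cons, List.map_cons, List.map_nil, List.prod_cons,
        List.prod_singleton, map_neg, mul_neg, ι_mul_self, hv, map_one]
    have h1 : IsConnectedToOne g' := by
      refine isConnectedToOne_mem_reflOrbit hQ hn hv ⟨v, by simp [hv], ?_⟩
      rw [hg1, hv, ι_mul_self, hv, map_one]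
      module
    have h2 : IsConnectedToOne (g' * g) := by
      refine key (-w) _ (by simp [hw]) (by rw [map_neg, h]; norm_num) ?_
      rw [spinIncl_mul, hg1, hg, map_neg, mul_neg, neg_mul, one_mul]
    have h3 := h1.mul h2
    have h4 : g' * (g' * g) = g := by
      apply spinIncl_injective
      rw [spinIncl_mul, spinIncl_mul, hg1]
      simp
    rwa [h4] at h3
  · exact key w g hw h hg

theorem isConnectedToOne_of_vprod (hQ : (form Q).Nondegenerate) (hn : 2 ≤ finrank ℂ V) :
    ∀ (l : List V) (g : Spin Q), IsUnitList Q l → Even l.length → spinIncl Q g = vprod Q l →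
      IsConnectedToOne g
  | [], g, _, _, hg => by
    obtain ⟨b, hb⟩ := exists_isOrthonormal Q hQ
    have hv : form Q (b ⟨0, by omega⟩) (b ⟨0, by omega⟩) = 1 := by rw [hb, if_pos rfl]
    have h1 : g = 1 := spinIncl_injective hg
    exact isConnectedToOne_of_two hQ hn hv hv (by rw [h1, spinIncl_one, ι_mul_self, hv, map_one])
  | [v], g, _, he, _ => by simp at he
  | v :: w :: l, g, hl, he, hg => by
    obtain ⟨hv, hl'⟩ := hl.of_cons
    obtain ⟨hw, hl''⟩ := hl'.of_cons
    obtain ⟨g₁, hg₁, -⟩ := exists_spin_eq_vprod (Q := Q) (l := [v, w])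
      (.cons hv (.cons hw (by simp [IsUnitList]))) (by simp)
    have he' : Even l.length := by simpa [Nat.even_add] using he
    obtain ⟨g₂, hg₂, -⟩ := exists_spin_eq_vprod hl'' he'
    have : g = g₁ * g₂ := by
      apply spinIncl_injective
      rw [hg, spinIncl_mul, hg₁, hg₂, ← vprod_append]
      rfl
    rw [this]
    refine (isConnectedToOne_of_two hQ hn hv hw ?_).mul
      (isConnectedToOne_of_vprod hQ hn l g₂ hl'' he' hg₂)
    rw [hg₁, vprod, List.map_cons, List.map_cons, List.map_nil, List.prod_cons,
      List.prod_singleton]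

/-- If $f_1(g_1)\ne0$ and $f_2(g_2)\ne0$, translating by $g_1$ moves these points to $1$ and
$g_1^{-1}g_2$. They lie in a common irreducible set, so $f_1f_2\ne0$. -/
theorem isDomain_ASpin (hQ : (form Q).Nondegenerate) (hn : 2 ≤ finrank ℂ V) :
    IsDomain (ASpin Q) := by
  have hc : ∀ g : Spin Q, IsConnectedToOne g := by
    intro g
    obtain ⟨l, hl, he, hg⟩ := exists_spinIncl_eq_vprod hQ (by omega) g
    exact isConnectedToOne_of_vprod hQ hn l g hl he hg
  have : NoZeroDivisors (ASpin Q) := by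
    refine ⟨fun {f₁ f₂} h => ?_⟩
    by_contra! hne
    have hex : ∀ f : ASpin Q, f ≠ 0 → ∃ g, (f : Spin Q → ℂ) g ≠ 0 := by
      intro f hf
      by_contra! h0
      exact hf (Subtype.ext (funext h0))
    obtain ⟨g₁, h₁⟩ := hex _ hne.1
    obtain ⟨g₂, h₂⟩ := hex _ hne.2
    obtain ⟨D, hD, h1D, hgD⟩ := hc (g₁⁻¹ * g₂)
    rcases hD _ (mul_left_regular g₁ f₁ f₁.2) _ (mul_left_regular g₁ f₂ f₂.2)
      (fun g _ => congrFun (congrArg Subtype.val h) (g₁ * g)) with h' | h'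
    · exact h₁ (by simpa using h' 1 h1D)
    · exact h₂ (by simpa using h' _ hgD)
  have : Nontrivial (ASpin Q) :=
    ⟨0, 1, fun h => zero_ne_one (congrFun (congrArg Subtype.val h) (1 : Spin Q))⟩
  exact NoZeroDivisors.to_isDomain _

end CayleySpin

end

noncomputable section

namespace CayleySpin

/-! ### An irreducible specialization -/

section Specialization

open Polynomial

/-- Coprimality excludes constant factors. A splitting $(aX+b)(cX+d)$ has $ad+bc=0$, so
$AB=abcd=-(ad)^2$ could not have a simple root. -/
theorem irreducible_quadratic {A B : ℂ[X]} (h : IsCoprime A B) {x : ℂ} (hx : (A * B).eval x = 0)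
    (hx' : (derivative (A * B)).eval x ≠ 0) : Irreducible (C A * X ^ 2 + C B : ℂ[X][X]) := by
  have hA : A ≠ 0 := by rintro rfl; simp at hx'
  have h0 : (C A * X ^ 2 + C B : ℂ[X][X]).coeff 0 = B := by simp
  have h1 : (C A * X ^ 2 + C B : ℂ[X][X]).coeff 1 = 0 := by simp [coeff_X_pow]
  have h2 : (C A * X ^ 2 + C B : ℂ[X][X]).coeff 2 = A := by simp
  have hdeg : (C A * X ^ 2 + C B : ℂ[X][X]).natDegree = 2 := by compute_degree!
  have hunit : ∀ p q : ℂ[X][X], C A * X ^ 2 + C B = p * q → p.natDegree = 0 → IsUnit p := by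
    intro p q hpq hp
    obtain ⟨c, rfl⟩ := natDegree_eq_zero.1 hp
    rw [isUnit_C]
    refine h.isUnit_of_dvd' (Dvd.intro (q.coeff 2) ?_) (Dvd.intro (q.coeff 0) ?_)
    · rw [← h2, hpq, coeff_C_mul]
    · rw [← h0, hpq, coeff_C_mul]
  refine ⟨fun hu => ?_, fun p q hpq => ?_⟩
  · rw [natDegree_eq_zero_of_isUnit hu] at hdeg
    omega
  · have hne : C A * X ^ 2 + C B ≠ (0 : ℂ[X][X]) := by
      intro h'
      rw [h', natDegree_zero] at hdeg
      omega
    have hsum : p.natDegree + q.natDegree = 2 := by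
      rw [← natDegree_mul (left_ne_zero_of_mul (hpq ▸ hne)) (right_ne_zero_of_mul (hpq ▸ hne)),
        ← hpq, hdeg]
    by_cases hp : p.natDegree = 0
    · exact Or.inl (hunit p q hpq hp)
    by_cases hq : q.natDegree = 0
    · exact Or.inr (hunit q p (hpq.trans (mul_comm p q)) hq)
    exfalso
    obtain ⟨a, -, b, rfl⟩ := natDegree_eq_one.1 (by omega : p.natDegree = 1)
    obtain ⟨c, -, d, rfl⟩ := natDegree_eq_one.1 (by omega : q.natDegree = 1)
    have e : (C a * X + C b) * (C c * X + C d) =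
        (C (a * c) * X ^ 2 + C (a * d + b * c) * X + C (b * d) : ℂ[X][X]) := by
      simp only [C_mul, C_add]
      ring
    rw [e] at hpq
    have e0 : B = b * d := by rw [← h0, hpq]; simp
    have e1 : 0 = a * d + b * c := by
      rw [← h1, hpq]
      simp only [coeff_add, coeff_C_mul, coeff_X_pow, coeff_X, coeff_C]
      simp
    have e2 : A = a * c := by
      rw [← h2, hpq]
      simp only [coeff_add, coeff_C_mul, coeff_X_pow, coeff_X, coeff_C]
      simp
    have hAB : A * B = -(a * d) ^ 2 := by
      rw [e0, e2]
      linear_combination -(a * d) * e1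
    rw [hAB] at hx hx'
    have hz : (a * d).eval x = 0 := by simpa using hx
    apply hx'
    rw [derivative_neg, derivative_pow, eval_neg, eval_mul, eval_mul, eval_pow, hz]
    simp

/-- The coefficients of the blocks. -/
def blockCoeff {k : ℕ} (j : Fin k) : ℂ := if (j : ℕ) = 0 then 1 else 2

/-- With the variables exchanged this is quadratic, $Rt^2+(X^2R-X^{2k})$, with coprime coefficients
because $R$ is prime to $X$. For $k>0$ exactly one block has coefficient $1$, so $i$ is a simple
root of $R$; for $k=0$ the polynomial $X^2-1$ has the simple root $1$. -/
theorem irreducible_specialization (k : ℕ) :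
    Irreducible ((X ^ 2 + C (X ^ 2)) * (∏ j : Fin k, (X ^ 2 + C (C (blockCoeff j ^ 2)))) -
      X ^ (2 * k) : ℂ[X][X]) := by
  set R : ℂ[X] := ∏ j : Fin k, (X ^ 2 + C (blockCoeff j ^ 2)) with hR
  rw [← MulEquiv.irreducible_iff (Bivariate.swap (R := ℂ))]
  have e : Bivariate.swap ((X ^ 2 + C (X ^ 2)) * (∏ j : Fin k, (X ^ 2 + C (C (blockCoeff j ^ 2)))) -
      X ^ (2 * k) : ℂ[X][X]) = C R * X ^ 2 + C (X ^ 2 * R - X ^ (2 * k)) := by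
    simp only [map_sub, map_mul, map_add, map_prod, map_pow, Bivariate.swap_X, Bivariate.swap_Y,
      Bivariate.swap_C_C, hR]
    ring
  rw [e]
  have hb0 : ∀ j : Fin k, blockCoeff j ^ 2 ≠ 0 := by
    intro j
    unfold blockCoeff
    split_ifs <;> norm_num
  have hcop : IsCoprime R (X ^ 2 * R - X ^ (2 * k)) := by
    have h1 : IsCoprime R (X ^ (2 * k)) := by
      refine IsCoprime.pow_right (IsCoprime.prod_left fun j _ => ?_)
      refine ⟨C (blockCoeff j ^ 2)⁻¹, -C (blockCoeff j ^ 2)⁻¹ * X, ?_⟩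
      rw [mul_add, ← C_mul, inv_mul_cancel₀ (hb0 j), C_1]
      ring
    rw [sub_eq_neg_add, mul_comm (X ^ 2)]
    exact h1.neg_right.add_mul_left_right _
  cases k with
  | zero =>
    refine irreducible_quadratic hcop (x := 1) ?_ ?_
    · simp [hR]
    · simp [hR]
  | succ k =>
    have hR' : R = (X ^ 2 + 1) * (X ^ 2 + C 4) ^ k := by
      rw [hR, Fin.prod_univ_succ]
      norm_num [blockCoeff]
    have hRI : R.eval Complex.I = 0 := by rw [hR']; simp
    refine irreducible_quadratic hcop (x := Complex.I) ?_ ?_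
    · rw [eval_mul, hRI, zero_mul]
    · rw [derivative_mul, eval_add, eval_mul, eval_mul, hRI, zero_mul, add_zero]
      refine mul_ne_zero ?_ ?_
      · rw [hR', derivative_mul, eval_add, eval_mul, eval_mul]
        simp only [derivative_add, derivative_X_pow, derivative_one, eval_add, eval_pow, eval_X,
          eval_one, eval_mul, eval_C, Complex.I_sq, neg_add_cancel, zero_mul, add_zero]
        norm_num
      · rw [eval_sub, eval_mul, hRI, mul_zero, zero_sub, eval_pow, eval_X]
        exact neg_ne_zero.2 (pow_ne_zero _ Complex.I_ne_zero)

/-! ### Skew-symmetric block matrices and their characteristic polynomials. -/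

variable {R : Type*} [CommRing R] {o : Type*} [Fintype o] [DecidableEq o]

/-- The skew-symmetric matrix with blocks `[[0, c i], [-c i, 0]]`, extended by zeros. -/
def skewBlocks (c : o → R) (r : ℕ) : Matrix ((Fin 2 × o) ⊕ Fin r) ((Fin 2 × o) ⊕ Fin r) R :=
  Matrix.fromBlocks (Matrix.blockDiagonal fun i => !![0, c i; -c i, 0]) 0 0 0

theorem transpose_skewBlocks (c : o → R) (r : ℕ) :
    (skewBlocks c r).transpose = -skewBlocks c r := by
  rw [skewBlocks, Matrix.fromBlocks_transpose, Matrix.fromBlocks_neg, Matrix.blockDiagonal_transpose,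
    ← Matrix.blockDiagonal_neg]
  simp only [Matrix.transpose_zero, neg_zero]
  congr 2
  funext i
  ext a b
  fin_cases a <;> fin_cases b <;> simp

theorem skewBlocks_map {R' : Type*} [CommRing R'] (f : R →+* R') (c : o → R) (r : ℕ) :
    (skewBlocks c r).map f = skewBlocks (fun i => f (c i)) r := by
  rw [skewBlocks, skewBlocks, Matrix.fromBlocks_map, Matrix.blockDiagonal_map _ _ (map_zero f)]
  simp only [Matrix.map_zero _ (map_zero f)]
  congr 2
  funext i
  ext a b
  fin_cases a <;> fin_cases b <;> simp

theorem skewBlocks_add_smul (c d : o → R) (t : R) (r : ℕ) :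
    skewBlocks (fun i => c i + t * d i) r = skewBlocks c r + t • skewBlocks d r := by
  rw [skewBlocks, skewBlocks, skewBlocks, Matrix.fromBlocks_smul, Matrix.fromBlocks_add,
    ← Matrix.blockDiagonal_smul, ← Matrix.blockDiagonal_add]
  simp only [smul_zero, add_zero]
  congr 2
  funext i
  ext a b
  fin_cases a <;> fin_cases b <;> simp [add_comm]

theorem charpoly_skewBlocks (c : o → R) (r : ℕ) :
    (skewBlocks c r).charpoly = (∏ i, (X ^ 2 + C (c i ^ 2))) * X ^ r := by
  rw [skewBlocks, Matrix.charpoly_fromBlocks_zero₁₂, Matrix.charpoly_zero, Fintype.card_fin]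
  congr 1
  have : (Matrix.blockDiagonal fun i => !![0, c i; -c i, 0]).charmatrix =
      Matrix.blockDiagonal fun i => !![X, -C (c i); C (c i), X] := by
    rw [Matrix.charmatrix, Matrix.scalar_apply, ← Matrix.blockDiagonal_diagonal (fun _ _ => X)]
    change _ - (Matrix.blockDiagonal _).map C = _
    rw [Matrix.blockDiagonal_map _ _ (map_zero C), ← Matrix.blockDiagonal_sub]
    congr 1
    funext i
    ext a b : 2
    fin_cases a <;> fin_cases b <;> simp
  rw [Matrix.charpoly, this, Matrix.det_blockDiagonal]
  refine Finset.prod_congr rfl fun i _ => ?_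
  rw [Matrix.det_fin_two]
  simp
  ring

end Specialization

end CayleySpin

end

noncomputable section

namespace CayleySpin

open Polynomial

variable {V : Type*} [AddCommGroup V] [Module ℂ V] {Q : QuadraticForm ℂ V} [FiniteDimensional ℂ V]

/-! ### The polynomial relation between `pr₀` and `Φ` -/

/-- Evaluation of regular functions at a point. -/
def evalAt {X E : Type*} [AddCommGroup E] [Module ℂ E] (j : X → E) (x : X) : regular j →ₐ[ℂ] ℂ :=
  (Pi.evalAlgHom ℂ (fun _ : X => ℂ) x).comp (regular j).val

theorem evalAt_apply {X E : Type*} [AddCommGroup E] [Module ℂ E] (j : X → E) (x : X)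
    (f : regular j) : evalAt j x f = (f : X → ℂ) x := rfl

section Matrix

variable {ι : Type*} [Fintype ι] [DecidableEq ι]

/-- The matrix of `τ(w) / 2`, with entries in the affine ring of `∧²V`. -/
def tauMatrix (Q : QuadraticForm ℂ V) (b : Basis ι ℂ V) : Matrix ι ι (ALie V) := fun i j =>
  ⟨_, linear_mem_regular (lieIncl V)
    (form Q (b i) ∘ₗ LinearMap.applyₗ (b j) ∘ₗ ((1 / 2 : ℂ) • tau Q))⟩

variable {b : Basis ι ℂ V} (hb : IsOrthonormal Q b)
include hb

theorem tauMatrix_map (w : Lie V) : (tauMatrix Q b).map (evalAt (lieIncl V) w) =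
    LinearMap.toMatrix b b ((1 / 2 : ℂ) • tau Q w) := by
  ext i j
  rw [Matrix.map_apply, toMatrix_apply_form hb]
  rfl

theorem charpoly_tauMatrix_map (w : Lie V) :
    (tauMatrix Q b).charpoly.map (evalAt (lieIncl V) w).toRingHom =
      ((1 / 2 : ℂ) • tau Q w).charpoly := by
  rw [← Matrix.charpoly_map, ← LinearMap.charpoly_toMatrix _ b]
  exact congrArg Matrix.charpoly (tauMatrix_map hb w)

end Matrix

/-- `det (X - τ(w) / 2) - X ^ (n - 2)`, a polynomial over the affine ring of `∧²V`. -/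
def cayleyPoly {ι : Type*} [Fintype ι] [DecidableEq ι] (Q : QuadraticForm ℂ V) (b : Basis ι ℂ V) :
    (ALie V)[X] := (tauMatrix Q b).charpoly - X ^ (finrank ℂ V - 2)

section CayleyPoly

variable {ι : Type*} [Fintype ι] [DecidableEq ι] {b : Basis ι ℂ V}

theorem cayleyPoly_monic (b : Basis ι ℂ V) (hn : 2 ≤ finrank ℂ V) : (cayleyPoly Q b).Monic ∧
    (cayleyPoly Q b).natDegree = finrank ℂ V := by
  have := isDomain_regular (E := Lie V) (j := lieIncl V) rfl
  have hd : (tauMatrix Q b).charpoly.natDegree = finrank ℂ V := by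
    rw [Matrix.charpoly_natDegree_eq_dim, finrank_eq_card_basis b]
  have hlt : (X ^ (finrank ℂ V - 2) : (ALie V)[X]).natDegree <
      (tauMatrix Q b).charpoly.natDegree := by
    rw [natDegree_X_pow, hd]
    omega
  have hm := Matrix.charpoly_monic (tauMatrix Q b)
  exact ⟨hm.sub_of_left (degree_lt_degree hlt),
    (natDegree_sub_eq_left_of_natDegree_lt hlt).trans hd⟩

theorem eval_cayleyPoly (hb : IsOrthonormal Q b) (w : Lie V) (a : ℂ) :
    ((cayleyPoly Q b).map (evalAt (lieIncl V) w).toRingHom).eval a =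
      LinearMap.det (a • (1 : End ℂ V) - (1 / 2 : ℂ) • tau Q w) - a ^ (finrank ℂ V - 2) := by
  rw [cayleyPoly, Polynomial.map_sub, charpoly_tauMatrix_map hb, eval_sub, Polynomial.map_pow, map_X,
    eval_pow, eval_X, LinearMap.eval_charpoly]
  rfl

theorem det_one_add_Gamma {t : End ℂ V} (h : IsUnit (1 + t)) :
    LinearMap.det (1 + Gamma t) * LinearMap.det (1 + t) = 2 ^ finrank ℂ V := by
  rw [(T_one_add_Gamma h).2.2.2, LinearMap.det_smul, mul_assoc, ← map_mul,
    Ring.inverse_mul_cancel _ h, map_one, mul_one]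

theorem Gamma_Gamma {t : End ℂ V} (h : IsUnit (1 + t)) : Gamma (Gamma t) = t := by
  obtain ⟨h1, h2, -, -⟩ := T_one_add_Gamma h
  rw [Gamma, ← h1, mul_assoc, Ring.mul_inverse_cancel _ h2, mul_one]

theorem isSO_Gamma {s : End ℂ V} (hQ : (form Q).Nondegenerate) (hs : IsSkew Q s)
    (h : IsUnit (1 + s)) : IsSO Q (Gamma s) := by
  obtain ⟨b, hb⟩ := exists_isOrthonormal Q hQ
  have hi : (1 + s) * Ring.inverse (1 + s) = 1 := Ring.mul_inverse_cancel _ h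
  refine ⟨fun x y => ?_, ?_⟩
  · have key : ∀ x y, form Q ((1 - s) x) ((1 - s) y) = form Q ((1 + s) x) ((1 + s) y) := by
      intro x y
      simp only [LinearMap.sub_apply, LinearMap.add_apply, Module.End.one_apply, map_sub, map_add,
        hs x y]
      ring
    rw [Gamma, Module.End.mul_apply, Module.End.mul_apply, key, ← Module.End.mul_apply,
      ← Module.End.mul_apply, hi, Module.End.one_apply, Module.End.one_apply]
  · have h4 := det_add_eq_det_sub hb hs 1
    rw [one_smul] at h4
    rw [Gamma, map_mul, h4, ← map_mul, hi, map_one]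

theorem exists_neg_one (hQ : (form Q).Nondegenerate) (hn : 0 < finrank ℂ V) :
    ∃ z : Spin Q, spinIncl Q z = -1 ∧ T Q z = 1 := by
  obtain ⟨b, hb⟩ := exists_isOrthonormal Q hQ
  have hv : form Q (b ⟨0, hn⟩) (b ⟨0, hn⟩) = 1 := by rw [hb, if_pos rfl]
  obtain ⟨g, hg, -⟩ := exists_spin_eq_vprod (Q := Q) (l := [b ⟨0, hn⟩, -b ⟨0, hn⟩])
    (.cons hv (.cons (by simp [hv]) (by simp [IsUnitList]))) (by simp)
  have hg1 : spinIncl Q g = -1 := by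
    rw [hg, vprod, List.map_cons, List.map_cons, List.map_nil, List.prod_cons,
      List.prod_singleton, map_neg, mul_neg, ι_mul_self, hv, map_one]
  refine ⟨g, hg1, LinearMap.ext fun x => ?_⟩
  have h1 := ι_T_mul g x
  rw [hg1, mul_neg, mul_one, neg_mul, one_mul, neg_inj] at h1
  rw [← pr1_ι Q (T Q g x), h1, pr1_ι]
  rfl

variable {S : Type*} [AddCommGroup S] [Module ℂ S] [FiniteDimensional ℂ S]
  {σ : CZ Q →ₐ[ℂ] End ℂ S} (hQ : (form Q).Nondegenerate) (hn : 2 ≤ finrank ℂ V)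
  (hσ : IsSpinModule Q σ)
include hQ hn hσ

/-- With $a=\mathrm{pr}_0(g)$ the Cayley formula gives $a-\tau(\Phi(g))/2=a(1+\Gamma)$. Moreover
$\det(1+\Gamma)=2^n/\det(1+T(g))=a^{-2}$. -/
theorem eval_cayleyPoly_Phi (hb : IsOrthonormal Q b) {g : Spin Q} (hg : g ∈ SpinStar Q) :
    ((cayleyPoly Q b).map (evalAt (lieIncl V) (Phi σ g)).toRingHom).eval (pr0 Q (spinIncl Q g)) =
      0 := by
  have hn0 : 0 < finrank ℂ V := by omega
  have hu := isUnit_of_det_ne_zero hg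
  have ha := (spinStar_iff hQ hn0 g).1 hg
  have h1 := det_one_add_Gamma hu
  rw [← two_pow_mul_pr0_sq hQ hn0] at h1
  have h2 : LinearMap.det (1 + Gamma (T Q g)) * pr0 Q (spinIncl Q g) ^ 2 = 1 := by
    apply mul_left_cancel₀ (pow_ne_zero (finrank ℂ V) (two_ne_zero (α := ℂ)))
    linear_combination h1
  rw [eval_cayleyPoly hb, tau_Phi hQ hn0 hσ hg]
  generalize pr0 Q (spinIncl Q g) = a at *
  have h3 : a • (1 : End ℂ V) - (1 / 2 : ℂ) • ((-2 * a) • Gamma (T Q g)) =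
      a • (1 + Gamma (T Q g)) := by module
  have h4 : a ^ finrank ℂ V = a ^ (finrank ℂ V - 2) * a ^ 2 := by
    rw [← pow_add, Nat.sub_add_cancel hn]
  rw [h3, LinearMap.det_smul, h4]
  linear_combination a ^ (finrank ℂ V - 2) * h2

/-- The equation says that $s=-\tau(w)/(2a)$ satisfies $\det(1+s)=a^{-2}$, so $\Gamma(s)$ exists in
$SO(V)$ and lifts to $\mathrm{Spin}(V)$. The lift has $\mathrm{pr}_0=\pm a$, and
$-1\in\mathrm{Spin}(V)$ corrects the sign. -/
theorem exists_Phi_eq (hb : IsOrthonormal Q b) {w : Lie V} {a : ℂ} (ha : a ≠ 0)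
    (h : ((cayleyPoly Q b).map (evalAt (lieIncl V) w).toRingHom).eval a = 0) :
    ∃ g : Spin Q, pr0 Q (spinIncl Q g) = a ∧ Phi σ g = w := by
  have hn0 : 0 < finrank ℂ V := by omega
  rw [eval_cayleyPoly hb, sub_eq_zero] at h
  set s := (-(2 * a)⁻¹) • tau Q w with hs
  have hskew : IsSkew Q s := (tau_isSkew Q w).smul _
  have h3 : a • (1 : End ℂ V) - (1 / 2 : ℂ) • tau Q w = a • (1 + s) := by
    rw [hs, smul_add, smul_smul, sub_eq_add_neg, ← neg_smul]
    congr 2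
    field_simp
  have h4 : a ^ finrank ℂ V = a ^ (finrank ℂ V - 2) * a ^ 2 := by
    rw [← pow_add, Nat.sub_add_cancel hn]
  have h5 : LinearMap.det (1 + s) * a ^ 2 = 1 := by
    apply mul_left_cancel₀ (pow_ne_zero (finrank ℂ V - 2) ha)
    rw [h3, LinearMap.det_smul, h4] at h
    linear_combination h
  have hu : IsUnit (1 + s) := isUnit_of_det_ne_zero (left_ne_zero_of_mul_eq_one h5)
  obtain ⟨g, hg⟩ := exists_T_eq hQ (isSO_Gamma hQ hskew hu)
  have h6 := det_one_add_Gamma hu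
  rw [← hg, ← two_pow_mul_pr0_sq hQ hn0] at h6
  have h7 : pr0 Q (spinIncl Q g) ^ 2 = a ^ 2 := by
    apply mul_left_cancel₀ (pow_ne_zero (finrank ℂ V) (two_ne_zero (α := ℂ)))
    linear_combination a ^ 2 * h6 - 2 ^ finrank ℂ V * pr0 Q (spinIncl Q g) ^ 2 * h5
  have h8 : ∃ g : Spin Q, pr0 Q (spinIncl Q g) = a ∧ T Q g = Gamma s := by
    rcases sq_eq_sq_iff_eq_or_eq_neg.1 h7 with h8 | h8
    · exact ⟨g, h8, hg⟩
    · obtain ⟨z, hz, hz'⟩ := exists_neg_one hQ hn0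
      refine ⟨z * g, ?_, by rw [map_mul, hz', one_mul, hg]⟩
      rw [spinIncl_mul, hz, neg_mul, one_mul, map_neg, h8, neg_neg]
  obtain ⟨g, hga, hgs⟩ := h8
  refine ⟨g, hga, tau_injective hb ?_⟩
  rw [tau_Phi hQ hn0 hσ ((spinStar_iff hQ hn0 g).2 (by rwa [hga])), hgs, Gamma_Gamma hu, hga, hs,
    smul_smul]
  convert one_smul ℂ (tau Q w)
  field_simp

/-- If $\Phi^*f=0$, then $f$ vanishes at each $w$ where `cayleyPoly` has a nonzero root. At the
other $w$ it specializes to $X^n$, so its coefficient $q$ of degree $n-2$ vanishes. Hence $fq=0$,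
while $q(0)=-1$. -/
theorem PhiStar_injective : Function.Injective (PhiStar σ) := by
  have := isDomain_regular (E := Lie V) (j := lieIncl V) rfl
  obtain ⟨b, hb⟩ := exists_isOrthonormal Q hQ
  rw [injective_iff_map_eq_zero]
  intro f hf
  obtain ⟨hmonic, hdeg⟩ := cayleyPoly_monic (Q := Q) b hn
  set q := (cayleyPoly Q b).coeff (finrank ℂ V - 2) with hq
  have hq0 : q ≠ 0 := by
    intro h0
    have h1 : ((cayleyPoly Q b).map (evalAt (lieIncl V) 0).toRingHom).coeff (finrank ℂ V - 2) = 0 := by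
      rw [coeff_map, ← hq, h0, map_zero]
    have h2 : (cayleyPoly Q b).map (evalAt (lieIncl V) 0).toRingHom =
        X ^ finrank ℂ V - X ^ (finrank ℂ V - 2) := by
      refine Polynomial.funext fun a => ?_
      rw [eval_cayleyPoly hb, map_zero, smul_zero, sub_zero, LinearMap.det_smul, map_one, mul_one]
      simp
    rw [h2, coeff_sub, coeff_X_pow, coeff_X_pow, if_pos rfl, if_neg (by omega)] at h1
    norm_num at h1
  have hfq : f * q = 0 := by
    apply Subtype.ext
    funext w
    change (f : Lie V → ℂ) w * evalAt (lieIncl V) w q = 0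
    by_cases hw : ∃ a ≠ 0, ((cayleyPoly Q b).map (evalAt (lieIncl V) w).toRingHom).eval a = 0
    · obtain ⟨a, ha, haw⟩ := hw
      obtain ⟨g, -, rfl⟩ := exists_Phi_eq hQ hn hσ hb ha haw
      exact mul_eq_zero_of_left (congrFun (congrArg Subtype.val hf) g) _
    · push Not at hw
      set P := (cayleyPoly Q b).map (evalAt (lieIncl V) w).toRingHom with hP
      have hPm : P.Monic := hmonic.map _
      have hPd : P.natDegree = finrank ℂ V := by rw [hP, hmonic.natDegree_map, hdeg]
      have hs := IsAlgClosed.splits P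
      have hr : P.roots = Multiset.replicate (finrank ℂ V) 0 := by
        rw [Multiset.eq_replicate, ← hPd]
        refine ⟨hs.natDegree_eq_card_roots.symm, fun a ha => ?_⟩
        by_contra ha0
        exact hw a ha0 (isRoot_of_mem_roots ha)
      have hPX : P = X ^ finrank ℂ V := by
        rw [hs.eq_prod_roots_of_monic hPm, hr, Multiset.map_replicate, Multiset.prod_replicate, C_0,
          sub_zero]
      have h1 : P.coeff (finrank ℂ V - 2) = 0 := by
        rw [hPX, coeff_X_pow, if_neg (by omega)]
      rw [hP, coeff_map] at h1
      exact mul_eq_zero_of_right _ h1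
  exact (mul_eq_zero.1 hfq).resolve_right hq0

/-- `pr₀` as a regular function on `Spin(V)`. -/
def pr0Fun (Q : QuadraticForm ℂ V) : ASpin Q :=
  ⟨_, linear_mem_regular (spinIncl Q) (pr0 Q)⟩

omit hQ hn hσ in
theorem evalAt_eval₂ (p : (ALie V)[X]) (g : Spin Q) :
    evalAt (spinIncl Q) g (p.eval₂ (PhiStar σ).toRingHom (pr0Fun Q)) =
      (p.map (evalAt (lieIncl V) (Phi σ g)).toRingHom).eval (pr0 Q (spinIncl Q g)) := by
  change (evalAt (spinIncl Q) g).toRingHom _ = _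
  rw [hom_eval₂, eval_map]
  rfl

theorem pr0Fun_ne_zero : pr0Fun Q ≠ 0 := by
  intro h
  have := congrFun (congrArg Subtype.val h) 1
  change pr0 Q (spinIncl Q 1) = 0 at this
  rw [spinIncl_one, pr0_one] at this
  exact one_ne_zero this

/-- The relation is known where $\mathrm{pr}_0\ne0$. Multiplied by `pr0` it holds everywhere, and
the factor cancels in the domain. -/
theorem eval₂_cayleyPoly (hb : IsOrthonormal Q b) :
    (cayleyPoly Q b).eval₂ (PhiStar σ).toRingHom (pr0Fun Q) = 0 := by
  have := isDomain_ASpin hQ hn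
  refine (mul_eq_zero.1 (?_ : pr0Fun Q * _ = 0)).resolve_left (pr0Fun_ne_zero hQ hn hσ)
  apply Subtype.ext
  funext g
  change pr0 Q (spinIncl Q g) * evalAt (spinIncl Q) g _ = 0
  rw [evalAt_eval₂]
  by_cases hg : pr0 Q (spinIncl Q g) = 0
  · rw [hg, zero_mul]
  · rw [eval_cayleyPoly_Phi hQ hn hσ hb ((spinStar_iff hQ (by omega) g).2 hg), mul_zero]

end CayleyPoly

/-- The relation between `pr₀` and `Φ` has the irreducible factor of degree `2 [n / 2]`. -/
theorem exists_irreducible_factor (hQ : (form Q).Nondegenerate) (hn : 2 ≤ finrank ℂ V) :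
    ∃ (ι : Type) (_ : Fintype ι) (_ : DecidableEq ι) (b : Basis ι ℂ V) (F : (ALie V)[X]),
      IsOrthonormal Q b ∧ F.Monic ∧ F.natDegree = 2 * (finrank ℂ V / 2) ∧ Irreducible F ∧
      cayleyPoly Q b = X ^ (finrank ℂ V % 2) * F := by
  have := isDomain_regular (E := Lie V) (j := lieIncl V) rfl
  obtain ⟨b', hb'⟩ := exists_isOrthonormal Q hQ
  obtain ⟨k, hk⟩ : ∃ k, finrank ℂ V = 2 * (k + 1) + finrank ℂ V % 2 :=
    ⟨finrank ℂ V / 2 - 1, by omega⟩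
  set r := finrank ℂ V % 2 with hr
  have e : Fin (finrank ℂ V) ≃ (Fin 2 × Option (Fin k)) ⊕ Fin r := by
    apply Fintype.equivOfCardEq
    simp only [Fintype.card_fin, Fintype.card_sum, Fintype.card_prod, Fintype.card_option]
    exact hk
  let b := b'.reindex e
  have hb : IsOrthonormal Q b := by
    intro i j
    rw [Basis.reindex_apply, Basis.reindex_apply, hb']
    simp
  obtain ⟨hmonic, hdeg⟩ := cayleyPoly_monic (Q := Q) b hn
  -- the parity factor
  have hfac : ∃ F, cayleyPoly Q b = X ^ r * F := by
    change X ^ r ∣ cayleyPoly Q b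
    rcases Nat.mod_two_eq_zero_or_one (finrank ℂ V) with h0 | h1
    · have h2 : (X ^ r : (ALie V)[X]) = 1 := by rw [hr, h0, pow_zero]
      rw [h2]
      exact one_dvd _
    · have h2 : (X ^ r : (ALie V)[X]) = X := by rw [hr, h1, pow_one]
      rw [h2]
      refine X_dvd_iff.2 (Subtype.ext (funext fun w => ?_))
      refine (coeff_map (p := cayleyPoly Q b) (evalAt (lieIncl V) w).toRingHom 0).symm.trans
        (?_ : _ = (0 : ℂ))
      rw [coeff_zero_eq_eval_zero, eval_cayleyPoly hb]
      -- A skew endomorphism in odd dimension has determinant zero, and $n\ge3$ here, so $0^{n-2}=0$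
      -- as well.
      have h2 := det_add_eq_det_sub hb ((tau_isSkew Q w).smul (1 / 2)) 0
      rw [zero_smul, zero_sub, zero_add, ← neg_one_smul ℂ, LinearMap.det_smul,
        Odd.neg_one_pow (Nat.odd_iff.2 h1)] at h2
      rw [zero_smul, zero_sub, ← neg_one_smul ℂ, LinearMap.det_smul,
        Odd.neg_one_pow (Nat.odd_iff.2 h1), zero_pow (by omega)]
      linear_combination h2 / 2
  obtain ⟨F, hF⟩ := hfac
  have hFm : F.Monic := Monic.of_mul_monic_left (monic_X_pow r) (hF ▸ hmonic)
  refine ⟨_, inferInstance, inferInstance, b, F, hb, hFm, ?_, ?_, hF⟩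
  · have h1 := hdeg
    rw [hF, (monic_X_pow r).natDegree_mul hFm, natDegree_X_pow] at h1
    omega
  -- specialization along a line
  have hskew : ∀ c : Option (Fin k) → ℂ, ∃ w : Lie V,
      LinearMap.toMatrix b b ((1 / 2 : ℂ) • tau Q w) = skewBlocks c r := by
    intro c
    have hs : IsSkew Q (Matrix.toLin b b (skewBlocks c r)) := by
      apply isSkew_of_transpose hb
      rw [LinearMap.toMatrix_toLin, transpose_skewBlocks]
    obtain ⟨w, hw⟩ := exists_tau_eq hb (hs.smul 2)
    refine ⟨w, ?_⟩
    rw [hw, smul_smul, one_div, inv_mul_cancel₀ two_ne_zero, one_smul, LinearMap.toMatrix_toLin]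
  -- On the line $w_0+tw_1$ one block has the entry $t$ and the others the constants `blockCoeff`.
  let c₀ : Option (Fin k) → ℂ := fun o => o.elim 0 blockCoeff
  let c₁ : Option (Fin k) → ℂ := fun o => o.elim 1 fun _ => 0
  obtain ⟨w₀, hw₀⟩ := hskew c₀
  obtain ⟨w₁, hw₁⟩ := hskew c₁
  obtain ⟨φ, hφ⟩ := exists_restrictLine (j := lieIncl V) rfl w₀ w₁
  let c : Option (Fin k) → ℂ[X] := fun o => o.elim X fun j => C (blockCoeff j)
  have hM : (tauMatrix Q b).map φ.toRingHom = skewBlocks c r := by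
    refine Matrix.ext fun i j => Polynomial.funext fun t => ?_
    have h1 : (skewBlocks c r i j).eval t = (skewBlocks c r).map (evalRingHom t) i j := rfl
    have h2 : (fun o => evalRingHom t (c o)) = fun o => c₀ o + t * c₁ o := by
      funext o
      cases o <;> simp [c, c₀, c₁]
    have h3 : (1 / 2 : ℂ) • tau Q w₀ + t • (1 / 2 : ℂ) • tau Q w₁ =
        (1 / 2 : ℂ) • tau Q (w₀ + t • w₁) := by
      rw [map_add, map_smul]
      module
    rw [h1, skewBlocks_map, h2, skewBlocks_add_smul, ← hw₀, ← hw₁,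
      ← map_smul (LinearMap.toMatrix b b), ← map_add (LinearMap.toMatrix b b), h3,
      ← tauMatrix_map hb]
    exact hφ _ t
  have hG : (cayleyPoly Q b).map φ.toRingHom = X ^ r * ((X ^ 2 + C (X ^ 2)) *
      (∏ j : Fin k, (X ^ 2 + C (C (blockCoeff j ^ 2)))) - X ^ (2 * k)) := by
    rw [cayleyPoly, Polynomial.map_sub, ← Matrix.charpoly_map, hM, charpoly_skewBlocks,
      Fintype.prod_option, Polynomial.map_pow, map_X]
    have h2 : finrank ℂ V - 2 = r + 2 * k := by omega
    rw [h2, pow_add]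
    simp only [c, Option.elim, C_pow]
    ring
  rw [hF, Polynomial.map_mul, Polynomial.map_pow, map_X] at hG
  have hG' := mul_left_cancel₀ (pow_ne_zero r X_ne_zero) hG
  -- Since $F$ is monic, a nontrivial factorization would survive the specialization.
  apply Monic.irreducible_of_irreducible_map φ.toRingHom F hFm
  rw [hG']
  exact irreducible_specialization k

end CayleySpin

end

noncomputable section

namespace CayleySpin

/-! ### Simple field extensions -/

section SimpleExtension

open Polynomial

variable {K L : Type*} [Field K] [Field L] [Algebra ℂ K] [Algebra ℂ L] {φ : K →ₐ[ℂ] L} {a : L}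
  {P : K[X]}

/-- The hypothesis `hgen` says that $\varphi(K)$ and $a$ generate $L$ as a field. As $a$ is
algebraic, $K[a]$ is closed under inverses and equals $L$; the irreducible monic $P$ is the minimal
polynomial of $a$. -/
theorem exists_powerBasis (hP : Irreducible P) (hm : P.Monic) (ha : P.eval₂ φ.toRingHom a = 0)
    (hgen : ∀ M : Subalgebra ℂ L, (∀ x, φ x ∈ M) → a ∈ M → (∀ x ∈ M, x⁻¹ ∈ M) → M = ⊤) :
    letI := φ.toRingHom.toAlgebra
    ∃ pb : PowerBasis K L, pb.gen = a ∧ pb.dim = P.natDegree := by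
  let := φ.toRingHom.toAlgebra
  have : IsScalarTower ℂ K L := IsScalarTower.of_algebraMap_eq fun c => (φ.commutes c).symm
  have hint : IsIntegral K a := ⟨P, hm, ha⟩
  have htop : Algebra.adjoin K {a} = ⊤ := by
    have h := hgen ((Algebra.adjoin K {a}).restrictScalars ℂ)
      (fun x => (Algebra.adjoin K {a}).algebraMap_mem x)
      (Algebra.self_mem_adjoin_singleton K a)
      (fun x hx => (Algebra.adjoin K {a}).inv_mem_of_algebraic (x := ⟨x, hx⟩)
        (adjoin_le_integralClosure hint hx).isAlgebraic)
    rw [eq_top_iff]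
    intro x _
    have hx : x ∈ (Algebra.adjoin K {a}).restrictScalars ℂ := h ▸ Algebra.mem_top
    exact hx
  refine ⟨PowerBasis.ofAdjoinEqTop' hint htop, PowerBasis.ofAdjoinEqTop'_gen hint htop, ?_⟩
  rw [PowerBasis.ofAdjoinEqTop'_dim, ← minpoly.eq_of_irreducible_of_monic hP ha hm]

theorem extensionDegree_eq (hP : Irreducible P) (hm : P.Monic) (ha : P.eval₂ φ.toRingHom a = 0)
    (hgen : ∀ M : Subalgebra ℂ L, (∀ x, φ x ∈ M) → a ∈ M → (∀ x ∈ M, x⁻¹ ∈ M) → M = ⊤) :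
    extensionDegree φ.toRingHom = P.natDegree := by
  let := φ.toRingHom.toAlgebra
  obtain ⟨pb, -, hd⟩ := exists_powerBasis hP hm ha hgen
  exact pb.finrank.trans hd

theorem exists_eq_sum_pow (hP : Irreducible P) (hm : P.Monic) (ha : P.eval₂ φ.toRingHom a = 0)
    (hgen : ∀ M : Subalgebra ℂ L, (∀ x, φ x ∈ M) → a ∈ M → (∀ x ∈ M, x⁻¹ ∈ M) → M = ⊤) :
    (∀ z, ∃ c : Fin P.natDegree → K, z = ∑ i, φ (c i) * a ^ (i : ℕ)) ∧
      ∀ c c' : Fin P.natDegree → K, ∑ i, φ (c i) * a ^ (i : ℕ) = ∑ i, φ (c' i) * a ^ (i : ℕ) →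
        c = c' := by
  let := φ.toRingHom.toAlgebra
  obtain ⟨pb, rfl, hd⟩ := exists_powerBasis hP hm ha hgen
  rw [← hd]
  have e : ∀ c : Fin pb.dim → K, ∑ i, φ (c i) * pb.gen ^ (i : ℕ) = pb.basis.equivFun.symm c := by
    intro c
    rw [Basis.equivFun_symm_apply]
    refine Finset.sum_congr rfl fun i _ => ?_
    rw [pb.basis_eq_pow, Algebra.smul_def]
    rfl
  refine ⟨fun z => ⟨pb.basis.equivFun z, ?_⟩, fun c c' h => ?_⟩
  · rw [e, LinearEquiv.symm_apply_apply]
  · rw [e, e] at h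
    exact pb.basis.equivFun.symm.injective h

theorem adjoin_range_eq_top (hP : Irreducible P) (hm : P.Monic) (ha : P.eval₂ φ.toRingHom a = 0)
    (hgen : ∀ M : Subalgebra ℂ L, (∀ x, φ x ∈ M) → a ∈ M → (∀ x ∈ M, x⁻¹ ∈ M) → M = ⊤) :
    Algebra.adjoin ℂ (Set.range φ ∪ {a}) = ⊤ := by
  rw [eq_top_iff]
  intro z _
  obtain ⟨c, rfl⟩ := (exists_eq_sum_pow hP hm ha hgen).1 z
  have ha' : a ∈ Algebra.adjoin ℂ (Set.range φ ∪ {a}) :=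
    Algebra.subset_adjoin (Or.inr (Set.mem_singleton a))
  exact Subalgebra.sum_mem _ fun i _ => Subalgebra.mul_mem _
    (Algebra.subset_adjoin (Or.inl ⟨_, rfl⟩)) (Subalgebra.pow_mem _ ha' _)

/-- The maps fix $a$ and act on $\varphi(K)$ through $K$, so by uniqueness of the expansion
$\sum\varphi(c_i)a^i$ an element is fixed exactly when its coefficients are. -/
theorem adjoin_fixed_eq {G : Type*} (e : G → L →ₐ[ℂ] L) (r : G → K →ₐ[ℂ] K)
    (he : ∀ g x, e g (φ x) = φ (r g x)) (hea : ∀ g, e g a = a)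
    (hP : Irreducible P) (hm : P.Monic) (ha : P.eval₂ φ.toRingHom a = 0)
    (hgen : ∀ M : Subalgebra ℂ L, (∀ x, φ x ∈ M) → a ∈ M → (∀ x ∈ M, x⁻¹ ∈ M) → M = ⊤) :
    Algebra.adjoin ℂ (φ '' ((⨅ g, AlgHom.equalizer (r g) (AlgHom.id ℂ K) : Subalgebra ℂ K) : Set K)
      ∪ {a}) = ⨅ g, AlgHom.equalizer (e g) (AlgHom.id ℂ L) := by
  apply le_antisymm
  · refine Algebra.adjoin_le ?_
    rintro z (⟨x, hx, rfl⟩ | rfl)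
    · rw [SetLike.mem_coe, Algebra.mem_iInf] at hx ⊢
      intro g
      have hg : r g x = x := hx g
      exact (he g x).trans (congrArg φ hg)
    · rw [SetLike.mem_coe, Algebra.mem_iInf]
      exact hea
  · intro z hz
    rw [Algebra.mem_iInf] at hz
    obtain ⟨h1, h2⟩ := exists_eq_sum_pow hP hm ha hgen
    obtain ⟨c, rfl⟩ := h1 z
    refine Subalgebra.sum_mem _ fun i _ => Subalgebra.mul_mem _ (Algebra.subset_adjoin
      (Set.mem_union_left _ (Set.mem_image_of_mem φ ?_)))
      (Subalgebra.pow_mem _ (Algebra.subset_adjoin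
        (Set.mem_union_right _ (Set.mem_singleton a))) _)
    rw [SetLike.mem_coe, Algebra.mem_iInf]
    intro g
    have hg : e g (∑ i, φ (c i) * a ^ (i : ℕ)) = ∑ i, φ (c i) * a ^ (i : ℕ) := hz g
    rw [map_sum] at hg
    simp only [map_mul, map_pow, he, hea] at hg
    exact congrFun (h2 (fun i => r g (c i)) c hg) i

end SimpleExtension

/-! ### Coordinates of `Spin(V)` in terms of `pr₀` and `Φ` -/

variable {V : Type*} [AddCommGroup V] [Module ℂ V] {Q : QuadraticForm ℂ V} [FiniteDimensional ℂ V]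

/-- The regular function `g ↦ pr₀(u g)` on `Spin(V)`. -/
def coordFun (u : CliffordAlgebra Q) : ASpin Q :=
  ⟨_, linear_mem_regular (spinIncl Q) (pr0 Q ∘ₗ LinearMap.mulLeft ℂ u)⟩

theorem coordFun_apply (u : CliffordAlgebra Q) (g : Spin Q) :
    (coordFun u : Spin Q → ℂ) g = pr0 Q (u * spinIncl Q g) := rfl

theorem coordFun_smul (c : ℂ) (u : CliffordAlgebra Q) : coordFun (c • u) = c • coordFun u := by
  apply Subtype.ext
  funext g
  change pr0 Q (c • u * spinIncl Q g) = c • pr0 Q (u * spinIncl Q g)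
  rw [smul_mul_assoc, map_smul]

theorem coordFun_one : coordFun (1 : CliffordAlgebra Q) = pr0Fun Q := by
  apply Subtype.ext
  funext g
  exact congrArg (pr0 Q) (one_mul _)

section

variable {S : Type*} [AddCommGroup S] [Module ℂ S] [FiniteDimensional ℂ S]
  {σ : CZ Q →ₐ[ℂ] End ℂ S} (hQ : (form Q).Nondegenerate) (hσ : IsSpinModule Q σ)
include hQ hσ

/-- The trace property of `pr0` moves conjugation to the other argument of the form, and
nondegeneracy concludes. -/
theorem Phi_conj (hn : 0 < finrank ℂ V) (h g : Spin Q) :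
    Phi σ (h * g * h⁻¹) = Ad Q h (Phi σ g) := by
  rw [← sub_eq_zero]
  refine (traceForm_spin_nondegenerate hQ hn hσ).2 _ fun y => ?_
  rw [map_sub, traceForm_spin hQ hn hσ, traceForm_spin hQ hn hσ, pr0_Phi hQ hn hσ, ← mul_sub,
    sub_eq_zero.2, mul_zero]
  have e1 : ∀ u : CliffordAlgebra Q, pr0 Q ((psi Q).symm y * (spinIncl Q h * u * spinIncl Q h⁻¹)) =
      pr0 Q ((psi Q).symm (Ad Q h⁻¹ y) * u) := by
    intro u
    rw [psi_symm_Ad, inv_inv, ← mul_assoc, pr0_mul_comm]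
    simp only [mul_assoc]
  rw [spinIncl_mul, spinIncl_mul, psi_symm_Ad, e1, e1, pr0_Phi hQ hn hσ]

variable {ι : Type*} [Fintype ι] [DecidableEq ι] {b : Basis ι ℂ V} (hb : IsOrthonormal Q b)
  (hn : 2 ≤ finrank ℂ V)
include hb hn

/-- A Pfaffian-like expansion: up to sign $e_te_j$ for $j\in t$ is $e_{t\setminus j}$, two degrees
below $e_te_i$. It comes from $(b_i-\Gamma b_i)g=g(b_i+\Gamma b_i)$, multiplied by $e_t$ under the
trace `pr0`. -/
theorem pr0Fun_mul_coordFun {i : ι} {t : Finset ι} (hi : i ∉ t) (ht : Odd t.card) :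
    pr0Fun Q * coordFun (mon Q b t * gen Q b i) =
      -∑ j ∈ t, PhiStar σ (tauMatrix Q b j i) * coordFun (mon Q b t * gen Q b j) := by
  have := isDomain_ASpin hQ hn
  have hn0 : 0 < finrank ℂ V := by omega
  -- One more factor `pr0` reduces the identity to points with $\mathrm{pr}_0(g)\ne0$, where the
  -- Cayley formula applies.
  apply mul_left_cancel₀ (pr0Fun_ne_zero hQ hn hσ)
  apply Subtype.ext
  funext g
  have hsum : evalAt (spinIncl Q) g (-∑ j ∈ t, PhiStar σ (tauMatrix Q b j i) *
      coordFun (mon Q b t * gen Q b j)) = -∑ j ∈ t, form Q (b j)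
        (((1 / 2 : ℂ) • tau Q (Phi σ g)) (b i)) * pr0 Q (mon Q b t * gen Q b j * spinIncl Q g) := by
    rw [map_neg, map_sum]
    simp only [map_mul]
    rfl
  change evalAt (spinIncl Q) g (pr0Fun Q * (pr0Fun Q * coordFun (mon Q b t * gen Q b i))) =
    evalAt (spinIncl Q) g (pr0Fun Q * -∑ j ∈ t, PhiStar σ (tauMatrix Q b j i) *
      coordFun (mon Q b t * gen Q b j))
  rw [map_mul, map_mul, map_mul, hsum]
  change pr0 Q (spinIncl Q g) * (pr0 Q (spinIncl Q g) *
    pr0 Q (mon Q b t * gen Q b i * spinIncl Q g)) = pr0 Q (spinIncl Q g) * _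
  by_cases hg : pr0 Q (spinIncl Q g) = 0
  · rw [hg, zero_mul, zero_mul]
  congr 1
  have hg' := (spinStar_iff hQ hn0 g).2 hg
  rw [tau_Phi hQ hn0 hσ hg']
  obtain ⟨hT, -⟩ := T_one_add_Gamma (isUnit_of_det_ne_zero hg')
  set B := Gamma (T Q g) with hB
  set X : ι → ℂ := fun j => pr0 Q (mon Q b t * gen Q b j * spinIncl Q g) with hX
  set c : ι → ℂ := fun j => form Q (b j) (B (b i)) with hc
  have hBy : CliffordAlgebra.ι Q (B (b i)) = ∑ j, c j • gen Q b j := by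
    conv_lhs => rw [← sum_form_smul hb (B (b i))]
    rw [map_sum]
    exact Finset.sum_congr rfl fun j _ => map_smul _ _ _
  -- As $|t|$ is odd, $e_j$ commutes with $e_t$ for $j\in t$ and anticommutes otherwise, so the
  -- terms with $j\notin t$ will cancel.
  have hcomm : ∀ j, gen Q b j * mon Q b t = (if j ∈ t then (1 : ℂ) else -1) •
      (mon Q b t * gen Q b j) := by
    intro j
    rw [gen_mul_mon_comm hb, ht.neg_one_pow]
    congr 1
    split_ifs <;> norm_num
  have h1 : (gen Q b i - CliffordAlgebra.ι Q (B (b i))) * spinIncl Q g =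
      spinIncl Q g * (gen Q b i + CliffordAlgebra.ι Q (B (b i))) := by
    have h2 := LinearMap.congr_fun hT (b i)
    rw [Module.End.mul_apply] at h2
    have h3 := ι_T_mul g ((1 + B) (b i))
    rw [h2, LinearMap.sub_apply, LinearMap.add_apply, map_sub, map_add] at h3
    exact h3
  have h2 : pr0 Q (mon Q b t * ((gen Q b i - CliffordAlgebra.ι Q (B (b i))) * spinIncl Q g)) =
      pr0 Q ((gen Q b i + CliffordAlgebra.ι Q (B (b i))) * mon Q b t * spinIncl Q g) := by
    rw [h1, ← mul_assoc, pr0_mul_comm, ← mul_assoc]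
  have h3 : X i - ∑ j, c j * X j = -X i + ∑ j, c j * ((if j ∈ t then (1 : ℂ) else -1) * X j) := by
    rw [← mul_assoc, mul_sub, sub_mul, add_mul, add_mul, hcomm i, if_neg hi, hBy, Finset.mul_sum,
      Finset.sum_mul, Finset.sum_mul, Finset.sum_mul, map_sub, map_add, map_sum, map_sum] at h2
    simp only [mul_smul_comm, smul_mul_assoc, hcomm, map_smul, smul_eq_mul, neg_mul, one_mul] at h2
    exact h2
  have h4 : ∑ j, c j * X j + ∑ j, c j * ((if j ∈ t then (1 : ℂ) else -1) * X j) =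
      2 * ∑ j ∈ t, c j * X j := by
    rw [← Finset.sum_add_distrib, ← Finset.sum_filter_add_sum_filter_not _ (· ∈ t),
      Finset.filter_mem_eq_inter, Finset.univ_inter, Finset.mul_sum]
    rw [Finset.sum_eq_zero (s := Finset.univ.filter fun j => j ∉ t), add_zero]
    · refine Finset.sum_congr rfl fun j hj => ?_
      rw [if_pos hj]
      ring
    · intro j hj
      rw [if_neg (Finset.mem_filter.1 hj).2]
      ring
  have h5 : X i = ∑ j ∈ t, c j * X j := by linear_combination (h3 + h4) / 2
  change pr0 Q (spinIncl Q g) * X i = _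
  rw [h5, Finset.mul_sum, ← Finset.sum_neg_distrib]
  refine Finset.sum_congr rfl fun j _ => ?_
  simp only [LinearMap.smul_apply, map_smul, smul_eq_mul]
  change _ = -(1 / 2 * (-2 * pr0 Q (spinIncl Q g) * c j) * X j)
  ring

end

end CayleySpin

end

noncomputable section

namespace CayleySpin

theorem algEquivOfAlgEquiv_comm {A B K L : Type*} [CommRing A] [CommRing B] [Field K] [Field L]
    [Algebra ℂ A] [Algebra ℂ B] [Algebra ℂ K] [Algebra ℂ L] [Algebra A K] [Algebra B L]
    [IsFractionRing A K] [IsFractionRing B L] [IsScalarTower ℂ A K] [IsScalarTower ℂ B L]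
    {eA : A ≃ₐ[ℂ] A} {eB : B ≃ₐ[ℂ] B} {ψ : A →ₐ[ℂ] B} {φ : K →ₐ[ℂ] L}
    (hφ : ∀ f, φ (algebraMap A K f) = algebraMap B L (ψ f)) (h : ∀ f, eB (ψ f) = ψ (eA f)) (x : K) :
    IsFractionRing.algEquivOfAlgEquiv (K := L) (L := L) eB (φ x) =
      φ (IsFractionRing.algEquivOfAlgEquiv (K := K) (L := K) eA x) := by
  have key : ∀ f, IsFractionRing.algEquivOfAlgEquiv (K := L) (L := L) eB (φ (algebraMap A K f)) =
      φ (IsFractionRing.algEquivOfAlgEquiv (K := K) (L := K) eA (algebraMap A K f)) := by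
    intro f
    rw [IsFractionRing.algEquivOfAlgEquiv_algebraMap, hφ, hφ,
      IsFractionRing.algEquivOfAlgEquiv_algebraMap, h]
  obtain ⟨f, f', -, rfl⟩ := IsFractionRing.div_surjective A x
  simp only [map_div₀, key]

/-! ### The function fields -/

variable {V : Type*} [AddCommGroup V] [Module ℂ V] {Q : QuadraticForm ℂ V} [FiniteDimensional ℂ V]

variable {S : Type*} [AddCommGroup S] [Module ℂ S] [FiniteDimensional ℂ S]
  {σ : CZ Q →ₐ[ℂ] End ℂ S} (hQ : (form Q).Nondegenerate) (hσ : IsSpinModule Q σ)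
  (hn : 2 ≤ finrank ℂ V)
include hQ hσ hn

/-- `A(Spin(V))` is contained in the field generated by `pr₀` and the image of `Φ^*`. -/
theorem map_mem_of_inv_mem {L : Type*} [Field L] [Algebra ℂ L] (j : ASpin Q →ₐ[ℂ] L)
    (hj : Function.Injective j) (M : Subalgebra ℂ L) (hΦ : ∀ f, j (PhiStar σ f) ∈ M)
    (ha : j (pr0Fun Q) ∈ M) (hinv : ∀ x ∈ M, x⁻¹ ∈ M) (f : ASpin Q) : j f ∈ M := by
  obtain ⟨b, hb⟩ := exists_isOrthonormal Q hQ
  have ha0 : j (pr0Fun Q) ≠ 0 := by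
    exact (map_ne_zero_iff j hj).2 (pr0Fun_ne_zero hQ hn hσ)
  have hsmul : ∀ (c : ℂ) (f : ASpin Q), j f ∈ M →
      j (c • f) ∈ M := by
    intro c f hf
    rw [map_smul]
    exact M.smul_mem hf c
  have hsign : ∀ u v : CliffordAlgebra Q, SignEq u v →
      j (coordFun v) ∈ M →
      j (coordFun u) ∈ M := by
    rintro u v ⟨ε, -, rfl⟩ hv
    rw [coordFun_smul]
    exact hsmul _ _ hv
  -- Induction on $|s|$: for even $s\ne\emptyset$ the recursion, divided by `pr0`, leads to sets
  -- with two elements fewer. Odd coordinates vanish because $g$ is even.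
  have hcoord : ∀ (k : ℕ) (s : Finset (Fin (finrank ℂ V))), s.card = k →
      j (coordFun (mon Q b s)) ∈ M := by
    intro k
    induction k using Nat.strong_induction_on with
    | _ k ih =>
      rintro s rfl
      rcases Nat.even_or_odd s.card with he | ho
      · rcases s.eq_empty_or_nonempty with rfl | ⟨i, hi⟩
        · rwa [mon_empty, coordFun_one]
        · set t := s.erase i with ht
          have hit : i ∉ t := Finset.notMem_erase i s
          have hcard : t.card + 1 = s.card := Finset.card_erase_add_one hi
          have hto : Odd t.card := by
            rw [← hcard, Nat.even_add_one, Nat.not_even_iff_odd] at he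
            exact he
          have h1 : ∀ k, SignEq (mon Q b t * gen Q b k) (gen Q b k * mon Q b t) := by
            intro k
            refine SignEq.symm ⟨_, ?_, gen_mul_mon_comm hb k t⟩
            rw [hto.neg_one_pow]
            split_ifs <;> norm_num
          have h2 : SignEq (mon Q b s) (mon Q b t * gen Q b i) := by
            have := gen_mul_mon_of_notMem hb hit
            rw [ht, Finset.insert_erase hi] at this
            exact ((h1 i).trans this).symm
          refine hsign _ _ h2 ?_
          have h3 := congrArg (j)
            (pr0Fun_mul_coordFun hQ hσ hb hn hit hto)
          rw [map_mul] at h3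
          rw [← inv_mul_cancel_left₀ ha0 (j (coordFun (mon Q b t * gen Q b i))), h3, map_neg, map_sum]
          refine M.mul_mem (hinv _ ha) (M.neg_mem (M.sum_mem fun k hk => ?_))
          rw [map_mul]
          refine M.mul_mem (hΦ _) (hsign _ _ ((h1 k).trans (gen_mul_mon_of_mem hb hk)) ?_)
          refine ih _ ?_ _ rfl
          have := Finset.card_erase_add_one hk
          omega
      · have h0 : coordFun (mon Q b s) = 0 := by
          apply Subtype.ext
          funext g
          exact pr0_mon_mul_of_even ho (spinIncl_mem_even g)
        rw [h0, map_zero]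
        exact M.zero_mem
  obtain ⟨f, hf⟩ := f
  induction hf using Algebra.adjoin_induction with
  | mem f hf =>
    obtain ⟨l, rfl⟩ := hf
    have h1 : (⟨fun g => l (spinIncl Q g), linear_mem_regular (spinIncl Q) l⟩ : ASpin Q) =
        ∑ s, (pr0 Q (mon Q b s * mon Q b s) * l (mon Q b s)) • coordFun (mon Q b s) := by
      apply Subtype.ext
      funext g
      change _ = evalAt (spinIncl Q) g _
      rw [map_sum]
      change l (spinIncl Q g) = _
      conv_lhs => rw [eq_sum_mon hb (spinIncl Q g)]
      rw [map_sum]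
      refine Finset.sum_congr rfl fun s _ => ?_
      rw [map_smul, map_smul, smul_eq_mul, smul_eq_mul, evalAt_apply, coordFun_apply]
      ring
    rw [h1, map_sum]
    exact M.sum_mem fun s _ => hsmul _ _ (hcoord _ s rfl)
  | algebraMap r =>
    have h1 := j.commutes r
    exact h1 ▸ M.algebraMap_mem r
  | add f g hf hg h1 h2 =>
    have := M.add_mem h1 h2
    rwa [← map_add] at this
  | mul f g hf hg h1 h2 =>
    have := M.mul_mem h1 h2
    rwa [← map_mul] at this

omit hn in
theorem translate_PhiStar (hn : 0 < finrank ℂ V) (h : Spin Q) (f : ALie V) :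
    translate (conjPerm Q h) (conjPerm_regular Q h) (conjPerm_symm_regular Q h) (PhiStar σ f) =
      PhiStar σ (translate (adPerm Q h) (adPerm_regular Q h) (adPerm_symm_regular Q h) f) := by
  apply Subtype.ext
  funext g
  refine congrArg (f : Lie V → ℂ) ?_
  have h1 := Phi_conj hQ hσ hn h⁻¹ g
  rw [inv_inv] at h1
  exact h1

omit hQ hσ hn in
theorem translate_pr0Fun (h : Spin Q) :
    translate (conjPerm Q h) (conjPerm_regular Q h) (conjPerm_symm_regular Q h) (pr0Fun Q) =
      pr0Fun Q := by
  apply Subtype.ext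
  funext g
  change pr0 Q (spinIncl Q (h⁻¹ * g * h⁻¹⁻¹)) = pr0 Q (spinIncl Q g)
  rw [spinIncl_mul, pr0_mul_comm, ← spinIncl_mul, inv_inv, mul_inv_cancel_left]

/-- The function fields of `Spin(V)` and `∧²V`, for given fields of fractions. -/
theorem exists_fieldHom {K L : Type*} [Field K] [Field L] [Algebra (ALie V) K] [Algebra (ASpin Q) L]
    [IsFractionRing (ALie V) K] [IsFractionRing (ASpin Q) L] [Algebra ℂ K] [Algebra ℂ L]
    [IsScalarTower ℂ (ALie V) K] [IsScalarTower ℂ (ASpin Q) L] :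
    ∃ φ : K →ₐ[ℂ] L,
      (∀ f : ALie V, φ (algebraMap (ALie V) K f) = algebraMap (ASpin Q) L (PhiStar σ f)) ∧
      (extensionDegree φ.toRingHom =
        if Even (finrank ℂ V) then finrank ℂ V else finrank ℂ V - 1) ∧
      Algebra.adjoin ℂ (φ '' ((⨅ h, AlgHom.equalizer
          (IsFractionRing.algEquivOfAlgEquiv (K := K) (L := K)
            (translate (adPerm Q h) (adPerm_regular Q h) (adPerm_symm_regular Q h))).toAlgHom
          (AlgHom.id ℂ K) : Subalgebra ℂ K) : Set K) ∪ {algebraMap (ASpin Q) L (chi Q)}) =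
        ⨅ h, AlgHom.equalizer
          (IsFractionRing.algEquivOfAlgEquiv (K := L) (L := L)
            (translate (conjPerm Q h) (conjPerm_regular Q h) (conjPerm_symm_regular Q h))).toAlgHom
          (AlgHom.id ℂ L) ∧
      Algebra.adjoin ℂ (Set.range φ ∪ {algebraMap (ASpin Q) L (chi Q)}) = ⊤ := by
  have hinj := PhiStar_injective hQ hn hσ
  have := isDomain_ASpin hQ hn
  have := isDomain_regular (E := Lie V) (j := lieIncl V) rfl
  have := isIntegrallyClosed_regular (E := Lie V) (j := lieIncl V) rfl
  have hinj' : Function.Injective ((IsScalarTower.toAlgHom ℂ (ASpin Q) (L)).comp (PhiStar σ)) :=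
    (IsFractionRing.injective (ASpin Q) (L)).comp hinj
  let φ : K →ₐ[ℂ] L := IsFractionRing.liftAlgHom hinj'
  have hφ : ∀ f : ALie V, φ (algebraMap (ALie V) (K) f) =
      algebraMap (ASpin Q) (L) (PhiStar σ f) := fun f =>
    IsFractionRing.lift_algebraMap hinj' f
  obtain ⟨ι, _, _, b, F, hb, hFm, hFd, hFi, hF⟩ := exists_irreducible_factor hQ hn
  -- the generator
  set a := algebraMap (ASpin Q) (L) (pr0Fun Q) with ha
  have ha0 : pr0Fun Q ≠ 0 := pr0Fun_ne_zero hQ hn hσ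
  have hroot : F.eval₂ (PhiStar σ).toRingHom (pr0Fun Q) = 0 := by
    have h := eval₂_cayleyPoly hQ hn hσ hb
    rw [hF, Polynomial.eval₂_mul, Polynomial.eval₂_pow, Polynomial.eval₂_X] at h
    exact (mul_eq_zero.1 h).resolve_left (pow_ne_zero _ ha0)
  set P := F.map (algebraMap (ALie V) (K)) with hP
  have hPm : P.Monic := hFm.map _
  have hPd : P.natDegree = 2 * (finrank ℂ V / 2) := by rw [hP, hFm.natDegree_map, hFd]
  -- Gauss's lemma for the monic $F$ over the integrally closed ring $A(\wedge^2V)$.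
  have hPi : Irreducible P := hFm.irreducible_iff_irreducible_map_fraction_map.1 hFi
  set χ := algebraMap (ASpin Q) (L) (chi Q) with hχ
  set d : ℂ := ((√2 : ℝ) : ℂ) ^ finrank ℂ V with hd
  have hd0 : d ≠ 0 := by
    refine pow_ne_zero _ ?_
    rw [Ne, Complex.ofReal_eq_zero]
    positivity
  have hχa : χ = d • a := by
    rw [hχ, ha, ← IsScalarTower.coe_toAlgHom' ℂ, ← map_smul]
    rfl
  -- The functions $\chi$ and `pr0` differ by the nonzero constant $d$, so either serves as
  -- generator.
  have hadjoin : ∀ s : Set (L), Algebra.adjoin ℂ (s ∪ {χ}) = Algebra.adjoin ℂ (s ∪ {a}) := by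
    intro s
    apply le_antisymm <;> refine Algebra.adjoin_le (Set.union_subset (fun x hx =>
      Algebra.subset_adjoin (Or.inl hx)) (Set.singleton_subset_iff.2 ?_))
    · rw [hχa]
      exact Subalgebra.smul_mem _ (Algebra.subset_adjoin
        (Set.mem_union_right _ (Set.mem_singleton a))) d
    · have h : a = d⁻¹ • χ := by rw [hχa, smul_smul, inv_mul_cancel₀ hd0, one_smul]
      rw [h]
      exact Subalgebra.smul_mem _ (Algebra.subset_adjoin
        (Set.mem_union_right _ (Set.mem_singleton χ))) _
  have hPa : P.eval₂ φ.toRingHom a = 0 := by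
    rw [hP, Polynomial.eval₂_map]
    have h1 : φ.toRingHom.comp (algebraMap (ALie V) (K)) =
        (algebraMap (ASpin Q) (L)).comp (PhiStar σ).toRingHom := RingHom.ext hφ
    rw [h1, ha, ← Polynomial.hom_eval₂, hroot, map_zero]
  have hgen : ∀ M : Subalgebra ℂ (L), (∀ x, φ x ∈ M) → a ∈ M → (∀ x ∈ M, x⁻¹ ∈ M) → M = ⊤ :=
    by
    intro M h1 h2 h3
    have h4 := map_mem_of_inv_mem hQ hσ hn (IsScalarTower.toAlgHom ℂ (ASpin Q) L)
      (IsFractionRing.injective (ASpin Q) L) M (fun f => hφ f ▸ h1 _) h2 h3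
    rw [eq_top_iff]
    intro z _
    obtain ⟨x, y, -, rfl⟩ := IsFractionRing.div_surjective (ASpin Q) z
    rw [div_eq_mul_inv]
    exact M.mul_mem (h4 x) (h3 _ (h4 y))
  refine ⟨φ, hφ, ?_, ?_, ?_⟩
  · rw [extensionDegree_eq hPi hPm hPa hgen, hPd]
    split_ifs with h
    · exact Nat.two_mul_div_two_of_even h
    · exact Nat.two_mul_odd_div_two (Nat.odd_iff.1 (Nat.not_even_iff_odd.1 h))
  · rw [hadjoin]
    refine adjoin_fixed_eq
      (fun h => (IsFractionRing.algEquivOfAlgEquiv (K := L) (L := L)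
        (translate (conjPerm Q h) (conjPerm_regular Q h) (conjPerm_symm_regular Q h))).toAlgHom)
      (fun h => (IsFractionRing.algEquivOfAlgEquiv (K := K) (L := K)
        (translate (adPerm Q h) (adPerm_regular Q h) (adPerm_symm_regular Q h))).toAlgHom)
      (fun h x => ?_) (fun h => ?_) hPi hPm hPa hgen
    · exact algEquivOfAlgEquiv_comm hφ (fun f => translate_PhiStar hQ hσ (by omega) h f) x
    · exact (IsFractionRing.algEquivOfAlgEquiv_algebraMap _ (pr0Fun Q)).trans
        (congrArg (algebraMap (ASpin Q) L) (translate_pr0Fun h))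
  · rw [hadjoin]
    exact adjoin_range_eq_top hPi hPm hPa hgen

end CayleySpin

end

/-! ### The theorem. -/

open CayleySpin in
theorem theorem7p15 {V : Type*} [AddCommGroup V] [Module ℂ V] [FiniteDimensional ℂ V]
    (Q : QuadraticForm ℂ V) (hQ : (form Q).Nondegenerate) (hn : 0 < Module.finrank ℂ V)
    {S : Type*} [AddCommGroup S] [Module ℂ S] [FiniteDimensional ℂ S]
    (σ : CZ Q →ₐ[ℂ] Module.End ℂ S) (hσ : IsSpinModule Q σ) :
    -- the Cayley mapping of the spin representation is defined
    (traceForm (spinRepDiff σ)).Nondegenerate ∧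
    -- `χ = 2^{n/2} pr₀` is a choice of the square root of `det (1 + T)`
    (∀ g : Spin Q, (chi Q : Spin Q → ℂ) g ^ 2 = LinearMap.det (1 + T Q g)) ∧
    -- on `Spin(V)^*`, `Φ` is the classical Cayley transform up to the regular factor `-2 pr₀`
    (∀ g ∈ SpinStar Q,
      IsSO Q (T Q g) ∧
      IsSkew Q (Gamma (T Q g)) ∧ IsUnit (1 + Gamma (T Q g)) ∧ IsUnit (1 - Gamma (T Q g)) ∧
      ∃ w : Lie V, (∀ u : Lie V, tau Q u = Gamma (T Q g) ↔ u = w) ∧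
        Phi σ g = (-2 * pr0 Q (spinIncl Q g)) • w) ∧
    -- the function fields
    (2 ≤ Module.finrank ℂ V →
      IsDomain (ASpin Q) ∧ Function.Injective (PhiStar σ) ∧
      ∃ φ : QLie V →ₐ[ℂ] QSpin Q,
        (∀ f : ALie V, φ (algebraMap (ALie V) (QLie V) f) =
          algebraMap (ASpin Q) (QSpin Q) (PhiStar σ f)) ∧
        (extensionDegree φ.toRingHom =
          if Even (Module.finrank ℂ V) then Module.finrank ℂ V else Module.finrank ℂ V - 1) ∧
        Algebra.adjoin ℂ (φ '' (QLieInv Q : Set (QLie V)) ∪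
          {algebraMap (ASpin Q) (QSpin Q) (chi Q)}) = QSpinInv Q ∧
        Algebra.adjoin ℂ (Set.range φ ∪ {algebraMap (ASpin Q) (QSpin Q) (chi Q)}) = ⊤) := by
  refine ⟨traceForm_spin_nondegenerate hQ hn hσ, fun g => ?_,
    fun g hg => cayley_spinStar hQ hn hσ hg, fun hn2 => ?_⟩
  · rw [← two_pow_mul_pr0_sq hQ hn]
    change (((√2 : ℝ) : ℂ) ^ Module.finrank ℂ V * pr0 Q (spinIncl Q g)) ^ 2 = _
    have h : ((√2 : ℝ) : ℂ) ^ 2 = 2 := by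
      rw [← Complex.ofReal_pow, Real.sq_sqrt zero_le_two, Complex.ofReal_ofNat]
    rw [mul_pow, ← pow_mul, mul_comm _ 2, pow_mul, h]
  · have hdomain := isDomain_ASpin hQ hn2
    have := isDomain_regular (E := Lie V) (j := lieIncl V) rfl
    exact ⟨hdomain, PhiStar_injective hQ hn2 hσ,
      exists_fieldHom hQ hσ hn2 (K := QLie V) (L := QSpin Q)⟩
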